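/- **Model.** Let $T\in\{0,1,2,\dots\}$, let $(\Omega,\mathcal F,\mathbb P)$ be a probability space carrying the $N$-dimensional discounted stock price process $P=(P_t)_{0\le t\le T}$, and let $\mathcal F_t=\sigma(P_0,\dots,P_t)$. Put $\Delta\tilde P_{t+1}=\mathrm{diag}(P_t)^{-1}(P_{t+1}-P_t)$. All relations between random variables hold a.s. An effort $A=(A_t)_{t<T}$ consists of $\mathcal F_t$-measurable $\mathbb R^N$-valued $A_t$ (dollar amounts invested); it generates the wealth $W^A_t=W_0+\sum_{s<t}A_s\cdot\Delta\tilde P_{s+1}$ ($W_0\in\mathbb R$) and costs $C(A)=\sum_{t<T}c_t(A_t)$, where each $c_t:\mathbb R^N\to\mathbb R$ is strictly convex. Let $\mathcal F^A_t$ be generated by $P_s,W^A_s$, $s\le t$. *Utilities.* For $l\in\{a,p\}$ (Agent, Principal) and $t<T$ let $H^l_t:\mathbb R\to(-\infty,+\infty]$ be convex, lower semicontinuous and nondecreasing, with $(H^l_t)^*(1)=0$, where $H^*(y)=\sup_s(sy-H(s))$. Let $(\mathcal G_t)=(\mathcal F_t)$ for the Agent and $(\mathcal G_t)=(\mathcal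 F^A_t)$ for the Principal. The one-step optimized certainty equivalent of a bounded $\mathcal G_{t+1}$-measurable $X$ is $$\tilde U^l_t(X)=\operatorname{ess\,sup}_{s\in\mathbb R}\{s-\mathbb E[H^l_t(s-X)\mid\mathcal G_t]\},$$ extended to $[-\infty,\infty)$-valued $X$ by $\tilde U^l_t(X)=\lim_{n\to\infty}\lim_{m\to-\infty}\tilde U^l_t((X\wedge n)\vee m)$, and $U^l_t=\tilde U^l_t\circ\tilde U^l_{t+1}\circ\dots\circ\tilde U^l_{T-1}$ (pasting; $U^l_T$ is the identity). *Contracts.* A contract $(\Theta,\beta)$ with recommended effort $A$ consists of a real $\mathcal F_T$-measurable $\Theta$ and real $\mathcal F^A_t$-measurable $\beta_t$, $t<T$; it pays $S(B)=\Theta+\sum_{t<T}\beta_t(W^B_{t+1}-W^B_t)$ to the Agent if he exerts effort $B$. It is *incentive-compatible* if, in the Agent's recursion $V_T=\Theta$, $$V_t=\operatorname{ess\,sup}_{a\in L^0(\mathcal F_t)^N}\{U^a_t(V_{t+1}+\beta_t\,a\cdot\Delta\tilde P_{t+1})-c_t(a)\}\quad(t<T),$$ the essential supremum is attained at $a=A_t$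 for every $t<T$. It is *individually rational* if $\operatorname{ess\,sup}_B U^a_0(S(B)-C(B))\ge R$, where $B$ ranges over all efforts and $R\in\mathbb R$ is the Agent's reservation utility. An incentive-compatible, individually rational contract with effort $A$ is *optimal* if $U^p_0(W^{A'}_T-S'(A'))\le U^p_0(W^A_T-S(A))$ a.s. for every incentive-compatible, individually rational contract $(\Theta',\beta')$ with recommended effort $A'$ and payments $S'$. **Theorem.** Suppose that there are constants $0<p_-\le p_+$ with $p_-\le P^i_t\le p_+$ a.s. for all $i,t$; that for every $t<T$ the functions $H^a_t$ and $H^p_t$ are bounded from below and $1\in\mathrm{int}(\mathrm{dom}\,(H^a_t)^*)\cap\mathrm{int}(\mathrm{dom}\,(H^p_t)^*)$; and that $\lim_{|a|\to\infty}c_t(a)/|a|=\infty$ for every $t<T$. Then the dynamic Principal–Agent problem has an optimal contract $(\Theta,\beta)$ with $\beta_t=1$ for all $t$, in which the Agent keeps the generated wealth and the Principal receives a possibly path-dependent derivative on the prices: there are a Borel function $d$ of the price path and an effort $A$ such that $$S(B)=W^B_T-d(P_0,\dots,P_T)\qquad\text{for every effort }B,$$ and this contract with effort $A$ is optimal. Moreover,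 under it the Agent's optimal utility at time $0$ equals $R$, and the Principal's utility $U^p_0(W^A_T-S(A))=U^p_0(d(P_0,\dots,P_T))$ is a.s. finite. (No Markov or replicability property of $d$ is asserted.) -/

import Mathlib

open MeasureTheory Filter

/-! ### Essential suprema of families of random variables -/

/-- `g` is an `m`-measurable essential supremum of the family `S`: the a.s. smallest `m`-measurable
random variable that dominates every member of `S` almost surely. -/
structure IsEssSup {Ω : Type*} (m : MeasurableSpace Ω) {mΩ : MeasurableSpace Ω} (μ : Measure Ω)
    (S : Set (Ω → EReal)) (g : Ω → EReal) : Prop where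
  measurable : Measurable[m] g
  le : ∀ f ∈ S, f ≤ᵐ[μ] g
  least : ∀ g' : Ω → EReal, Measurable[m] g' → (∀ f ∈ S, f ≤ᵐ[μ] g') → g ≤ᵐ[μ] g'

/-- Essential suprema exist for arbitrary families. -/
theorem exists_isEssSup {Ω : Type*} {m mΩ : MeasurableSpace Ω} (hm : m ≤ mΩ) (μ : Measure Ω)
    [IsFiniteMeasure μ] (S : Set (Ω → EReal)) : ∃ g, IsEssSup m μ S g := by
  let ψ : EReal → ENNReal := fun x => (EReal.exp x + 1)⁻¹
  have hψ_inj : Function.Injective ψ := by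
    intro x y h
    have h1 : EReal.exp x + 1 = EReal.exp y + 1 := inv_injective h
    have h2 : EReal.exp x = EReal.exp y := (ENNReal.add_left_inj ENNReal.one_ne_top).1 h1
    exact EReal.expOrderIso.injective h2
  have hψ_anti : Antitone ψ := by
    intro x y h
    refine ENNReal.inv_le_inv.2 ?_
    gcongr
  have hψ_le : ∀ x, ψ x ≤ 1 := fun x => ENNReal.inv_le_one.2 le_add_self
  have hψ_meas : Measurable ψ := hψ_anti.measurable
  let G : Set (Ω → EReal) := {g | Measurable[m] g ∧ ∀ f ∈ S, f ≤ᵐ[μ] g}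
  let I : Set ENNReal := (fun g : Ω → EReal => ∫⁻ ω, ψ (g ω) ∂μ) '' G
  have hI : I.Nonempty :=
    Set.Nonempty.image _ ⟨fun _ => ⊤, measurable_const, fun f _ => .of_forall fun _ => le_top⟩
  obtain ⟨u, -, hu, huI⟩ := exists_seq_tendsto_sSup hI (OrderTop.bddAbove I)
  choose g hg hgu using huI
  have hG : (fun ω => ⨅ n, g n ω) ∈ G := by
    refine ⟨Measurable.iInf fun n => (hg n).1, fun f hf => ?_⟩
    have h := ae_all_iff.2 fun n => (hg n).2 f hf
    filter_upwards [h] with ω hω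
    exact le_iInf hω
  refine ⟨fun ω => ⨅ n, g n ω, hG.1, hG.2, fun g' hg'm hg'S => ?_⟩
  have hK : (fun ω => min (⨅ n, g n ω) (g' ω)) ∈ G := by
    refine ⟨Measurable.min hG.1 hg'm, fun f hf => ?_⟩
    filter_upwards [hG.2 f hf, hg'S f hf] with ω h1 h2
    exact le_min h1 h2
  have hsup : sSup I ≤ ∫⁻ ω, ψ (⨅ n, g n ω) ∂μ := by
    refine le_of_tendsto' hu fun n => ?_
    rw [← hgu n]
    exact lintegral_mono fun ω => hψ_anti (iInf_le _ n)
  have hle : ∫⁻ ω, ψ (min (⨅ n, g n ω) (g' ω)) ∂μ ≤ ∫⁻ ω, ψ (⨅ n, g n ω) ∂μ :=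
    le_trans (le_sSup (Set.mem_image_of_mem (fun g : Ω → EReal => ∫⁻ ω, ψ (g ω) ∂μ) hK)) hsup
  have hfin : ∫⁻ ω, ψ (⨅ n, g n ω) ∂μ ≠ ⊤ := by
    refine ne_top_of_le_ne_top (measure_ne_top μ Set.univ) ?_
    calc ∫⁻ ω, ψ (⨅ n, g n ω) ∂μ ≤ ∫⁻ _, 1 ∂μ := lintegral_mono fun ω => hψ_le _
      _ = μ Set.univ := by simp
  have hae := ae_eq_of_ae_le_of_lintegral_le
    (.of_forall fun ω => hψ_anti (min_le_left (⨅ n, g n ω) (g' ω))) hfin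
    (hψ_meas.comp (hK.1.mono hm le_rfl)).aemeasurable hle
  filter_upwards [hae] with ω hω
  exact min_eq_left_iff.1 (hψ_inj hω).symm

open Classical in
/-- The essential supremum of a family (a version; it is unique up to a.s. equality). -/
noncomputable def essSupFamily {Ω : Type*} (m : MeasurableSpace Ω) {mΩ : MeasurableSpace Ω}
    (μ : Measure Ω) (S : Set (Ω → EReal)) : Ω → EReal :=
  if h : ∃ g, IsEssSup m μ S g then h.choose else fun _ => ⊤

theorem isEssSup_essSupFamily {Ω : Type*} {m mΩ : MeasurableSpace Ω} (hm : m ≤ mΩ) (μ : Measure Ω)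
    [IsFiniteMeasure μ] (S : Set (Ω → EReal)) : IsEssSup m μ S (essSupFamily m μ S) := by
  have h := exists_isEssSup hm μ S
  rw [essSupFamily, dif_pos h]
  exact h.choose_spec

/-! ### Optimized certainty equivalents -/

/-- Conditional expectation `E[f | m] = E[f⁺ | m] - E[f⁻ | m]` of an extended random variable, used
for `f` bounded from below and possibly equal to `+∞`, for which it takes values in `(-∞, +∞]`. -/
noncomputable def condExpExt {Ω : Type*} (m : MeasurableSpace Ω) {mΩ : MeasurableSpace Ω}
    (μ : Measure Ω) (f : Ω → EReal) : Ω → EReal :=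
  fun ω => ((condLExp m μ (fun ω' => (f ω').toENNReal) ω : ENNReal) : EReal)
    - ((condLExp m μ (fun ω' => (-f ω').toENNReal) ω : ENNReal) : EReal)

/-- The convex conjugate `H*(y) = sup_s (s y - H s)`. -/
noncomputable def convexConj (H : ℝ → EReal) (y : ℝ) : EReal :=
  ⨆ s : ℝ, ((s * y : ℝ) : EReal) - H s

/-- Loss functions of optimized certainty equivalents: convex (convex epigraph), closed (lower
semicontinuous), increasing, with `H*(1) = sup_s (s - H s) = 0`. The last condition forces
`s ≤ H s`, and that `H` is not identically `+∞`; so `H` is proper. -/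
structure IsLossFunction (H : ℝ → EReal) : Prop where
  convex : Convex ℝ {p : ℝ × ℝ | H p.1 ≤ (p.2 : EReal)}
  closed : LowerSemicontinuous H
  mono : Monotone H
  normalized : convexConj H 1 = 0

/-- One-step optimized certainty equivalent of a bounded random variable:
`esssup_{s ∈ ℝ} {s - E[H (s - X) | m]}`. -/
noncomputable def oceBounded {Ω : Type*} (m : MeasurableSpace Ω) {mΩ : MeasurableSpace Ω}
    (μ : Measure Ω) (H : ℝ → EReal) (X : Ω → ℝ) : Ω → EReal :=
  essSupFamily m μ (Set.range fun (s : ℝ) (ω : Ω) =>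
    (s : EReal) - condExpExt m μ (fun ω' => H (s - X ω')) ω)

/-- Extension of the one-step optimized certainty equivalent to random variables with values in
`[-∞, +∞)`, by truncation: `lim_{n → +∞} lim_{k → +∞} U ((X ∧ n) ∨ (-k))`. The inner limit is
decreasing in `k` and the outer one increasing in `n`. -/
noncomputable def oceStep {Ω : Type*} (m : MeasurableSpace Ω) {mΩ : MeasurableSpace Ω}
    (μ : Measure Ω) (H : ℝ → EReal) (X : Ω → EReal) : Ω → EReal :=
  fun ω => ⨆ n : ℕ, ⨅ k : ℕ, oceBounded m μ H
    (fun ω' => (max ((-(k : ℝ) : ℝ) : EReal) (min (X ω') ((n : ℝ) : EReal))).toReal) ω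

/-- Composition `u t ∘ u (t + 1) ∘ ⋯ ∘ u (t + k - 1)` of one-step functionals. -/
def pasteSteps {Ω : Type*} (u : ℕ → (Ω → EReal) → (Ω → EReal)) :
    ℕ → ℕ → (Ω → EReal) → (Ω → EReal)
  | 0, _, X => X
  | k + 1, t, X => u t (pasteSteps u k (t + 1) X)

/-- The utility functional `U_t = u_t ∘ u_{t+1} ∘ ⋯ ∘ u_{T-1}` at time `t`, obtained by pasting the
one-step optimized certainty equivalents `u_t` with loss functions `H t` along the information
flow `𝒢`. -/
noncomputable def oceUtility {Ω : Type*} {mΩ : MeasurableSpace Ω} (μ : Measure Ω)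
    (𝒢 : ℕ → MeasurableSpace Ω) (T : ℕ) (H : ℕ → ℝ → EReal) (t : ℕ) (X : Ω → EReal) : Ω → EReal :=
  pasteSteps (fun s => oceStep (𝒢 s) μ (H s)) (T - t) t X

/-! ### The Principal-Agent model -/

/-- Data of the model: horizon, discounted prices of `N` stocks, cost functions of effort, loss
functions of the Agent and of the Principal, initial wealth, and the Agent's reservation utility.
Times `t ≤ T` matter for prices, times `t < T` for the other processes. -/
structure PAModel (Ω : Type*) (N : ℕ) where
  T : ℕ
  P : ℕ → Ω → EuclideanSpace ℝ (Fin N)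
  c : ℕ → EuclideanSpace ℝ (Fin N) → ℝ
  Ha : ℕ → ℝ → EReal
  Hp : ℕ → ℝ → EReal
  W₀ : ℝ
  R : ℝ

namespace PAModel

/-- The price filtration `F_t = σ(P_0, …, P_t)`. -/
abbrev priceInfo {Ω : Type*} {N : ℕ} (M : PAModel Ω N) (t : ℕ) : MeasurableSpace Ω :=
  ⨆ s : ℕ, ⨆ _ : s ≤ t, MeasurableSpace.comap (M.P s) inferInstance

/-- The gain `a · diag(P_t)⁻¹ (P_{t+1} - P_t)` of the dollar positions `a` held from `t` to
`t + 1`. -/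
noncomputable def gain {Ω : Type*} {N : ℕ} (M : PAModel Ω N) (t : ℕ)
    (a : Ω → EuclideanSpace ℝ (Fin N)) (ω : Ω) : ℝ :=
  ∑ i, a ω i * ((M.P (t + 1) ω i - M.P t ω i) / M.P t ω i)

/-- The wealth `W^A_t` generated by the effort levels `A`. -/
noncomputable def wealth {Ω : Type*} {N : ℕ} (M : PAModel Ω N)
    (A : ℕ → Ω → EuclideanSpace ℝ (Fin N)) (t : ℕ) (ω : Ω) : ℝ :=
  M.W₀ + ∑ s ∈ Finset.range t, M.gain s (A s) ω

/-- The filtration `F^A` generated by prices and by the wealth process `W^A`. -/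
noncomputable abbrev principalInfo {Ω : Type*} {N : ℕ} (M : PAModel Ω N)
    (A : ℕ → Ω → EuclideanSpace ℝ (Fin N)) (t : ℕ) : MeasurableSpace Ω :=
  M.priceInfo t ⊔ ⨆ s : ℕ, ⨆ _ : s ≤ t, MeasurableSpace.comap (M.wealth A s) inferInstance

/-- Effort levels: `A_t` is `F_t`-measurable. -/
def IsEffort {Ω : Type*} {N : ℕ} (M : PAModel Ω N)
    (A : ℕ → Ω → EuclideanSpace ℝ (Fin N)) : Prop :=
  ∀ t < M.T, Measurable[M.priceInfo t] (A t)

/-- The total cost of effort. -/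
noncomputable def cost {Ω : Type*} {N : ℕ} (M : PAModel Ω N)
    (A : ℕ → Ω → EuclideanSpace ℝ (Fin N)) (ω : Ω) : ℝ :=
  ∑ t ∈ Finset.range M.T, M.c t (A t ω)

/-- The payment `S(A) = Θ + ∑_{t < T} β_t (W^A_{t+1} - W^A_t)` to the Agent under the contract
`(Θ, β)`. -/
noncomputable def payment {Ω : Type*} {N : ℕ} (M : PAModel Ω N) (Θ : Ω → ℝ) (β : ℕ → Ω → ℝ)
    (A : ℕ → Ω → EuclideanSpace ℝ (Fin N)) (ω : Ω) : ℝ :=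
  Θ ω + ∑ t ∈ Finset.range M.T, β t ω * (M.wealth A (t + 1) ω - M.wealth A t ω)

/-- The Agent's utility functionals `U^a_t`. -/
noncomputable def agentU {Ω : Type*} {N : ℕ} {mΩ : MeasurableSpace Ω} (M : PAModel Ω N)
    (μ : Measure Ω) (t : ℕ) (X : Ω → EReal) : Ω → EReal :=
  oceUtility μ M.priceInfo M.T M.Ha t X

/-- The Principal's utility functionals `U^p_t`, for her information `F^A`. -/
noncomputable def principalU {Ω : Type*} {N : ℕ} {mΩ : MeasurableSpace Ω} (M : PAModel Ω N)
    (μ : Measure Ω) (A : ℕ → Ω → EuclideanSpace ℝ (Fin N)) (t : ℕ) (X : Ω → EReal) : Ω → EReal :=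
  oceUtility μ (M.principalInfo A) M.T M.Hp t X

/-- The Agent's one-step objective `U^a_t (X + b a ΔP̃_{t+1}) - c_t(a)`. -/
noncomputable def agentObjective {Ω : Type*} {N : ℕ} {mΩ : MeasurableSpace Ω} (M : PAModel Ω N)
    (μ : Measure Ω) (t : ℕ) (X : Ω → EReal) (b : Ω → ℝ) (a : Ω → EuclideanSpace ℝ (Fin N)) :
    Ω → EReal :=
  fun ω => M.agentU μ t (fun ω' => X ω' + ((b ω' * M.gain t a ω' : ℝ) : EReal)) ω
    - ((M.c t (a ω) : ℝ) : EReal)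

/-- `V` solves the Agent's recursion for the contract `(Θ, β)`: `V_T = Θ` and `V_t` is the essential
supremum over `a ∈ L⁰(F_t)^N` of `U^a_t (V_{t+1} + β_t a ΔP̃_{t+1}) - c_t(a)`. -/
def IsAgentValue {Ω : Type*} {N : ℕ} {mΩ : MeasurableSpace Ω} (M : PAModel Ω N)
    (μ : Measure Ω) (Θ : Ω → ℝ) (β : ℕ → Ω → ℝ) (V : ℕ → Ω → EReal) : Prop :=
  (∀ ω, V M.T ω = (Θ ω : EReal)) ∧
  ∀ t < M.T, IsEssSup (M.priceInfo t) μ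
    {Y | ∃ a : Ω → EuclideanSpace ℝ (Fin N), Measurable[M.priceInfo t] a ∧
      Y = M.agentObjective μ t (V (t + 1)) (β t) a} (V t)

/-- `(Θ, β)`, with recommended effort `A`, is a contract that is incentive-compatible: at each time
the essential supremum in the Agent's recursion is attained at `A_t`. -/
structure IsIncentiveCompatible {Ω : Type*} {N : ℕ} {mΩ : MeasurableSpace Ω} (M : PAModel Ω N)
    (μ : Measure Ω) (Θ : Ω → ℝ) (β : ℕ → Ω → ℝ)
    (A : ℕ → Ω → EuclideanSpace ℝ (Fin N)) : Prop where
  payment_measurable : Measurable[M.priceInfo M.T] Θ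
  effort : M.IsEffort A
  share_measurable : ∀ t < M.T, Measurable[M.principalInfo A t] (β t)
  attained : ∃ V : ℕ → Ω → EReal, M.IsAgentValue μ Θ β V ∧
    ∀ t < M.T, M.agentObjective μ t (V (t + 1)) (β t) (A t) =ᵐ[μ] V t

/-- The optimal utility that the Agent can obtain at time `0` from the contract `(Θ, β)`. -/
noncomputable def agentOptimalUtility {Ω : Type*} {N : ℕ} {mΩ : MeasurableSpace Ω}
    (M : PAModel Ω N) (μ : Measure Ω) (Θ : Ω → ℝ) (β : ℕ → Ω → ℝ) : Ω → EReal :=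
  essSupFamily (M.priceInfo 0) μ
    {Y | ∃ A : ℕ → Ω → EuclideanSpace ℝ (Fin N), M.IsEffort A ∧
      Y = M.agentU μ 0 (fun ω => ((M.payment Θ β A ω - M.cost A ω : ℝ) : EReal))}

/-- The contract gives the Agent at least his reservation utility. -/
def IsIndividuallyRational {Ω : Type*} {N : ℕ} {mΩ : MeasurableSpace Ω} (M : PAModel Ω N)
    (μ : Measure Ω) (Θ : Ω → ℝ) (β : ℕ → Ω → ℝ) : Prop :=
  ∀ᵐ ω ∂μ, (M.R : EReal) ≤ M.agentOptimalUtility μ Θ β ω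

/-- The Principal's utility at time `0` from `W^A_T - S(A)`, when the Agent chooses `A` under the
contract `(Θ, β)`. -/
noncomputable def principalUtility {Ω : Type*} {N : ℕ} {mΩ : MeasurableSpace Ω}
    (M : PAModel Ω N) (μ : Measure Ω) (Θ : Ω → ℝ) (β : ℕ → Ω → ℝ)
    (A : ℕ → Ω → EuclideanSpace ℝ (Fin N)) : Ω → EReal :=
  M.principalU μ A 0 (fun ω => ((M.wealth A M.T ω - M.payment Θ β A ω : ℝ) : EReal))

/-- `(Θ, β)`, with effort `A`, solves the dynamic Principal-Agent problem: it is incentive-compatible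
and individually rational, and no other such contract gives the Principal more utility. -/
structure IsOptimalContract {Ω : Type*} {N : ℕ} {mΩ : MeasurableSpace Ω} (M : PAModel Ω N)
    (μ : Measure Ω) (Θ : Ω → ℝ) (β : ℕ → Ω → ℝ)
    (A : ℕ → Ω → EuclideanSpace ℝ (Fin N)) : Prop where
  incentiveCompatible : M.IsIncentiveCompatible μ Θ β A
  individuallyRational : M.IsIndividuallyRational μ Θ β
  optimal : ∀ (Θ' : Ω → ℝ) (β' : ℕ → Ω → ℝ) (A' : ℕ → Ω → EuclideanSpace ℝ (Fin N)),
    M.IsIncentiveCompatible μ Θ' β' A' → M.IsIndividuallyRational μ Θ' β' →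
    M.principalUtility μ Θ' β' A' ≤ᵐ[μ] M.principalUtility μ Θ β A

end PAModel

/-!
The excess `L s = H s - s` of a loss function is nonnegative, so a certainty equivalent becomes
`X` minus a minimal conditional expectation of `L`. If a payoff and an effort are shared over one
period, the losses of the two sides add up, and the best that they can achieve together is found by
minimizing, over the effort `a` and one number `w`, the conditional expectation of the infimal
convolution of the excesses at `w - payoff a`, plus the cost of `a`. This is a convex problem in
finitely many variables, which are chosen measurably by minimizing in `L²`: superlinear costs and
the at least linear growth of `L`, which is what `1 ∈ int dom H*` says, make it coercive.
The pointwise optimal split is a 1-Lipschitz function of the loss, so the transfers are measurable,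
and the Agent can be left with exactly the cost of the effort.

Since certainty equivalents are translation invariant, the social surplus of the remaining periods
solves a backward recursion, and the Principal's utility in an incentive-compatible contract is at
most initial wealth plus surplus minus the utility of the Agent. If `β = 1`, the transfers become
part of the path-dependent payment; then an effort that would be better for the Agent would, with
the same transfer to the Principal, exceed the social surplus. Hence the efficient effort is optimal
for the Agent, and the bound on the Principal's utility is attained.
-/

open scoped NNReal ENNReal

/-! ### Loss functions and infimal convolution -/

section Excess

/-- The excess `H s - s` of a loss function over the identity, nonnegative by the normalization
`H*(1) = 0`. All estimates are made on it, since Mathlib integrates `[0, ∞]`-valued functions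
without integrability conditions. -/
noncomputable def lossExcess (H : ℝ → EReal) (s : ℝ) : ℝ≥0∞ := (H s - (s : EReal)).toENNReal

/-- The class of functions `lossExcess H` for loss functions `H`. Convexity is taken over `ℝ≥0`
because `ℝ` does not act on `ℝ≥0∞`; `le_add_ofReal` is the monotonicity of `H`, and
`exists_le_ofReal` its normalization. -/
structure IsLossExcess (L : ℝ → ℝ≥0∞) : Prop where
  convex : ConvexOn ℝ≥0 Set.univ L
  lsc : LowerSemicontinuous L
  le_add_ofReal : ∀ x y : ℝ, x ≤ y → L x ≤ L y + ENNReal.ofReal (y - x)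
  exists_le_ofReal : ∀ δ : ℝ, 0 < δ → ∃ r : ℝ, L r ≤ ENNReal.ofReal δ

/-- Growth at least linear in both directions. For the excess of a loss function `H`, this is what
`1 ∈ int (dom H*)` amounts to. -/
def HasLinearGrowth (L : ℝ → ℝ≥0∞) : Prop :=
  ∃ ε C : ℝ, 0 < ε ∧ ∀ s : ℝ, ENNReal.ofReal (ε * |s| - C) ≤ L s

namespace IsLossFunction

variable {H : ℝ → EReal}

theorem self_le (hH : IsLossFunction H) (s : ℝ) : (s : EReal) ≤ H s := by
  have h : ((s * 1 : ℝ) : EReal) - H s ≤ convexConj H 1 :=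
    le_iSup (fun s : ℝ => ((s * 1 : ℝ) : EReal) - H s) s
  rw [hH.normalized, mul_one] at h
  exact EReal.sub_nonpos.1 h

theorem eq_add_lossExcess (hH : IsLossFunction H) (s : ℝ) :
    H s = (s : EReal) + (lossExcess H s : EReal) := by
  have h := hH.self_le s
  rw [lossExcess, EReal.coe_toENNReal ((EReal.sub_nonneg (by simp) (by simp)).2 h)]
  induction hs : H s with
  | bot => simp
  | top => simp
  | coe x => rw [← EReal.coe_sub, ← EReal.coe_add, add_sub_cancel]

theorem lossExcess_le_coe_iff (hH : IsLossFunction H) {s : ℝ} {r : ℝ≥0} :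
    lossExcess H s ≤ r ↔ H s ≤ ((s + r : ℝ) : EReal) := by
  rw [hH.eq_add_lossExcess s]
  induction lossExcess H s with
  | top => simpa only [EReal.coe_ennreal_top, EReal.coe_add_top, top_le_iff, ENNReal.coe_ne_top,
      false_iff] using EReal.coe_ne_top (s + r)
  | coe x =>
    rw [show ((x : ℝ≥0∞) : EReal) = ((x : ℝ) : EReal) from rfl, ← EReal.coe_add,
      EReal.coe_le_coe_iff, add_le_add_iff_left, ENNReal.coe_le_coe, NNReal.coe_le_coe]

theorem measurable (hH : IsLossFunction H) : Measurable H := hH.closed.measurable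

theorem convexOn_lossExcess (hH : IsLossFunction H) :
    ConvexOn ℝ≥0 Set.univ (lossExcess H) := by
  refine ⟨convex_univ, fun x _ y _ a b _ _ hab => ?_⟩
  rcases eq_or_ne a 0 with rfl | ha
  · obtain rfl : b = 1 := by simpa using hab
    simp
  rcases eq_or_ne b 0 with rfl | hb
  · obtain rfl : a = 1 := by simpa using hab
    simp
  induction hx : lossExcess H x with
  | top => simp [ENNReal.smul_top, ha]
  | coe p =>
    induction hy : lossExcess H y with
    | top => simp [ENNReal.smul_top, hb]
    | coe q =>
      have hmem : H (a * x + b * y) ≤ ((a * (x + p) + b * (y + q) : ℝ) : EReal) :=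
        hH.convex (x := (x, x + p)) (hH.lossExcess_le_coe_iff.1 hx.le)
          (y := (y, y + q)) (hH.lossExcess_le_coe_iff.1 hy.le) a.2 b.2 (congrArg NNReal.toReal hab)
      have hcoe : a • (p : ℝ≥0∞) + b • (q : ℝ≥0∞) = ((a * p + b * q : ℝ≥0) : ℝ≥0∞) := by
        simp [ENNReal.smul_def]
      rw [hcoe, hH.lossExcess_le_coe_iff, show a • x + b • y = (a : ℝ) * x + b * y from rfl]
      convert hmem using 2
      push_cast
      ring

theorem lowerSemicontinuous_lossExcess (hH : IsLossFunction H) :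
    LowerSemicontinuous (lossExcess H) := by
  intro s y hy
  obtain ⟨z, hyz, hz⟩ := ENNReal.lt_iff_exists_nnreal_btwn.1 hy
  lift y to ℝ≥0 using hyz.ne_top
  rw [ENNReal.coe_lt_coe, ← NNReal.coe_lt_coe] at hyz
  have hHs : ((s + z : ℝ) : EReal) < H s := not_le.1 fun h =>
    hz.not_ge (hH.lossExcess_le_coe_iff.2 h)
  filter_upwards [hH.closed s _ hHs, gt_mem_nhds (show s < s + (z - y) by linarith)] with t ht hts
  refine not_le.1 fun h => ?_
  have hlt := ht.trans_le (hH.lossExcess_le_coe_iff.1 h)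
  rw [EReal.coe_lt_coe_iff] at hlt
  linarith

theorem lossExcess_le_add_ofReal (hH : IsLossFunction H) {x y : ℝ} (hxy : x ≤ y) :
    lossExcess H x ≤ lossExcess H y + ENNReal.ofReal (y - x) := by
  induction hy : lossExcess H y with
  | top => simp
  | coe q =>
    rw [ENNReal.ofReal, ← ENNReal.coe_add, hH.lossExcess_le_coe_iff]
    refine (hH.mono hxy).trans ((hH.lossExcess_le_coe_iff.1 hy.le).trans_eq ?_)
    rw [NNReal.coe_add, Real.coe_toNNReal _ (sub_nonneg.2 hxy)]
    congr 1
    ring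

theorem exists_lossExcess_le_ofReal (hH : IsLossFunction H) {δ : ℝ} (hδ : 0 < δ) :
    ∃ s : ℝ, lossExcess H s ≤ ENNReal.ofReal δ := by
  have h : ((-δ : ℝ) : EReal) < convexConj H 1 := by
    rw [hH.normalized]
    exact_mod_cast neg_lt_zero.2 hδ
  obtain ⟨s, hs⟩ := lt_iSup_iff.1 h
  refine ⟨s, hH.lossExcess_le_coe_iff.2 ?_⟩
  rw [mul_one] at hs
  induction hHs : H s with
  | bot => simp
  | top => simp [hHs] at hs
  | coe x =>
    rw [hHs, ← EReal.coe_sub, EReal.coe_lt_coe_iff] at hs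
    rw [EReal.coe_le_coe_iff, Real.coe_toNNReal _ hδ.le]
    linarith

theorem isLossExcess (hH : IsLossFunction H) : IsLossExcess (lossExcess H) where
  convex := hH.convexOn_lossExcess
  lsc := hH.lowerSemicontinuous_lossExcess
  le_add_ofReal _ _ := hH.lossExcess_le_add_ofReal
  exists_le_ofReal _ := hH.exists_lossExcess_le_ofReal

theorem exists_ofReal_mul_sub_le_lossExcess (hH : IsLossFunction H) {y : ℝ}
    (hy : convexConj H y < ⊤) :
    ∃ C : ℝ, ∀ s : ℝ, ENNReal.ofReal (s * (y - 1) - C) ≤ lossExcess H s := by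
  obtain ⟨C, hC, -⟩ := EReal.lt_iff_exists_real_btwn.1 hy
  refine ⟨C, fun s => ?_⟩
  induction hs : lossExcess H s with
  | top => exact le_top
  | coe r =>
    have hlt : ((s * y : ℝ) : EReal) - ((s + r : ℝ) : EReal) < C :=
      calc ((s * y : ℝ) : EReal) - ((s + r : ℝ) : EReal)
          ≤ ((s * y : ℝ) : EReal) - H s :=
            EReal.sub_le_sub le_rfl (hH.lossExcess_le_coe_iff.1 hs.le)
        _ ≤ convexConj H y := le_iSup (fun s : ℝ => ((s * y : ℝ) : EReal) - H s) s
        _ < C := hC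
    rw [← EReal.coe_sub, EReal.coe_lt_coe_iff] at hlt
    rw [← ENNReal.ofReal_coe_nnreal]
    exact ENNReal.ofReal_le_ofReal (by linarith)

theorem hasLinearGrowth_lossExcess (hH : IsLossFunction H)
    (h1 : (1 : ℝ) ∈ interior {y : ℝ | convexConj H y < ⊤}) : HasLinearGrowth (lossExcess H) := by
  obtain ⟨ε, hε, hball⟩ := Metric.mem_nhds_iff.1 (mem_interior_iff_mem_nhds.1 h1)
  obtain ⟨C₁, hC₁⟩ := hH.exists_ofReal_mul_sub_le_lossExcess (y := 1 + ε / 2)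
    (hball (by simp [abs_of_pos, hε]))
  obtain ⟨C₂, hC₂⟩ := hH.exists_ofReal_mul_sub_le_lossExcess (y := 1 - ε / 2)
    (hball (by simp [abs_of_pos, hε]))
  refine ⟨ε / 2, max C₁ C₂, by linarith, fun s => ?_⟩
  rcases abs_cases s with ⟨hs, -⟩ | ⟨hs, -⟩ <;> rw [hs]
  · exact (ENNReal.ofReal_le_ofReal (by linarith [le_max_left C₁ C₂])).trans (hC₁ s)
  · exact (ENNReal.ofReal_le_ofReal (by linarith [le_max_right C₁ C₂])).trans (hC₂ s)

end IsLossFunction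

end Excess

section InfimalConvolution

/-- The infimal convolution: the smallest total of the two functions when the argument is split
between them. -/
noncomputable def infConv (L₁ L₂ : ℝ → ℝ≥0∞) (w : ℝ) : ℝ≥0∞ := ⨅ u, L₁ u + L₂ (w - u)

variable {L₁ L₂ : ℝ → ℝ≥0∞} {w w' u u' : ℝ}

theorem infConv_le (L₁ L₂ : ℝ → ℝ≥0∞) (w u : ℝ) : infConv L₁ L₂ w ≤ L₁ u + L₂ (w - u) :=
  iInf_le _ u

theorem add_le_add_of_convexOn_of_add_eq {L : ℝ → ℝ≥0∞} (hL : ConvexOn ℝ≥0 Set.univ L)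
    {x y p q : ℝ} (hxp : x ≤ p) (hpy : p ≤ y) (h : p + q = x + y) : L p + L q ≤ L x + L y := by
  obtain ⟨a, b, ha, hb, hab, rfl⟩ : p ∈ segment ℝ x y := by
    rw [segment_eq_Icc (hxp.trans hpy)]
    exact ⟨hxp, hpy⟩
  lift a to ℝ≥0 using ha
  lift b to ℝ≥0 using hb
  norm_cast at hab
  obtain rfl : q = b • x + a • y := by
    have hx : x = (a : ℝ) * x + b * x := by rw [← add_mul, ← NNReal.coe_add, hab]; simp
    have hy : y = (a : ℝ) * y + b * y := by rw [← add_mul, ← NNReal.coe_add, hab]; simp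
    simp only [NNReal.smul_def, smul_eq_mul] at h ⊢
    linarith
  calc L (a • x + b • y) + L (b • x + a • y)
      ≤ (a • L x + b • L y) + (b • L x + a • L y) :=
        add_le_add (hL.2 trivial trivial zero_le zero_le hab)
          (hL.2 trivial trivial zero_le zero_le (by rwa [add_comm]))
    _ = (a + b) • L x + (a + b) • L y := by simp only [add_smul]; abel
    _ = L x + L y := by rw [hab, one_smul, one_smul]

theorem exists_isLeast_minimizers {β : Type*} [LinearOrder β] {f : ℝ → β}
    (hf : LowerSemicontinuous f) {u₀ : ℝ} (hbdd : Bornology.IsBounded {u | f u ≤ f u₀}) :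
    ∃ u, IsLeast {u | ∀ v, f u ≤ f v} u := by
  have hcompact {v : ℝ} (hv : f v ≤ f u₀) : IsCompact {u | f u ≤ f v} :=
    Metric.isCompact_of_isClosed_isBounded (hf.isClosed_preimage (f v))
      (hbdd.subset fun u (hu : f u ≤ f v) => hu.trans hv)
  obtain ⟨v, hv, hvmin⟩ :=
    (hf.lowerSemicontinuousOn _).exists_isMinOn ⟨u₀, le_refl (f u₀)⟩ (hcompact le_rfl)
  have hmin (u : ℝ) : f v ≤ f u := by
    rcases le_or_gt (f u) (f u₀) with hu | hu
    · exact hvmin hu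
    · exact le_trans hv hu.le
  obtain ⟨u, hu, hleast⟩ := (hcompact hv).exists_isLeast ⟨v, le_refl (f v)⟩
  exact ⟨u, fun u' => le_trans hu (hmin u'), fun u' hu' => hleast (hu' v)⟩

/-- The optimal splittings of `w` in the infimal convolution. -/
def optimalSplits (L₁ L₂ : ℝ → ℝ≥0∞) (w : ℝ) : Set ℝ :=
  {u | ∀ v, L₁ u + L₂ (w - u) ≤ L₁ v + L₂ (w - v)}

theorem eq_infConv_of_mem_optimalSplits (hu : u ∈ optimalSplits L₁ L₂ w) :
    L₁ u + L₂ (w - u) = infConv L₁ L₂ w :=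
  le_antisymm (le_iInf hu) (infConv_le L₁ L₂ w u)

theorem exists_isLeast_optimalSplits (h₁ : LowerSemicontinuous L₁) (h₁_growth : HasLinearGrowth L₁)
    (h₂ : LowerSemicontinuous L₂) (hw : infConv L₁ L₂ w ≠ ⊤) :
    ∃ u, IsLeast (optimalSplits L₁ L₂ w) u := by
  obtain ⟨u₀, hu₀⟩ : ∃ u, L₁ u + L₂ (w - u) < ⊤ := iInf_lt_iff.1 hw.lt_top
  obtain ⟨ε, C, hε, hC⟩ := h₁_growth
  refine exists_isLeast_minimizers (u₀ := u₀) (f := fun u => L₁ u + L₂ (w - u))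
    (h₁.add (h₂.comp (by fun_prop))) ?_
  set r : ℝ := (L₁ u₀ + L₂ (w - u₀)).toReal with hr
  refine (Metric.isBounded_closedBall (x := (0 : ℝ)) (r := (r + C) / ε)).subset fun u hu => ?_
  have h : ENNReal.ofReal (ε * |u| - C) ≤ ENNReal.ofReal r := by
    rw [hr, ENNReal.ofReal_toReal hu₀.ne]
    exact ((hC u).trans le_self_add).trans hu
  rw [ENNReal.ofReal_le_ofReal_iff ENNReal.toReal_nonneg] at h
  rw [mem_closedBall_zero_iff, Real.norm_eq_abs, le_div_iff₀ hε]
  linarith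

theorem le_of_isLeast_optimalSplits_of_le (h₂ : ConvexOn ℝ≥0 Set.univ L₂)
    (hu : IsLeast (optimalSplits L₁ L₂ w) u) (hu' : u' ∈ optimalSplits L₁ L₂ w')
    (hw' : infConv L₁ L₂ w' ≠ ⊤) (hww' : w ≤ w') : u ≤ u' := by
  by_contra! hlt
  rw [← eq_infConv_of_mem_optimalSplits hu'] at hw'
  have hexchange := add_le_add_of_convexOn_of_add_eq h₂ (x := w - u) (y := w' - u')
    (p := w - u') (q := w' - u) (by linarith) (by linarith) (by ring)
  refine hlt.not_ge (hu.2 fun v => le_trans ?_ (hu.1 v))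
  refine (ENNReal.add_le_add_iff_right hw').1 ?_
  calc L₁ u' + L₂ (w - u') + (L₁ u' + L₂ (w' - u'))
      ≤ L₁ u' + L₂ (w - u') + (L₁ u + L₂ (w' - u)) := add_le_add le_rfl (hu' u)
    _ = L₁ u' + L₁ u + (L₂ (w - u') + L₂ (w' - u)) := by ring
    _ ≤ L₁ u' + L₁ u + (L₂ (w - u) + L₂ (w' - u')) := by gcongr
    _ = L₁ u + L₂ (w - u) + (L₁ u' + L₂ (w' - u')) := by ring

theorem le_add_sub_of_isLeast_optimalSplits (h₁ : ConvexOn ℝ≥0 Set.univ L₁)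
    (hu : u ∈ optimalSplits L₁ L₂ w) (hu' : IsLeast (optimalSplits L₁ L₂ w') u')
    (hw : infConv L₁ L₂ w ≠ ⊤) (hww' : w ≤ w') : u' ≤ u + (w' - w) := by
  by_contra! hlt
  rw [← eq_infConv_of_mem_optimalSplits hu] at hw
  have hexchange := add_le_add_of_convexOn_of_add_eq h₁ (x := u) (y := u')
    (p := u' - (w' - w)) (q := u + (w' - w)) (by linarith) (by linarith) (by ring)
  refine hlt.not_ge (hu'.2 fun v => le_trans ?_ (hu'.1 v))
  refine (ENNReal.add_le_add_iff_left hw).1 ?_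
  have hcomp : w' - (u + (w' - w)) = w - u := by ring
  have hcomp' : w - (u' - (w' - w)) = w' - u' := by ring
  calc L₁ u + L₂ (w - u) + (L₁ (u + (w' - w)) + L₂ (w' - (u + (w' - w))))
      ≤ L₁ (u' - (w' - w)) + L₂ (w - (u' - (w' - w)))
        + (L₁ (u + (w' - w)) + L₂ (w' - (u + (w' - w)))) := add_le_add (hu _) le_rfl
    _ = L₁ (u' - (w' - w)) + L₁ (u + (w' - w)) + (L₂ (w' - u') + L₂ (w - u)) := by
        rw [hcomp, hcomp']; ring
    _ ≤ L₁ u + L₁ u' + (L₂ (w' - u') + L₂ (w - u)) := by gcongr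
    _ = L₁ u + L₂ (w - u) + (L₁ u' + L₂ (w' - u')) := by ring

theorem exists_lipschitz_eq_infConv (h₁ : IsLossExcess L₁) (h₁_growth : HasLinearGrowth L₁)
    (h₂ : IsLossExcess L₂) :
    ∃ g : ℝ → ℝ, LipschitzWith 1 g ∧ ∀ w, L₁ (g w) + L₂ (w - g w) = infConv L₁ L₂ w := by
  set D : Set ℝ := {w | infConv L₁ L₂ w ≠ ⊤}
  have hsel (w : ℝ) : ∃ u, w ∈ D → IsLeast (optimalSplits L₁ L₂ w) u := by
    by_cases hw : w ∈ D
    · exact (exists_isLeast_optimalSplits h₁.lsc h₁_growth h₂.lsc hw).imp fun _ hu _ => hu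
    · exact ⟨0, fun h => absurd h hw⟩
  choose φ hφ using hsel
  have hlip : LipschitzOnWith 1 φ D := by
    refine LipschitzOnWith.of_le_add_mul 1 fun x hx y hy => ?_
    rw [NNReal.coe_one, one_mul, Real.dist_eq]
    rcases le_total x y with h | h
    · linarith [le_of_isLeast_optimalSplits_of_le h₂.convex (hφ x hx) (hφ y hy).1 hy h,
        abs_nonneg (x - y)]
    · linarith [le_add_sub_of_isLeast_optimalSplits h₁.convex (hφ y hy).1 (hφ x hx) hy h,
        le_abs_self (x - y)]
  obtain ⟨g, hg, hgφ⟩ := hlip.extend_real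
  refine ⟨g, hg, fun w => ?_⟩
  by_cases hw : w ∈ D
  · rw [← hgφ hw, eq_infConv_of_mem_optimalSplits (hφ w hw).1]
  · have htop : infConv L₁ L₂ w = ⊤ := not_not.1 hw
    exact (top_le_iff.1 (htop ▸ infConv_le L₁ L₂ w (g w))).trans htop.symm

theorem isLossExcess_infConv (h₁ : IsLossExcess L₁) (h₁_growth : HasLinearGrowth L₁)
    (h₂ : IsLossExcess L₂) : IsLossExcess (infConv L₁ L₂) := by
  obtain ⟨g, hg, hgeq⟩ := exists_lipschitz_eq_infConv h₁ h₁_growth h₂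
  refine ⟨⟨convex_univ, fun x _ y _ a b _ _ hab => ?_⟩, ?_, fun x y hxy => ?_, fun δ hδ => ?_⟩
  · refine (infConv_le L₁ L₂ _ (a • g x + b • g y)).trans ?_
    rw [← hgeq x, ← hgeq y, show a • x + b • y - (a • g x + b • g y)
      = a • (x - g x) + b • (y - g y) by simp only [smul_sub]; abel]
    calc L₁ (a • g x + b • g y) + L₂ (a • (x - g x) + b • (y - g y))
        ≤ (a • L₁ (g x) + b • L₁ (g y)) + (a • L₂ (x - g x) + b • L₂ (y - g y)) :=
          add_le_add (h₁.convex.2 trivial trivial zero_le zero_le hab)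
            (h₂.convex.2 trivial trivial zero_le zero_le hab)
      _ = a • (L₁ (g x) + L₂ (x - g x)) + b • (L₁ (g y) + L₂ (y - g y)) := by
          simp only [smul_add]; abel
  · rw [← funext hgeq]
    exact (h₁.lsc.comp hg.continuous).add (h₂.lsc.comp (by have := hg.continuous; fun_prop))
  · calc infConv L₁ L₂ x ≤ L₁ (g y - (y - x)) + L₂ (x - (g y - (y - x))) :=
          infConv_le L₁ L₂ x _
      _ ≤ L₁ (g y) + ENNReal.ofReal (y - x) + L₂ (y - g y) := by
          refine add_le_add ?_ (le_of_eq (by congr 1; ring))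
          simpa only [sub_sub_cancel] using
            h₁.le_add_ofReal (g y - (y - x)) (g y) (sub_le_self _ (sub_nonneg.2 hxy))
      _ = infConv L₁ L₂ y + ENNReal.ofReal (y - x) := by rw [← hgeq y]; ring
  · obtain ⟨r₁, hr₁⟩ := h₁.exists_le_ofReal (δ / 2) (half_pos hδ)
    obtain ⟨r₂, hr₂⟩ := h₂.exists_le_ofReal (δ / 2) (half_pos hδ)
    refine ⟨r₁ + r₂, (infConv_le L₁ L₂ _ r₁).trans ?_⟩
    rw [add_sub_cancel_left]
    refine (add_le_add hr₁ hr₂).trans_eq ?_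
    rw [← ENNReal.ofReal_add (half_pos hδ).le (half_pos hδ).le, add_halves]

theorem hasLinearGrowth_infConv (h₁ : HasLinearGrowth L₁) (h₂ : HasLinearGrowth L₂) :
    HasLinearGrowth (infConv L₁ L₂) := by
  obtain ⟨ε₁, C₁, hε₁, hC₁⟩ := h₁
  obtain ⟨ε₂, C₂, hε₂, hC₂⟩ := h₂
  refine ⟨min ε₁ ε₂, C₁ + C₂, lt_min hε₁ hε₂, fun w => le_iInf fun u => ?_⟩
  have hsplit : min ε₁ ε₂ * |w| ≤ ε₁ * |u| + ε₂ * |w - u| :=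
    calc min ε₁ ε₂ * |w| = min ε₁ ε₂ * |u + (w - u)| := by rw [add_sub_cancel]
      _ ≤ min ε₁ ε₂ * (|u| + |w - u|) :=
          mul_le_mul_of_nonneg_left (abs_add_le _ _) (lt_min hε₁ hε₂).le
      _ = min ε₁ ε₂ * |u| + min ε₁ ε₂ * |w - u| := mul_add _ _ _
      _ ≤ ε₁ * |u| + ε₂ * |w - u| := by gcongr; exacts [min_le_left _ _, min_le_right _ _]
  calc ENNReal.ofReal (min ε₁ ε₂ * |w| - (C₁ + C₂))
      ≤ ENNReal.ofReal ((ε₁ * |u| - C₁) + (ε₂ * |w - u| - C₂)) :=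
        ENNReal.ofReal_le_ofReal (by linarith)
    _ ≤ ENNReal.ofReal (ε₁ * |u| - C₁) + ENNReal.ofReal (ε₂ * |w - u| - C₂) :=
        ENNReal.ofReal_add_le
    _ ≤ L₁ u + L₂ (w - u) := add_le_add (hC₁ u) (hC₂ (w - u))

end InfimalConvolution

/-! ### Convex minimization -/

section HilbertSpace

variable {E : Type*} [NormedAddCommGroup E] [InnerProductSpace ℝ E]

theorem norm_sub_le_sqrt_of_norm_le_of_convex {C : Set E} (hconv : Convex ℝ C) {v w : E}
    (hv : v ∈ C) (hw : w ∈ C) (hmin : ∀ u ∈ C, ‖v‖ ≤ ‖u‖) {ℓ : ℝ} (hℓ : ‖w‖ ≤ ℓ) :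
    ‖v - w‖ ≤ √(2 * (ℓ ^ 2 - ‖v‖ ^ 2)) := by
  have hmid := hmin _ (hconv hv hw (by norm_num : (0 : ℝ) ≤ 1 / 2) (by norm_num : (0 : ℝ) ≤ 1 / 2)
    (by norm_num))
  rw [← smul_add, norm_smul, Real.norm_of_nonneg (by norm_num : (0 : ℝ) ≤ 1 / 2)] at hmid
  have hsum : (2 * ‖v‖) ^ 2 ≤ ‖v + w‖ ^ 2 := pow_le_pow_left₀ (by positivity) (by linarith) 2
  have hw_sq : ‖w‖ ^ 2 ≤ ℓ ^ 2 := pow_le_pow_left₀ (norm_nonneg _) hℓ 2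
  refine Real.le_sqrt_of_sq_le ?_
  linarith [parallelogram_law_with_norm ℝ v w]

variable [CompleteSpace E]

theorem exists_norm_le_of_isClosed_of_convex {C : Set E} (hne : C.Nonempty) (hcl : IsClosed C)
    (hconv : Convex ℝ C) : ∃ v ∈ C, ∀ w ∈ C, ‖v‖ ≤ ‖w‖ := by
  obtain ⟨v, hv, hmin⟩ := exists_norm_eq_iInf_of_complete_convex hne hcl.isComplete hconv 0
  refine ⟨v, hv, fun w hw => ?_⟩
  have hbdd : BddBelow (Set.range fun w : C => ‖(0 : E) - w‖) :=
    ⟨0, Set.forall_mem_range.2 fun _ => norm_nonneg _⟩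
  have hle := hmin.trans_le (ciInf_le hbdd ⟨w, hw⟩)
  simpa only [zero_sub, norm_neg] using hle

theorem nonempty_iInter_of_antitone_of_convex {C : ℕ → Set E} (hanti : Antitone C)
    (hne : ∀ n, (C n).Nonempty) (hcl : ∀ n, IsClosed (C n)) (hconv : ∀ n, Convex ℝ (C n))
    (hbdd : Bornology.IsBounded (C 0)) : (⋂ n, C n).Nonempty := by
  choose v hvC hvmin using fun n => exists_norm_le_of_isClosed_of_convex (hne n) (hcl n) (hconv n)
  obtain ⟨K, hK⟩ := hbdd.exists_norm_le
  have hmono : Monotone fun n => ‖v n‖ := fun n k hnk => hvmin n _ (hanti hnk (hvC k))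
  have hbdd : BddAbove (Set.range fun n => ‖v n‖) :=
    ⟨K, Set.forall_mem_range.2 fun n => hK _ (hanti (Nat.zero_le n) (hvC n))⟩
  have hlim := tendsto_atTop_ciSup hmono hbdd
  set ℓ := ⨆ n, ‖v n‖
  have hdist : ∀ n k, n ≤ k → dist (v n) (v k) ≤ √(2 * (ℓ ^ 2 - ‖v n‖ ^ 2)) := fun n k hnk => by
    rw [dist_eq_norm]
    exact norm_sub_le_sqrt_of_norm_le_of_convex (hconv n) (hvC n) (hanti hnk (hvC k)) (hvmin n)
      (le_ciSup hbdd k)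
  have hcauchy : CauchySeq v := by
    refine cauchySeq_of_le_tendsto_0' _ hdist ?_
    have hsqrt := (((hlim.pow 2).const_sub (ℓ ^ 2)).const_mul 2).sqrt
    rwa [sub_self, mul_zero, Real.sqrt_zero] at hsqrt
  obtain ⟨x, hx⟩ := cauchySeq_tendsto_of_complete hcauchy
  refine ⟨x, Set.mem_iInter.2 fun n => (hcl n).mem_of_tendsto hx ?_⟩
  filter_upwards [eventually_ge_atTop n] with k hk using hanti hk (hvC k)

theorem exists_isMinOn_of_convexOn {S : Set E} (hne : S.Nonempty) (hcl : IsClosed S)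
    (hbdd : Bornology.IsBounded S) {F : E → ℝ≥0∞} (hF_lsc : LowerSemicontinuous F)
    (hF : ConvexOn ℝ≥0 S F) : ∃ x ∈ S, IsMinOn F S x := by
  obtain ⟨u, hanti, hlim, hu⟩ := exists_seq_tendsto_sInf (hne.image F) (OrderBot.bddBelow _)
  choose y hyS hyu using hu
  have hconv : ∀ r, Convex ℝ {x | x ∈ S ∧ F x ≤ r} := fun r x hx z hz a b ha hb hab =>
    hF.convex_le r hx hz (zero_le (a := (⟨a, ha⟩ : ℝ≥0))) (zero_le (a := (⟨b, hb⟩ : ℝ≥0)))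
      (NNReal.eq hab)
  obtain ⟨x, hx⟩ := nonempty_iInter_of_antitone_of_convex
    (C := fun n => {x | x ∈ S ∧ F x ≤ u n}) (fun n k hnk x hx => ⟨hx.1, hx.2.trans (hanti hnk)⟩)
    (fun n => ⟨y n, hyS n, (hyu n).le⟩) (fun n => hcl.inter (hF_lsc.isClosed_preimage (u n)))
    (fun n => hconv _) (hbdd.subset fun x hx => hx.1)
  rw [Set.mem_iInter] at hx
  exact ⟨x, (hx 0).1, fun z hz => (ge_of_tendsto' hlim fun n => (hx n).2).trans
    (sInf_le (Set.mem_image_of_mem F hz))⟩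

end HilbertSpace

section Lp

variable {Ω : Type*} {m : MeasurableSpace Ω} {ν : Measure Ω} {E : Type*} [NormedAddCommGroup E]
  {p : ℝ≥0∞}

theorem isClosed_setOf_ae_mem [Fact (1 ≤ p)] {C : Set E} (hC : IsClosed C) :
    IsClosed {f : Lp E p ν | ∀ᵐ ω ∂ν, f ω ∈ C} := by
  refine IsSeqClosed.isClosed fun f g hf hfg => ?_
  obtain ⟨k, -, hk⟩ := (tendstoInMeasure_of_tendsto_Lp hfg).exists_seq_tendsto_ae
  filter_upwards [hk, ae_all_iff.2 fun i => hf (k i)] with ω hlim hmem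
  exact hC.mem_of_tendsto hlim (.of_forall hmem)

theorem coeFn_smul_add_smul [NormedSpace ℝ E] (f g : Lp E p ν) (a b : ℝ) :
    ⇑(a • f + b • g) =ᵐ[ν] fun ω => a • f ω + b • g ω := by
  filter_upwards [Lp.coeFn_add (a • f) (b • g), Lp.coeFn_smul a f, Lp.coeFn_smul b g]
    with ω hadd hf hg
  rw [hadd, Pi.add_apply, hf, hg, Pi.smul_apply, Pi.smul_apply]

theorem convex_setOf_ae_mem [NormedSpace ℝ E] {C : Set E} (hC : Convex ℝ C) :
    Convex ℝ {f : Lp E p ν | ∀ᵐ ω ∂ν, f ω ∈ C} := by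
  intro f hf g hg a b ha hb hab
  rw [Set.mem_ofPred_eq] at hf hg ⊢
  filter_upwards [coeFn_smul_add_smul f g a b, hf, hg] with ω hω hfω hgω
  rw [hω]
  exact hC hfω hgω ha hb hab

theorem isBounded_setOf_ae_mem [Fact (1 ≤ p)] [IsFiniteMeasure ν] {C : Set E}
    (hC : Bornology.IsBounded C) : Bornology.IsBounded {f : Lp E p ν | ∀ᵐ ω ∂ν, f ω ∈ C} := by
  obtain ⟨K, hK0, hK⟩ := hC.exists_pos_norm_le
  refine isBounded_iff_forall_norm_le.2 ⟨_, fun f hf => Lp.norm_le_of_ae_bound hK0.le ?_⟩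
  filter_upwards [hf] with ω hω using hK _ hω

end Lp

section CondLExp

variable {Ω : Type*} {m mΩ : MeasurableSpace Ω} {μ : Measure Ω}

theorem condLExp_mono_on (hm : m ≤ mΩ) [SigmaFinite (μ.trim hm)] {f g : Ω → ℝ≥0∞} {A : Set Ω}
    (hA : MeasurableSet[m] A) (h : ∀ᵐ ω ∂μ, ω ∈ A → f ω ≤ g ω) :
    ∀ᵐ ω ∂μ, ω ∈ A → condLExp m μ f ω ≤ condLExp m μ g ω := by
  have hle : A.indicator (condLExp m μ f) ≤ᵐ[μ] A.indicator (condLExp m μ g) := by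
    refine ae_le_of_ae_le_trim (hm := hm) (ae_le_of_forall_setLIntegral_le_of_sigmaFinite
      (μ := μ.trim hm) ((measurable_condLExp m μ f).indicator hA) fun s hs _ => ?_)
    rw [setLIntegral_indicator hA, setLIntegral_indicator hA,
      setLIntegral_condLExp_trim hm _ _ (hA.inter hs),
      setLIntegral_condLExp_trim hm _ _ (hA.inter hs)]
    refine setLIntegral_mono_ae' (hm _ (hA.inter hs)) ?_
    filter_upwards [h] with ω hω hωA using hω hωA.1
  filter_upwards [hle] with ω hω hωA
  simpa [hωA] using hω

theorem condLExp_add_measurable (hm : m ≤ mΩ) [SigmaFinite (μ.trim hm)] (f : Ω → ℝ≥0∞)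
    {g : Ω → ℝ≥0∞} (hg : Measurable[m] g) :
    condLExp m μ (fun ω => f ω + g ω) =ᵐ[μ] fun ω => condLExp m μ f ω + g ω := by
  have h := condLExp_add_right (mΩ := m) (P := μ) f (hg.mono hm le_rfl).aemeasurable
  rwa [condLExp_eq_self hm μ hg] at h

theorem condLExp_le_of_lintegral_le (hm : m ≤ mΩ) [SigmaFinite (μ.trim hm)]
    {E : Type*} [MeasurableSpace E]
    {ψ : Ω → E → ℝ≥0∞} {C : Set E}
    {x : Ω → E} (hx_meas : Measurable[m] x) (hxC : ∀ ω, x ω ∈ C) (hx : ∫⁻ ω, ψ ω (x ω) ∂μ ≠ ∞)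
    (hmin : ∀ y : Ω → E, Measurable[m] y → (∀ ω, y ω ∈ C) →
      ∫⁻ ω, ψ ω (x ω) ∂μ ≤ ∫⁻ ω, ψ ω (y ω) ∂μ)
    {y : Ω → E} (hy_meas : Measurable[m] y) (hyC : ∀ ω, y ω ∈ C) :
    condLExp m μ (fun ω => ψ ω (x ω)) ≤ᵐ[μ] condLExp m μ (fun ω => ψ ω (y ω)) := by
  classical
  refine ae_le_of_ae_le_trim (hm := hm) (ae_le_of_forall_setLIntegral_le_of_sigmaFinite
    (μ := μ.trim hm) (measurable_condLExp m μ _) fun s hs _ => ?_)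
  rw [setLIntegral_condLExp_trim hm _ _ hs, setLIntegral_condLExp_trim hm _ _ hs]
  have hpaste := hmin (s.piecewise y x) (hy_meas.piecewise hs hx_meas)
    fun ω => by by_cases h : ω ∈ s <;> simp [h, hyC, hxC]
  have hon : ∫⁻ ω in s, ψ ω (s.piecewise y x ω) ∂μ = ∫⁻ ω in s, ψ ω (y ω) ∂μ :=
    setLIntegral_congr_fun (hm s hs) fun ω hω => by simp [hω]
  have hoff : ∫⁻ ω in sᶜ, ψ ω (s.piecewise y x ω) ∂μ = ∫⁻ ω in sᶜ, ψ ω (x ω) ∂μ :=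
    setLIntegral_congr_fun (hm s hs).compl fun ω (hω : ω ∉ s) => by simp [hω]
  rw [← lintegral_add_compl _ (hm s hs), ← lintegral_add_compl (fun ω => ψ ω (s.piecewise y x ω))
    (hm s hs), hon, hoff] at hpaste
  exact (ENNReal.add_le_add_iff_right
    (ne_top_of_le_ne_top hx (setLIntegral_le_lintegral _ _))).1 hpaste

end CondLExp

section ConvexIntegrand

variable {Ω : Type*} {E : Type*} [NormedAddCommGroup E] [MeasurableSpace E]

/-- Random `[0, ∞]`-valued functionals on `E` that can be composed with random vectors and are
convex and lower semicontinuous for every `ω` (convex normal integrands). -/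
structure IsConvexIntegrand [NormedSpace ℝ E] [MeasurableSpace Ω] (ψ : Ω → E → ℝ≥0∞) : Prop where
  measurable_comp : ∀ {x : Ω → E}, Measurable x → Measurable fun ω => ψ ω (x ω)
  convex : ∀ ω, ConvexOn ℝ≥0 Set.univ (ψ ω)
  lsc : ∀ ω, LowerSemicontinuous (ψ ω)

variable {m mΩ : MeasurableSpace Ω} {μ : Measure Ω} {ψ : Ω → E → ℝ≥0∞}

namespace IsConvexIntegrand

variable {p : ℝ≥0∞} [BorelSpace E]

theorem lowerSemicontinuous_lintegral [NormedSpace ℝ E] [Fact (1 ≤ p)]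
    (hψ : IsConvexIntegrand ψ) (hm : m ≤ mΩ) :
    LowerSemicontinuous fun f : Lp E p (μ.trim hm) => ∫⁻ ω, ψ ω (f ω) ∂μ := by
  refine lowerSemicontinuous_iff_isClosed_preimage.2 fun r =>
    IsSeqClosed.isClosed fun f g hf hfg => ?_
  obtain ⟨k, -, hk⟩ := (tendstoInMeasure_of_tendsto_Lp hfg).exists_seq_tendsto_ae
  have hmeas : ∀ i, Measurable fun ω => ψ ω (f (k i) ω) := fun i =>
    hψ.measurable_comp ((Lp.stronglyMeasurable (f (k i))).measurable.mono hm le_rfl)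
  calc ∫⁻ ω, ψ ω (g ω) ∂μ ≤ ∫⁻ ω, liminf (fun i => ψ ω (f (k i) ω)) atTop ∂μ := by
        refine lintegral_mono_ae ?_
        filter_upwards [ae_of_ae_trim hm hk] with ω hω
        exact (lowerSemicontinuousAt_iff_le_liminf.1 (hψ.lsc ω (g ω))).trans
          (liminf_le_liminf_of_le hω)
    _ ≤ liminf (fun i => ∫⁻ ω, ψ ω (f (k i) ω) ∂μ) atTop := lintegral_liminf_le hmeas
    _ ≤ r := liminf_le_of_le (by isBoundedDefault) fun b hb =>
        hb.exists.elim fun i hi => hi.trans (hf (k i))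

theorem convexOn_lintegral [NormedSpace ℝ E] (hψ : IsConvexIntegrand ψ) (hm : m ≤ mΩ) :
    ConvexOn ℝ≥0 Set.univ fun f : Lp E p (μ.trim hm) => ∫⁻ ω, ψ ω (f ω) ∂μ := by
  refine ⟨convex_univ, fun f _ g _ a b ha hb hab => ?_⟩
  have hmeas : ∀ f : Lp E p (μ.trim hm), Measurable fun ω => ψ ω (f ω) := fun f =>
    hψ.measurable_comp ((Lp.stronglyMeasurable f).measurable.mono hm le_rfl)
  calc ∫⁻ ω, ψ ω ((a • f + b • g : Lp E p (μ.trim hm)) ω) ∂μ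
      ≤ ∫⁻ ω, (a * ψ ω (f ω) + b * ψ ω (g ω)) ∂μ := by
        refine lintegral_mono_ae ?_
        filter_upwards [ae_of_ae_trim hm (coeFn_smul_add_smul f g a b)] with ω hω
        exact (congrArg (ψ ω) hω).trans_le
          ((hψ.convex ω).2 (Set.mem_univ (f ω)) (Set.mem_univ (g ω)) ha hb hab)
    _ = a • ∫⁻ ω, ψ ω (f ω) ∂μ + b • ∫⁻ ω, ψ ω (g ω) ∂μ := by
        rw [lintegral_add_left ((hmeas f).const_mul _), lintegral_const_mul _ (hmeas f),
          lintegral_const_mul _ (hmeas g)]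
        rfl

variable [InnerProductSpace ℝ E] [CompleteSpace E] [SecondCountableTopology E]

theorem exists_measurable_lintegral_minimizer [IsFiniteMeasure μ] (hψ : IsConvexIntegrand ψ)
    (hm : m ≤ mΩ) {C : Set E} (hne : C.Nonempty) (hcl : IsClosed C) (hconv : Convex ℝ C)
    (hbdd : Bornology.IsBounded C) :
    ∃ x : Ω → E, Measurable[m] x ∧ (∀ ω, x ω ∈ C) ∧
      ∀ y : Ω → E, Measurable[m] y → (∀ ω, y ω ∈ C) →
        ∫⁻ ω, ψ ω (x ω) ∂μ ≤ ∫⁻ ω, ψ ω (y ω) ∂μ := by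
  classical
  obtain ⟨x₀, hx₀⟩ := hne
  obtain ⟨K, hK⟩ := hbdd.exists_norm_le
  have hLp : ∀ y : Ω → E, Measurable[m] y → (∀ ω, y ω ∈ C) →
      ∃ f : Lp E 2 (μ.trim hm), f =ᵐ[μ.trim hm] y := fun y hy hyC =>
    ⟨_, (MemLp.of_bound hy.stronglyMeasurable.aestronglyMeasurable K
      (.of_forall fun ω => hK _ (hyC ω))).coeFn_toLp⟩
  obtain ⟨f₀, hf₀⟩ := hLp (fun _ => x₀) measurable_const fun _ => hx₀
  obtain ⟨f, hfC, hf⟩ := exists_isMinOn_of_convexOn (S := {f : Lp E 2 (μ.trim hm) |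
      ∀ᵐ ω ∂μ.trim hm, f ω ∈ C}) ⟨f₀, by filter_upwards [hf₀] with ω hω; rwa [hω]⟩
    (isClosed_setOf_ae_mem hcl) (isBounded_setOf_ae_mem hbdd)
    (hψ.lowerSemicontinuous_lintegral (μ := μ) hm)
    ((hψ.convexOn_lintegral hm).subset (Set.subset_univ _)
      ((convex_setOf_ae_mem hconv).lift ℝ≥0))
  have hf_meas : Measurable[m] f := (Lp.stronglyMeasurable f).measurable
  refine ⟨fun ω => if f ω ∈ C then f ω else x₀,
    Measurable.ite (hf_meas hcl.measurableSet) hf_meas measurable_const,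
    fun ω => by dsimp only; split_ifs with h <;> assumption, fun y hy hyC => ?_⟩
  obtain ⟨g, hg⟩ := hLp y hy hyC
  calc ∫⁻ ω, ψ ω (if f ω ∈ C then f ω else x₀) ∂μ = ∫⁻ ω, ψ ω (f ω) ∂μ :=
        lintegral_congr_ae (by filter_upwards [ae_of_ae_trim hm hfC] with ω hω; rw [if_pos hω])
    _ ≤ ∫⁻ ω, ψ ω (g ω) ∂μ := hf (by filter_upwards [hg] with ω hω; rw [hω]; exact hyC ω)
    _ = ∫⁻ ω, ψ ω (y ω) ∂μ :=
        lintegral_congr_ae (by filter_upwards [ae_of_ae_trim hm hg] with ω hω; rw [hω])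

theorem exists_measurable_condLExp_minimizer [IsFiniteMeasure μ] (hψ : IsConvexIntegrand ψ)
    (hm : m ≤ mΩ) {x₀ : E} {C : ℝ≥0∞} (hC : C ≠ ∞) {K : ℝ} (hx₀ : ‖x₀‖ ≤ K)
    (hψ_x₀ : ∀ᵐ ω ∂μ, ψ ω x₀ ≤ C) (hψ_growth : ∀ᵐ ω ∂μ, ∀ x, K < ‖x‖ → C ≤ ψ ω x) :
    ∃ x : Ω → E, Measurable[m] x ∧ (∀ ω, ‖x ω‖ ≤ K) ∧ ∀ y : Ω → E, Measurable[m] y →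
      condLExp m μ (fun ω => ψ ω (x ω)) ≤ᵐ[μ] condLExp m μ (fun ω => ψ ω (y ω)) := by
  classical
  have hx₀K : x₀ ∈ Metric.closedBall (0 : E) K := mem_closedBall_zero_iff.2 hx₀
  obtain ⟨x, hx, hxK, hmin⟩ := hψ.exists_measurable_lintegral_minimizer (μ := μ) hm ⟨x₀, hx₀K⟩
    Metric.isClosed_closedBall (convex_closedBall _ _) Metric.isBounded_closedBall
  have hfin : ∫⁻ ω, ψ ω (x ω) ∂μ ≠ ∞ :=
    ne_top_of_le_ne_top (ENNReal.mul_ne_top hC (measure_ne_top μ Set.univ))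
      (((hmin _ measurable_const fun _ => hx₀K).trans (lintegral_mono_ae hψ_x₀)).trans_eq
        (lintegral_const C))
  refine ⟨x, hx, fun ω => mem_closedBall_zero_iff.1 (hxK ω), fun y hy => ?_⟩
  have hle := condLExp_le_of_lintegral_le hm hx hxK hfin hmin
    (y := fun ω => if y ω ∈ Metric.closedBall 0 K then y ω else x₀)
    (.ite (hy measurableSet_closedBall) hy measurable_const)
    (fun ω => by split_ifs with h <;> assumption)
  refine hle.trans (condLExp_mono ?_)
  filter_upwards [hψ_x₀, hψ_growth] with ω h_x₀ h_growth
  split_ifs with h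
  · exact le_rfl
  · exact h_x₀.trans (h_growth _ (not_le.1 (mt mem_closedBall_zero_iff.2 h)))

end IsConvexIntegrand

end ConvexIntegrand

/-! ### Extended real arithmetic -/

section ExtendedReals

theorem le_coe_sub_comm {x y : EReal} {r : ℝ} (h : x ≤ (r : EReal) - y) :
    y ≤ (r : EReal) - x := by
  rw [EReal.le_sub_iff_add_le (by simp) (by simp)] at h ⊢
  rwa [add_comm]

theorem ereal_le_of_forall_sub_one_div_le {a b : EReal}
    (h : ∀ n : ℕ, a - ((1 / ((n : ℝ) + 1) : ℝ) : EReal) ≤ b) : a ≤ b := by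
  induction a with
  | bot => exact bot_le
  | top => exact (EReal.top_sub_coe _).symm.trans_le (h 0)
  | coe r =>
    have hlim : Tendsto (fun n : ℕ => r - 1 / ((n : ℝ) + 1)) atTop (nhds r) := by
      simpa using tendsto_one_div_add_atTop_nhds_zero_nat.const_sub r
    exact le_of_tendsto' (EReal.tendsto_coe.2 hlim) h

theorem coe_sub_coe_add_ofReal {K δ : ℝ} (hδ : 0 ≤ δ) (R : ℝ≥0∞) :
    (K : EReal) - ((R + ENNReal.ofReal δ : ℝ≥0∞) : EReal) =
      (K : EReal) - (R : EReal) - (δ : EReal) := by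
  rw [EReal.coe_ennreal_add, EReal.coe_ennreal_ofReal, max_eq_left hδ]
  simp only [sub_eq_add_neg]
  rw [EReal.neg_add (by simp) (by simp), sub_eq_add_neg, add_assoc]

theorem coe_sub_sub_coe_sub (s t : ℝ) (x : EReal) :
    (s : EReal) - (x - ((t - s : ℝ) : EReal)) = (t : EReal) - x := by
  induction x with
  | bot => simp
  | top => rw [EReal.top_sub_coe, EReal.sub_top, EReal.sub_top]
  | coe x =>
    norm_cast
    ring

theorem coe_add_sub_sub_coe_sub (s t r : ℝ) (x : EReal) :
    ((s + t : ℝ) : EReal) - x - ((t - r : ℝ) : EReal) = (s : EReal) - x + (r : EReal) := by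
  induction x with
  | bot =>
    rw [EReal.coe_sub_bot, EReal.coe_sub_bot, EReal.top_sub_coe, EReal.top_add_coe]
  | top => simp
  | coe x =>
    norm_cast
    ring

theorem toENNReal_add_coe_add {x : EReal} {C : ℝ} (h : ((-C : ℝ) : EReal) ≤ x) :
    (x + C).toENNReal + ((-x).toENNReal + ENNReal.ofReal (-C)) =
      x.toENNReal + ENNReal.ofReal C := by
  induction x with
  | bot => exact absurd h (EReal.bot_lt_coe _).not_ge
  | top => simp
  | coe x =>
    rw [EReal.coe_le_coe_iff] at h
    simp only [← EReal.coe_add, ← EReal.coe_neg,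
      EReal.toENNReal_of_ne_top (EReal.coe_ne_top _), EReal.toReal_coe]
    rw [← ENNReal.toReal_eq_toReal_iff' (by finiteness) (by finiteness)]
    repeat rw [ENNReal.toReal_add (by finiteness) (by finiteness)]
    simp only [ENNReal.toReal_ofReal']
    grind

theorem coe_sub_coe_eq_of_add_eq {A B R : ℝ≥0∞} {C : ℝ} (hB : B ≠ ∞)
    (h : R + (B + ENNReal.ofReal (-C)) = A + ENNReal.ofReal C) :
    (A : EReal) - (B : EReal) = (R : EReal) - (C : EReal) := by
  lift B to ℝ≥0 using hB
  cases A with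
  | top =>
    have hR : R = ∞ := by simpa using h
    rw [hR]
    rfl
  | coe A =>
    have hR : R ≠ ∞ := by
      rintro rfl
      rw [top_add] at h
      exact absurd h.symm (by finiteness)
    lift R to ℝ≥0 using hR
    have h' := congrArg ENNReal.toReal h
    repeat rw [ENNReal.toReal_add (by finiteness) (by finiteness)] at h'
    simp only [ENNReal.toReal_ofReal', ENNReal.coe_toReal] at h'
    change ((A : ℝ) : EReal) - ((B : ℝ) : EReal) = ((R : ℝ) : EReal) - (C : EReal)
    rw [← EReal.coe_sub, ← EReal.coe_sub, EReal.coe_eq_coe_iff]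
    grind

end ExtendedReals

section Truncation

/-- The truncation `(x ∧ b) ∨ a` of an extended real number, as a real number. -/
noncomputable def truncReal (a b : ℝ) (x : EReal) : ℝ :=
  (max (a : EReal) (min x (b : EReal))).toReal

theorem coe_truncReal (a b : ℝ) (x : EReal) :
    (truncReal a b x : EReal) = max (a : EReal) (min x (b : EReal)) :=
  EReal.coe_toReal
    (max_lt (EReal.coe_lt_top _) ((min_le_right _ _).trans_lt (EReal.coe_lt_top _))).ne
    ((EReal.bot_lt_coe _).trans_le (le_max_left _ _)).ne'

theorem truncReal_coe (a b x : ℝ) : truncReal a b (x : EReal) = max a (min x b) := by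
  rw [← EReal.coe_eq_coe_iff, coe_truncReal, EReal.coe_strictMono.monotone.map_max,
    EReal.coe_strictMono.monotone.map_min]

theorem truncReal_top (a b : ℝ) : truncReal a b ⊤ = max a b := by
  rw [← EReal.coe_eq_coe_iff, coe_truncReal, min_eq_right le_top,
    EReal.coe_strictMono.monotone.map_max]

theorem truncReal_bot (a b : ℝ) : truncReal a b ⊥ = a := by
  rw [← EReal.coe_eq_coe_iff, coe_truncReal, min_eq_left bot_le, max_eq_left bot_le]

theorem monotone_truncReal (a b : ℝ) : Monotone (truncReal a b) := fun x y h => by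
  rw [← EReal.coe_le_coe_iff, coe_truncReal, coe_truncReal]
  gcongr

theorem measurable_truncReal (a b : ℝ) : Measurable (truncReal a b) :=
  (monotone_truncReal a b).measurable

theorem abs_truncReal_le (a b : ℝ) (x : EReal) : |truncReal a b x| ≤ max |a| |b| :=
  (abs_le_max_abs_abs ((truncReal_bot a b).ge.trans (monotone_truncReal a b bot_le))
    ((monotone_truncReal a b le_top).trans (truncReal_top a b).le)).trans
    (max_le (le_max_left _ _) abs_max_le_max_abs_abs)

theorem truncReal_add_le (a b : ℝ) (x : EReal) {r j : ℝ} (hr : |r| ≤ j) :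
    truncReal (a - j) b (x + (r : EReal)) ≤ truncReal a (b + j) x + r := by
  have h := abs_le.1 hr
  induction x with
  | bot => rw [EReal.bot_add, truncReal_bot, truncReal_bot]; linarith
  | top => rw [EReal.top_add_coe, truncReal_top, truncReal_top]; grind
  | coe x => rw [← EReal.coe_add, truncReal_coe, truncReal_coe]; grind

theorem truncReal_sub_le {b b' : ℝ} (hb : 0 ≤ b + b') (y : EReal) {z j : ℝ} (hz : |z| ≤ j) :
    truncReal (-(b + j)) b' ((z : EReal) - y) ≤ z - truncReal (-(b' + j)) b y := by
  have h := abs_le.1 hz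
  induction y with
  | bot => rw [EReal.coe_sub_bot, truncReal_bot, truncReal_top]; grind
  | top => rw [EReal.sub_top, truncReal_bot, truncReal_top]; grind
  | coe y => rw [← EReal.coe_sub, truncReal_coe, truncReal_coe]; grind

end Truncation

/-! ### Optimized certainty equivalents of bounded random variables -/

section OceBounded

variable {Ω : Type*} {m mΩ : MeasurableSpace Ω} {μ : Measure Ω} {H : ℝ → EReal}

/-- The conditional expectation of `(K - σ) + H (σ - X)` for a loss function `H` with excess `L`,
where `K` is an upper bound of `X` that makes this random variable nonnegative. -/
noncomputable def condLoss (m : MeasurableSpace Ω) {_ : MeasurableSpace Ω} (μ : Measure Ω)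
    (L : ℝ → ℝ≥0∞) (K : ℝ) (X σ : Ω → ℝ) : Ω → ℝ≥0∞ :=
  condLExp m μ fun ω => ENNReal.ofReal (K - X ω) + L (σ ω - X ω)

theorem ofReal_sub_add_le_of_le {L : ℝ → ℝ≥0∞} (hL : IsLossExcess L) {x y K : ℝ} (hxy : x ≤ y)
    (hy : y ≤ K) (s : ℝ) :
    ENNReal.ofReal (K - y) + L (s - y) ≤ ENNReal.ofReal (K - x) + L (s - x) :=
  calc ENNReal.ofReal (K - y) + L (s - y)
      ≤ ENNReal.ofReal (K - y) + (L (s - x) + ENNReal.ofReal (s - x - (s - y))) := by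
        gcongr
        exact hL.le_add_ofReal _ _ (by linarith)
    _ = ENNReal.ofReal (K - y) + ENNReal.ofReal (y - x) + L (s - x) := by
        rw [sub_sub_sub_cancel_left, add_comm (L _), add_assoc]
    _ = ENNReal.ofReal (K - x) + L (s - x) := by
        rw [← ENNReal.ofReal_add (by linarith) (by linarith), sub_add_sub_cancel]

section SigmaFinite

variable (hm : m ≤ mΩ) [SigmaFinite (μ.trim hm)]
include hm

theorem condLoss_le_add_on {L : ℝ → ℝ≥0∞} (hL : IsLossExcess L) {A : Set Ω}
    (hA : MeasurableSet[m] A) {σ σ' : Ω → ℝ} {δ : ℝ}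
    (h : ∀ ω ∈ A, σ' ω ≤ σ ω ∧ σ ω ≤ σ' ω + δ) (K : ℝ) (X : Ω → ℝ) :
    ∀ᵐ ω ∂μ, ω ∈ A → condLoss m μ L K X σ' ω ≤ condLoss m μ L K X σ ω + ENNReal.ofReal δ := by
  have hle := condLExp_mono_on (μ := μ) hm hA
    (f := fun ω => ENNReal.ofReal (K - X ω) + L (σ' ω - X ω))
    (g := fun ω => ENNReal.ofReal (K - X ω) + L (σ ω - X ω) + ENNReal.ofReal δ)
    (.of_forall fun ω hω => by
      obtain ⟨hle, hge⟩ := h ω hω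
      rw [add_assoc]
      gcongr
      refine (hL.le_add_ofReal _ (σ ω - X ω) (by linarith)).trans ?_
      gcongr
      linarith)
  filter_upwards [hle, condLExp_add_measurable hm _ measurable_const] with ω hle hadd hω
  exact (hle hω).trans_eq hadd

theorem condLoss_add_measurable (L : ℝ → ℝ≥0∞) {X r : Ω → ℝ} (hr : Measurable[m] r) {K Kr : ℝ}
    (hX : ∀ ω, X ω ≤ K) (hrK : ∀ ω, r ω ≤ Kr) (σ : Ω → ℝ) :
    condLoss m μ L (K + Kr) (fun ω => X ω + r ω) σ =ᵐ[μ]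
      fun ω => condLoss m μ L K X (fun ω => σ ω - r ω) ω + ENNReal.ofReal (Kr - r ω) := by
  have hsplit : condLoss m μ L (K + Kr) (fun ω => X ω + r ω) σ = condLExp m μ fun ω =>
      ENNReal.ofReal (K - X ω) + L (σ ω - r ω - X ω) + ENNReal.ofReal (Kr - r ω) := by
    unfold condLoss
    congr 1 with ω
    rw [add_sub_add_comm, ENNReal.ofReal_add (sub_nonneg.2 (hX ω)) (sub_nonneg.2 (hrK ω)),
      add_right_comm, sub_right_comm, sub_sub]
  rw [hsplit]
  exact condLExp_add_measurable hm _ (ENNReal.measurable_ofReal.comp (measurable_const.sub hr))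

theorem condLoss_of_measurable (L : ℝ → ℝ≥0∞) {X : Ω → ℝ} (hX : Measurable[m] X) (K q : ℝ) :
    condLoss m μ L K X (fun ω => X ω + q) = fun ω => L q + ENNReal.ofReal (K - X ω) := by
  have hmeas : Measurable[m] fun ω => ENNReal.ofReal (K - X ω) + L q :=
    (ENNReal.measurable_ofReal.comp (measurable_const.sub hX)).add measurable_const
  simp only [condLoss, add_sub_cancel_left, condLExp_eq_self hm μ hmeas]
  exact funext fun ω => add_comm _ _

end SigmaFinite

variable [IsFiniteMeasure μ]

theorem condExpExt_eq_condLExp_sub (hm : m ≤ mΩ) {f : Ω → EReal} (hf : Measurable f) {C : ℝ}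
    (hC : ∀ ω, ((-C : ℝ) : EReal) ≤ f ω) :
    ∀ᵐ ω ∂μ, condExpExt m μ f ω =
      (condLExp m μ (fun ω => (f ω + C).toENNReal) ω : EReal) - (C : EReal) := by
  have hneg : Measurable fun ω => (-f ω).toENNReal := hf.neg.ereal_toENNReal
  have hfin : ∀ᵐ ω ∂μ, condLExp m μ (fun ω => (-f ω).toENNReal) ω ≠ ∞ := by
    refine condLExp_ne_top (ne_top_of_le_ne_top (b := ∫⁻ _, ENNReal.ofReal C ∂μ)
      (by rw [lintegral_const]; finiteness)
      (lintegral_mono fun ω => ?_))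
    exact EReal.toENNReal_le_toENNReal (EReal.neg_le.1 (by simpa using hC ω))
  have hadd := condLExp_add_right (mΩ := m) (P := μ) (fun ω => (f ω + C).toENNReal)
    (Y := fun ω => (-f ω).toENNReal + ENNReal.ofReal (-C)) (hneg.add measurable_const).aemeasurable
  have hadd_neg := condLExp_add_measurable (μ := μ) hm (fun ω => (-f ω).toENNReal)
    (g := fun _ => ENNReal.ofReal (-C)) measurable_const
  have hadd_pos := condLExp_add_measurable (μ := μ) hm (fun ω => (f ω).toENNReal)
    (g := fun _ => ENNReal.ofReal C) measurable_const
  have hid : ((fun ω => (f ω + C).toENNReal) +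
      fun ω => (-f ω).toENNReal + ENNReal.ofReal (-C)) =
      fun ω => (f ω).toENNReal + ENNReal.ofReal C := funext fun ω => toENNReal_add_coe_add (hC ω)
  rw [hid] at hadd
  filter_upwards [hfin, hadd, hadd_neg, hadd_pos] with ω hfin hadd hadd_neg hadd_pos
  refine coe_sub_coe_eq_of_add_eq hfin ?_
  rw [← hadd_neg, ← hadd_pos, hadd]
  rfl

theorem coe_sub_condExpExt (hm : m ≤ mΩ) (hH : IsLossFunction H) {X : Ω → ℝ} (hX : Measurable X)
    {K : ℝ} (hK : ∀ ω, X ω ≤ K) (s : ℝ) :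
    ∀ᵐ ω ∂μ, (s : EReal) - condExpExt m μ (fun ω' => H (s - X ω')) ω =
      (K : EReal) - (condLoss m μ (lossExcess H) K X (fun _ => s) ω : EReal) := by
  have hbelow : ∀ ω, ((-(K - s) : ℝ) : EReal) ≤ H (s - X ω) := fun ω =>
    (EReal.coe_le_coe_iff.2 (by linarith [hK ω])).trans (hH.self_le _)
  have hshift : (fun ω => (H (s - X ω) + ((K - s : ℝ) : EReal)).toENNReal) =
      fun ω => ENNReal.ofReal (K - X ω) + lossExcess H (s - X ω) := by
    ext ω
    rw [hH.eq_add_lossExcess, add_right_comm, ← EReal.coe_add, sub_add_sub_comm, add_comm s,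
      ← sub_add_sub_comm, sub_self, add_zero,
      EReal.toENNReal_add (EReal.coe_nonneg.2 (sub_nonneg.2 (hK ω))) (EReal.coe_ennreal_nonneg _),
      EReal.toENNReal_of_ne_top (EReal.coe_ne_top _), EReal.toReal_coe, EReal.toENNReal_coe]
  have hext := condExpExt_eq_condLExp_sub (μ := μ) hm (hH.measurable.comp (hX.const_sub s)) hbelow
  filter_upwards [hext] with ω hext
  simp only [Function.comp_def, hshift] at hext
  rw [hext, condLoss]
  exact coe_sub_sub_coe_sub s K _

theorem measurable_oceBounded (hm : m ≤ mΩ) (X : Ω → ℝ) : Measurable[m] (oceBounded m μ H X) :=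
  (isEssSup_essSupFamily hm μ _).measurable

theorem oceBounded_le (hm : m ≤ mΩ) (hH : IsLossFunction H) {X : Ω → ℝ} (hX : Measurable X)
    {K : ℝ} (hK : ∀ ω, X ω ≤ K) {g : Ω → EReal} (hg : Measurable[m] g)
    (h : ∀ s : ℝ, ∀ᵐ ω ∂μ,
      (K : EReal) - (condLoss m μ (lossExcess H) K X (fun _ => s) ω : EReal) ≤ g ω) :
    oceBounded m μ H X ≤ᵐ[μ] g := by
  refine (isEssSup_essSupFamily hm μ _).least g hg ?_
  rintro _ ⟨s, rfl⟩
  filter_upwards [h s, coe_sub_condExpExt hm hH hX hK s] with ω hle heq using heq.trans_le hle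

theorem le_oceBounded_const (hm : m ≤ mΩ) (hH : IsLossFunction H) {X : Ω → ℝ} (hX : Measurable X)
    {K : ℝ} (hK : ∀ ω, X ω ≤ K) (s : ℝ) :
    ∀ᵐ ω ∂μ, (K : EReal) - (condLoss m μ (lossExcess H) K X (fun _ => s) ω : EReal) ≤
      oceBounded m μ H X ω := by
  have hle := (isEssSup_essSupFamily hm μ (Set.range fun (s : ℝ) (ω : Ω) =>
    (s : EReal) - condExpExt m μ (fun ω' => H (s - X ω')) ω)).le _ (Set.mem_range_self s)
  filter_upwards [hle, coe_sub_condExpExt hm hH hX hK s] with ω hle heq using heq.symm.trans_le hle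

theorem le_oceBounded (hm : m ≤ mΩ) (hH : IsLossFunction H) {X : Ω → ℝ} (hX : Measurable X)
    {K : ℝ} (hK : ∀ ω, X ω ≤ K) {σ : Ω → ℝ} (hσ : Measurable[m] σ) :
    ∀ᵐ ω ∂μ, (K : EReal) - (condLoss m μ (lossExcess H) K X σ ω : EReal) ≤
      oceBounded m μ H X ω := by
  have hloss : ∀ (n : ℕ) (q : ℚ), ∀ᵐ ω ∂μ, (q ≤ σ ω ∧ σ ω ≤ q + 1 / ((n : ℝ) + 1)) →
      condLoss m μ (lossExcess H) K X (fun _ => (q : ℝ)) ω ≤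
        condLoss m μ (lossExcess H) K X σ ω + ENNReal.ofReal (1 / ((n : ℝ) + 1)) := fun n q =>
    condLoss_le_add_on hm hH.isLossExcess
      ((measurableSet_le measurable_const hσ).inter (measurableSet_le hσ measurable_const))
      (fun ω hω => hω) K X
  filter_upwards [ae_all_iff.2 fun n => ae_all_iff.2 (hloss n),
    ae_all_iff.2 fun q : ℚ => le_oceBounded_const hm hH hX hK q] with ω hloss hle
  refine ereal_le_of_forall_sub_one_div_le fun n => ?_
  have hn : 0 < 1 / ((n : ℝ) + 1) := by positivity
  obtain ⟨q, hq, hq'⟩ := exists_rat_btwn (sub_lt_self (σ ω) hn)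
  rw [← coe_sub_coe_add_ofReal hn.le]
  refine (EReal.sub_le_sub le_rfl ?_).trans (hle q)
  exact EReal.coe_ennreal_le_coe_ennreal_iff.2 (hloss n q ⟨hq'.le, by linarith⟩)

theorem oceBounded_mono_on (hm : m ≤ mΩ) (hH : IsLossFunction H) {X Y : Ω → ℝ}
    (hX : Measurable X) (hY : Measurable Y) (hX_bdd : BddAbove (Set.range X))
    (hY_bdd : BddAbove (Set.range Y)) {A : Set Ω} (hA : MeasurableSet[m] A)
    (h : ∀ᵐ ω ∂μ, ω ∈ A → X ω ≤ Y ω) :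
    ∀ᵐ ω ∂μ, ω ∈ A → oceBounded m μ H X ω ≤ oceBounded m μ H Y ω := by
  classical
  obtain ⟨K, hK⟩ := hX_bdd.union hY_bdd
  have hXK : ∀ ω, X ω ≤ K := fun ω => hK (.inl ⟨ω, rfl⟩)
  have hYK : ∀ ω, Y ω ≤ K := fun ω => hK (.inr ⟨ω, rfl⟩)
  have hle : oceBounded m μ H X ≤ᵐ[μ] A.piecewise (oceBounded m μ H Y) fun _ => ⊤ := by
    refine oceBounded_le hm hH hX hXK
      (Measurable.piecewise hA (measurable_oceBounded hm Y) measurable_const) fun s => ?_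
    have hloss : ∀ᵐ ω ∂μ, ω ∈ A → condLoss m μ (lossExcess H) K Y (fun _ => s) ω ≤
        condLoss m μ (lossExcess H) K X (fun _ => s) ω := condLExp_mono_on hm hA (by
      filter_upwards [h] with ω h hω
      exact ofReal_sub_add_le_of_le hH.isLossExcess (h hω) (hYK ω) s)
    filter_upwards [hloss, le_oceBounded_const hm hH hY hYK s] with ω hloss hle
    by_cases hω : ω ∈ A
    · rw [Set.piecewise_eq_of_mem _ _ _ hω]
      exact (EReal.sub_le_sub le_rfl
        (EReal.coe_ennreal_le_coe_ennreal_iff.2 (hloss hω))).trans hle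
    · rw [Set.piecewise_eq_of_notMem _ _ _ hω]
      exact le_top
  filter_upwards [hle] with ω hle hω
  rwa [Set.piecewise_eq_of_mem _ _ _ hω] at hle

theorem oceBounded_mono (hm : m ≤ mΩ) (hH : IsLossFunction H) {X Y : Ω → ℝ}
    (hX : Measurable X) (hY : Measurable Y) (hX_bdd : BddAbove (Set.range X))
    (hY_bdd : BddAbove (Set.range Y)) (h : X ≤ᵐ[μ] Y) :
    oceBounded m μ H X ≤ᵐ[μ] oceBounded m μ H Y := by
  filter_upwards [oceBounded_mono_on hm hH hX hY hX_bdd hY_bdd .univ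
    (h.mono fun _ hω _ => hω)] with ω hω using hω trivial

theorem oceBounded_add_le (hm : m ≤ mΩ) (hH : IsLossFunction H) {X r : Ω → ℝ} (hX : Measurable X)
    (hr : Measurable[m] r) (hX_bdd : BddAbove (Set.range X)) (hr_bdd : BddAbove (Set.range r)) :
    ∀ᵐ ω ∂μ, oceBounded m μ H (fun ω => X ω + r ω) ω ≤ oceBounded m μ H X ω + (r ω : EReal) := by
  obtain ⟨K, hK⟩ := hX_bdd
  obtain ⟨Kr, hKr⟩ := hr_bdd
  have hXK : ∀ ω, X ω ≤ K := fun ω => hK ⟨ω, rfl⟩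
  have hrK : ∀ ω, r ω ≤ Kr := fun ω => hKr ⟨ω, rfl⟩
  refine oceBounded_le (X := fun ω => X ω + r ω) (g := fun ω => oceBounded m μ H X ω + r ω) hm hH
    (hX.add (hr.mono hm le_rfl)) (fun ω => add_le_add (hXK ω) (hrK ω))
    ((measurable_oceBounded hm X).add (measurable_coe_real_ereal.comp hr)) fun s => ?_
  filter_upwards [le_oceBounded hm hH hX hXK (hr.const_sub s),
    condLoss_add_measurable hm (lossExcess H) hr hXK hrK fun _ => s] with ω hle hloss
  rw [hloss, coe_sub_coe_add_ofReal (sub_nonneg.2 (hrK ω))]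
  exact (coe_add_sub_sub_coe_sub _ _ _ _).trans_le (add_le_add_left hle _)

theorem oceBounded_of_measurable (hm : m ≤ mΩ) (hH : IsLossFunction H) {X : Ω → ℝ}
    (hX : Measurable[m] X) (hX_bdd : BddAbove (Set.range X)) :
    ∀ᵐ ω ∂μ, oceBounded m μ H X ω = (X ω : EReal) := by
  obtain ⟨K, hK⟩ := hX_bdd
  have hXK : ∀ ω, X ω ≤ K := fun ω => hK ⟨ω, rfl⟩
  have hsub : ∀ ω, (K : EReal) - (ENNReal.ofReal (K - X ω) : EReal) = (X ω : EReal) := fun ω => by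
    rw [EReal.coe_ennreal_ofReal, max_eq_left (sub_nonneg.2 (hXK ω)), ← EReal.coe_sub,
      sub_sub_cancel]
  have hofReal : Measurable[m] fun ω => ENNReal.ofReal (K - X ω) :=
    ENNReal.measurable_ofReal.comp (measurable_const.sub hX)
  have hle : ∀ᵐ ω ∂μ, oceBounded m μ H X ω ≤ (X ω : EReal) := by
    refine oceBounded_le hm hH (hX.mono hm le_rfl) hXK (measurable_coe_real_ereal.comp hX)
      fun s => ?_
    have hmono := condLExp_mono (mΩ := m) (P := μ) (X := fun ω => ENNReal.ofReal (K - X ω))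
      (Y := fun ω => ENNReal.ofReal (K - X ω) + lossExcess H (s - X ω))
      (.of_forall fun ω => le_self_add)
    rw [condLExp_eq_self hm μ hofReal] at hmono
    filter_upwards [hmono] with ω hmono
    exact (EReal.sub_le_sub le_rfl
      (EReal.coe_ennreal_le_coe_ennreal_iff.2 hmono)).trans_eq (hsub ω)
  have hge : ∀ᵐ ω ∂μ, ∀ n : ℕ,
      (X ω : EReal) - ((1 / ((n : ℝ) + 1) : ℝ) : EReal) ≤ oceBounded m μ H X ω := by
    refine ae_all_iff.2 fun n => ?_
    have hn : 0 < 1 / ((n : ℝ) + 1) := by positivity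
    obtain ⟨q, hq⟩ := hH.isLossExcess.exists_le_ofReal _ hn
    have hloss := le_oceBounded (μ := μ) hm hH (hX.mono hm le_rfl) hXK
      (σ := fun ω => X ω + q) (hX.add_const q)
    filter_upwards [hloss] with ω hloss
    refine le_trans ?_ hloss
    rw [← hsub ω, ← coe_sub_coe_add_ofReal hn.le]
    refine EReal.sub_le_sub le_rfl (EReal.coe_ennreal_le_coe_ennreal_iff.2 ?_)
    exact ((congrFun (condLoss_of_measurable (μ := μ) hm _ hX K q) ω).trans_le
      (add_le_add_left hq _)).trans_eq (add_comm _ _)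
  filter_upwards [hle, hge] with ω hle hge
  exact hle.antisymm (ereal_le_of_forall_sub_one_div_le hge)

end OceBounded

/-! ### Optimized certainty equivalents of extended random variables -/

theorem iInf_max_neg_natCast (x : EReal) : ⨅ k : ℕ, max ((-(k : ℝ) : ℝ) : EReal) x = x := by
  refine le_antisymm (le_of_forall_gt fun y hy => ?_) (le_iInf fun k => le_max_right _ _)
  obtain ⟨r, -, hr⟩ := EReal.lt_iff_exists_real_btwn.1 hy
  obtain ⟨k, hk⟩ := exists_nat_gt (-r)
  exact (iInf_le _ k).trans_lt
    (max_lt ((EReal.coe_lt_coe_iff.2 (neg_lt.1 hk)).trans hr) hy)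

theorem iSup_min_natCast (x : EReal) : ⨆ n : ℕ, min x ((n : ℝ) : EReal) = x := by
  refine le_antisymm (iSup_le fun n => min_le_left _ _) (le_of_forall_lt fun y hy => ?_)
  obtain ⟨r, hr, -⟩ := EReal.lt_iff_exists_real_btwn.1 hy
  obtain ⟨n, hn⟩ := exists_nat_gt r
  exact (lt_min hy (hr.trans (EReal.coe_lt_coe_iff.2 hn))).trans_le
    (le_iSup (fun n : ℕ => min x ((n : ℝ) : EReal)) n)

theorem bddAbove_range_truncReal {ι : Type*} (a b : ℝ) (X : ι → EReal) :
    BddAbove (Set.range fun i => truncReal a b (X i)) :=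
  ⟨truncReal a b ⊤, Set.forall_mem_range.2 fun _ => monotone_truncReal a b le_top⟩

section OceStep

variable {Ω : Type*} {m mΩ : MeasurableSpace Ω} {μ : Measure Ω} {H : ℝ → EReal}

theorem oceStep_eq (X : Ω → EReal) (ω : Ω) : oceStep m μ H X ω = ⨆ n : ℕ, ⨅ k : ℕ,
    oceBounded m μ H (fun ω' => truncReal (-(k : ℝ)) n (X ω')) ω := rfl

variable [IsFiniteMeasure μ]

theorem measurable_oceStep (hm : m ≤ mΩ) (X : Ω → EReal) : Measurable[m] (oceStep m μ H X) :=
  Measurable.iSup fun _ => Measurable.iInf fun _ => measurable_oceBounded hm _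

theorem oceStep_mono_on (hm : m ≤ mΩ) (hH : IsLossFunction H) {X Y : Ω → EReal}
    (hX : Measurable X) (hY : Measurable Y) {A : Set Ω} (hA : MeasurableSet[m] A)
    (h : ∀ᵐ ω ∂μ, ω ∈ A → X ω ≤ Y ω) :
    ∀ᵐ ω ∂μ, ω ∈ A → oceStep m μ H X ω ≤ oceStep m μ H Y ω := by
  have htrunc : ∀ n k : ℕ, ∀ᵐ ω ∂μ, ω ∈ A →
      oceBounded m μ H (fun ω' => truncReal (-(k : ℝ)) n (X ω')) ω ≤
        oceBounded m μ H (fun ω' => truncReal (-(k : ℝ)) n (Y ω')) ω := fun n k =>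
    oceBounded_mono_on hm hH ((measurable_truncReal _ _).comp hX)
      ((measurable_truncReal _ _).comp hY) (bddAbove_range_truncReal _ _ X)
      (bddAbove_range_truncReal _ _ Y) hA
      (h.mono fun ω h hω => monotone_truncReal _ _ (h hω))
  filter_upwards [ae_all_iff.2 fun n => ae_all_iff.2 fun k => htrunc n k] with ω htrunc hω
  rw [oceStep_eq, oceStep_eq]
  exact iSup_mono fun n => iInf_mono fun k => htrunc n k hω

theorem oceStep_mono (hm : m ≤ mΩ) (hH : IsLossFunction H) {X Y : Ω → EReal}
    (hX : Measurable X) (hY : Measurable Y) (h : X ≤ᵐ[μ] Y) :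
    oceStep m μ H X ≤ᵐ[μ] oceStep m μ H Y := by
  filter_upwards [oceStep_mono_on hm hH hX hY .univ (h.mono fun _ hω _ => hω)] with ω hω
    using hω trivial

theorem oceStep_congr (hm : m ≤ mΩ) (hH : IsLossFunction H) {X Y : Ω → EReal}
    (hX : Measurable X) (hY : Measurable Y) (h : X =ᵐ[μ] Y) :
    oceStep m μ H X =ᵐ[μ] oceStep m μ H Y :=
  (oceStep_mono hm hH hX hY h.le).antisymm (oceStep_mono hm hH hY hX h.symm.le)

theorem oceStep_of_measurable (hm : m ≤ mΩ) (hH : IsLossFunction H) {X : Ω → EReal}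
    (hX : Measurable[m] X) : oceStep m μ H X =ᵐ[μ] X := by
  have htrunc : ∀ n k : ℕ, ∀ᵐ ω ∂μ,
      oceBounded m μ H (fun ω' => truncReal (-(k : ℝ)) n (X ω')) ω =
        (truncReal (-(k : ℝ)) n (X ω) : EReal) := fun n k =>
    oceBounded_of_measurable hm hH ((measurable_truncReal _ _).comp hX)
      (bddAbove_range_truncReal _ _ X)
  filter_upwards [ae_all_iff.2 fun n => ae_all_iff.2 fun k => htrunc n k] with ω htrunc
  simp only [oceStep_eq, htrunc, coe_truncReal, iInf_max_neg_natCast, iSup_min_natCast]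

theorem oceBounded_truncReal_add_le (hm : m ≤ mΩ) (hH : IsLossFunction H) {X : Ω → EReal}
    (hX : Measurable X) {r : Ω → ℝ} (hr : Measurable[m] r) (a b j : ℝ) :
    ∀ᵐ ω ∂μ, |r ω| ≤ j →
      oceBounded m μ H (fun ω' => truncReal (a - j) b (X ω' + (r ω' : EReal))) ω ≤
        oceBounded m μ H (fun ω' => truncReal a (b + j) (X ω')) ω + (r ω : EReal) := by
  have hrj : Measurable[m] fun ω => min (r ω) j := hr.min measurable_const
  have hrj_bdd : BddAbove (Set.range fun ω => min (r ω) j) :=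
    ⟨j, Set.forall_mem_range.2 fun _ => min_le_right _ _⟩
  have hT : Measurable fun ω => truncReal a (b + j) (X ω) := (measurable_truncReal _ _).comp hX
  have hT_bdd := bddAbove_range_truncReal a (b + j) X
  have hmono := oceBounded_mono_on (μ := μ) hm hH (A := {ω | |r ω| ≤ j})
    (X := fun ω => truncReal (a - j) b (X ω + (r ω : EReal)))
    (Y := fun ω => truncReal a (b + j) (X ω) + min (r ω) j)
    ((measurable_truncReal _ _).comp
      (hX.add (measurable_coe_real_ereal.comp (hr.mono hm le_rfl))))
    (hT.add (hrj.mono hm le_rfl)) (bddAbove_range_truncReal _ _ _)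
    ((hT_bdd.add hrj_bdd).mono
      (Set.range_subset_iff.2 fun ω =>
        Set.add_mem_add (Set.mem_range_self ω) (Set.mem_range_self ω)))
    ((continuous_abs.measurable.comp hr) measurableSet_Iic)
    (.of_forall fun ω hω => by
      rw [min_eq_left ((le_abs_self _).trans hω)]
      exact truncReal_add_le a b (X ω) hω)
  filter_upwards [hmono, oceBounded_add_le hm hH hT hrj hT_bdd hrj_bdd] with ω hmono hadd hω
  refine (hmono hω).trans (hadd.trans_eq ?_)
  rw [min_eq_left ((le_abs_self _).trans hω)]

theorem oceStep_add_le (hm : m ≤ mΩ) (hH : IsLossFunction H) {X : Ω → EReal} (hX : Measurable X)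
    {r : Ω → ℝ} (hr : Measurable[m] r) :
    ∀ᵐ ω ∂μ, oceStep m μ H (fun ω => X ω + (r ω : EReal)) ω ≤
      oceStep m μ H X ω + (r ω : EReal) := by
  have htrunc := fun j n k : ℕ => oceBounded_truncReal_add_le (μ := μ) hm hH hX hr (-k) n j
  filter_upwards [ae_all_iff.2 fun j => ae_all_iff.2 fun n => ae_all_iff.2 fun k => htrunc j n k]
    with ω htrunc
  obtain ⟨j, hj⟩ := exists_nat_ge |r ω|
  rw [oceStep_eq, oceStep_eq]
  refine iSup_le fun n => ?_
  rw [← EReal.sub_le_iff_le_add (by simp) (by simp)]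
  refine le_iSup_of_le (n + j) (le_iInf fun k => ?_)
  rw [EReal.sub_le_iff_le_add (by simp) (by simp)]
  refine iInf_le_of_le (k + j) ?_
  simpa only [Nat.cast_add, neg_add'] using htrunc j n k hj

theorem oceStep_add (hm : m ≤ mΩ) (hH : IsLossFunction H) {X : Ω → EReal} (hX : Measurable X)
    {r : Ω → ℝ} (hr : Measurable[m] r) :
    ∀ᵐ ω ∂μ, oceStep m μ H (fun ω => X ω + (r ω : EReal)) ω =
      oceStep m μ H X ω + (r ω : EReal) := by
  have hge := oceStep_add_le (μ := μ) (X := fun ω => X ω + (r ω : EReal)) hm hH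
    (hX.add (measurable_coe_real_ereal.comp (hr.mono hm le_rfl))) hr.neg
  have hcancel : (fun ω => X ω + (r ω : EReal) + ((-r ω : ℝ) : EReal)) = X := by
    ext ω
    rw [add_assoc, ← EReal.coe_add, add_neg_cancel, EReal.coe_zero, add_zero]
  simp only [Pi.neg_apply, hcancel] at hge
  filter_upwards [oceStep_add_le hm hH hX hr, hge] with ω hle hge
  refine hle.antisymm ?_
  rwa [EReal.coe_neg, ← sub_eq_add_neg, EReal.le_sub_iff_add_le (by simp) (by simp)] at hge

theorem oceStep_of_bounded (hm : m ≤ mΩ) (hH : IsLossFunction H) {X : Ω → ℝ} (hX : Measurable X)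
    {K : ℝ} (hK : ∀ ω, |X ω| ≤ K) :
    ∀ᵐ ω ∂μ, oceStep m μ H (fun ω => (X ω : EReal)) ω = oceBounded m μ H X ω := by
  obtain ⟨j, hj⟩ := exists_nat_ge K
  have hXj : ∀ ω, -(j : ℝ) ≤ X ω ∧ X ω ≤ j := fun ω => abs_le.1 ((hK ω).trans hj)
  have hX_bdd : BddAbove (Set.range X) := ⟨j, Set.forall_mem_range.2 fun ω => (hXj ω).2⟩
  have hT : ∀ a b : ℝ, Measurable fun ω => truncReal a b (X ω : EReal) := fun a b =>
    (measurable_truncReal a b).comp (measurable_coe_real_ereal.comp hX)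
  have hge : ∀ k : ℕ, oceBounded m μ H X ≤ᵐ[μ]
      oceBounded m μ H fun ω => truncReal (-(k : ℝ)) j (X ω : EReal) := fun k =>
    oceBounded_mono hm hH hX (hT _ _) hX_bdd (bddAbove_range_truncReal _ _ _)
      (.of_forall fun ω => by grind [truncReal_coe])
  have hle : ∀ n : ℕ, (oceBounded m μ H fun ω => truncReal (-(j : ℝ)) n (X ω : EReal)) ≤ᵐ[μ]
      oceBounded m μ H X := fun n =>
    oceBounded_mono hm hH (hT _ _) hX (bddAbove_range_truncReal _ _ _) hX_bdd
      (.of_forall fun ω => by grind [truncReal_coe])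
  filter_upwards [ae_all_iff.2 hge, ae_all_iff.2 hle] with ω hge hle
  rw [oceStep_eq]
  exact le_antisymm (iSup_le fun n => iInf_le_of_le j (hle n)) (le_iSup_of_le j (le_iInf hge))

theorem oceStep_coe_sub_le (hm : m ≤ mΩ) {H₁ H₂ : ℝ → EReal} (hH₁ : IsLossFunction H₁)
    {Z : Ω → ℝ} (hZ : Measurable Z) {K : ℝ} (hK : ∀ ω, |Z ω| ≤ K) {ρ : Ω → ℝ}
    (h_bdd : ∀ Y : Ω → ℝ, Measurable Y → (∃ C, ∀ ω, |Y ω| ≤ C) → ∀ᵐ ω ∂μ,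
      oceBounded m μ H₁ (fun ω => Z ω - Y ω) ω ≤ (ρ ω : EReal) - oceBounded m μ H₂ Y ω)
    {Y : Ω → EReal} (hY : Measurable Y) :
    ∀ᵐ ω ∂μ, oceStep m μ H₁ (fun ω => (Z ω : EReal) - Y ω) ω ≤
      (ρ ω : EReal) - oceStep m μ H₂ Y ω := by
  obtain ⟨j, hj⟩ := exists_nat_ge K
  have hZj : ∀ ω, |Z ω| ≤ j := fun ω => (hK ω).trans hj
  have hZY : Measurable fun ω => (Z ω : EReal) - Y ω := by
    simp only [sub_eq_add_neg]
    exact (measurable_coe_real_ereal.comp hZ).add hY.neg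
  have htrunc : ∀ n n' : ℕ, ∀ᵐ ω ∂μ,
      oceBounded m μ H₁ (fun ω => truncReal (-((n + j : ℕ) : ℝ)) n' ((Z ω : EReal) - Y ω)) ω ≤
        (ρ ω : EReal) -
          oceBounded m μ H₂ (fun ω => truncReal (-((n' + j : ℕ) : ℝ)) n (Y ω)) ω := fun n n' => by
    have hT : Measurable fun ω => truncReal (-((n' + j : ℕ) : ℝ)) n (Y ω) :=
      (measurable_truncReal _ _).comp hY
    have hZT : ∀ ω, Z ω - truncReal (-((n' + j : ℕ) : ℝ)) n (Y ω) ≤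
        j + max |(-((n' + j : ℕ) : ℝ))| |(n : ℝ)| := fun ω =>
      (le_abs_self _).trans ((abs_sub _ _).trans (add_le_add (hZj ω) (abs_truncReal_le _ _ _)))
    have hmono := oceBounded_mono (μ := μ) hm hH₁
      ((measurable_truncReal (-((n + j : ℕ) : ℝ)) n').comp hZY) (hZ.sub hT)
      (bddAbove_range_truncReal _ _ _) ⟨_, Set.forall_mem_range.2 hZT⟩
      (.of_forall fun ω => by
        push_cast
        exact truncReal_sub_le (by positivity) (Y ω) (hZj ω))
    filter_upwards [hmono, h_bdd _ hT ⟨_, fun ω => abs_truncReal_le _ _ _⟩] with ω hmono h_bdd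
    exact hmono.trans h_bdd
  filter_upwards [ae_all_iff.2 fun n => ae_all_iff.2 fun n' => htrunc n n'] with ω htrunc
  simp only [oceStep_eq]
  refine iSup_le fun n' => le_coe_sub_comm (iSup_le fun n => le_coe_sub_comm ?_)
  exact (iInf_le _ (n + j)).trans
    ((htrunc n n').trans (EReal.sub_le_sub le_rfl (iInf_le _ (n' + j))))

end OceStep

/-! ### Optimal risk sharing over one period -/

section Transfer

theorem coe_sub_le_coe_sub_coe_sub {K₁ K₂ ρ : ℝ} {R₁ R₂ : ℝ≥0∞}
    (h : ((K₁ + K₂ : ℝ) : EReal) - ((R₁ + R₂ : ℝ≥0∞) : EReal) ≤ (ρ : EReal)) :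
    (K₁ : EReal) - (R₁ : EReal) ≤ (ρ : EReal) - ((K₂ : EReal) - (R₂ : EReal)) := by
  cases R₁ with
  | top => simp
  | coe r₁ =>
    cases R₂ with
    | top => simp
    | coe r₂ =>
      change ((K₁ + K₂ - ((r₁ + r₂ : ℝ≥0) : ℝ) : ℝ) : EReal) ≤ ρ at h
      change ((K₁ - r₁ : ℝ) : EReal) ≤ ((ρ - (K₂ - r₂) : ℝ) : EReal)
      rw [EReal.coe_le_coe_iff] at h ⊢
      push_cast at h
      linarith

theorem exists_coe_eq_of_coe_sub_add_eq {K₁ K₂ ρ : ℝ} {R₁ R₂ : ℝ≥0∞} {x y : EReal}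
    (h : ((K₁ + K₂ : ℝ) : EReal) - ((R₁ + R₂ : ℝ≥0∞) : EReal) = (ρ : EReal))
    (hx : (K₁ : EReal) - (R₁ : EReal) ≤ x) (hy : (K₂ : EReal) - (R₂ : EReal) ≤ y)
    (hxy : x ≤ (ρ : EReal) - y) : ∃ u : ℝ, y = (u : EReal) ∧ x = ((ρ - u : ℝ) : EReal) := by
  have hR : R₁ + R₂ ≠ ∞ := by
    intro hR
    rw [hR] at h
    exact EReal.coe_ne_bot ρ (by simpa using h.symm)
  lift R₁ to ℝ≥0 using (ENNReal.add_ne_top.1 hR).1 with r₁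
  lift R₂ to ℝ≥0 using (ENNReal.add_ne_top.1 hR).2 with r₂
  replace h : K₁ + K₂ - ((r₁ + r₂ : ℝ≥0) : ℝ) = ρ := EReal.coe_injective h
  change ((K₁ - r₁ : ℝ) : EReal) ≤ x at hx
  change ((K₂ - r₂ : ℝ) : EReal) ≤ y at hy
  have hx_bot : x ≠ ⊥ := ((EReal.bot_lt_coe _).trans_le hx).ne'
  have hy_bot : y ≠ ⊥ := ((EReal.bot_lt_coe _).trans_le hy).ne'
  have hy_top : y ≠ ⊤ := by
    rintro rfl
    exact hx_bot (by simpa using hxy)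
  lift y to ℝ using ⟨hy_top, hy_bot⟩
  refine ⟨y, rfl, le_antisymm hxy (le_trans ?_ hx)⟩
  rw [EReal.coe_le_coe_iff] at hy ⊢
  push_cast at h
  linarith

variable {Ω : Type*} {m mΩ : MeasurableSpace Ω} {μ : Measure Ω}

theorem coe_sub_condLoss_eq (hm : m ≤ mΩ) [SigmaFinite (μ.trim hm)] (L : ℝ → ℝ≥0∞) {V : Ω → ℝ}
    {K K' : ℝ} (hK : ∀ ω, V ω ≤ K) (hK' : ∀ ω, V ω ≤ K') (σ : Ω → ℝ) :
    ∀ᵐ ω ∂μ, (K : EReal) - (condLoss m μ L K V σ ω : EReal) =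
      (K' : EReal) - (condLoss m μ L K' V σ ω : EReal) := by
  wlog hle : K ≤ K' generalizing K K'
  · filter_upwards [this hK' hK (le_of_not_ge hle)] with ω h using h.symm
  have hshift := condLoss_add_measurable (μ := μ) hm L (r := fun _ => 0) (Kr := K' - K)
    measurable_const hK (fun _ => sub_nonneg.2 hle) σ
  simp only [add_zero, sub_zero, add_sub_cancel] at hshift
  filter_upwards [hshift] with ω hω
  rw [hω, coe_sub_coe_add_ofReal (sub_nonneg.2 hle)]
  simpa using (coe_add_sub_sub_coe_sub K (K' - K) 0 (condLoss m μ L K V σ ω)).symm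

variable {L₁ L₂ : ℝ → ℝ≥0∞} {V X : Ω → ℝ} {K₁ K₂ : ℝ}

theorem condLoss_sub_add_condLoss (hL₂ : Measurable L₂) (hX : Measurable X)
    (hK₁ : ∀ ω, V ω - X ω ≤ K₁) (hK₂ : ∀ ω, X ω ≤ K₂) (σ₁ : Ω → ℝ) {σ₂ : Ω → ℝ}
    (hσ₂ : Measurable σ₂) :
    condLExp m μ (fun ω => ENNReal.ofReal (K₁ + K₂ - V ω) +
        (L₁ (σ₁ ω - (V ω - X ω)) + L₂ (σ₂ ω - X ω))) =ᵐ[μ]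
      fun ω => condLoss m μ L₁ K₁ (fun ω => V ω - X ω) σ₁ ω + condLoss m μ L₂ K₂ X σ₂ ω := by
  have hmeas : Measurable fun ω => ENNReal.ofReal (K₂ - X ω) + L₂ (σ₂ ω - X ω) :=
    (measurable_const.sub hX).ennreal_ofReal.add (hL₂.comp (hσ₂.sub hX))
  have hsplit : (fun ω => ENNReal.ofReal (K₁ + K₂ - V ω) +
      (L₁ (σ₁ ω - (V ω - X ω)) + L₂ (σ₂ ω - X ω))) =
      (fun ω => ENNReal.ofReal (K₁ - (V ω - X ω)) + L₁ (σ₁ ω - (V ω - X ω))) +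
        fun ω => ENNReal.ofReal (K₂ - X ω) + L₂ (σ₂ ω - X ω) := by
    ext ω
    rw [Pi.add_apply, add_add_add_comm, ← ENNReal.ofReal_add (sub_nonneg.2 (hK₁ ω))
      (sub_nonneg.2 (hK₂ ω))]
    congr 2
    ring
  rw [hsplit]
  exact condLExp_add_right _ hmeas.aemeasurable

theorem condLoss_infConv_le (hm : m ≤ mΩ) [SigmaFinite (μ.trim hm)] (hL₂ : Measurable L₂)
    (hX : Measurable X) (hK₁ : ∀ ω, V ω - X ω ≤ K₁) (hK₂ : ∀ ω, X ω ≤ K₂) (s₁ s₂ : ℝ) :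
    ∀ᵐ ω ∂μ, condLoss m μ (infConv L₁ L₂) (K₁ + K₂) V (fun _ => s₁ + s₂) ω ≤
      condLoss m μ L₁ K₁ (fun ω => V ω - X ω) (fun _ => s₁) ω +
        condLoss m μ L₂ K₂ X (fun _ => s₂) ω := by
  have hle := condLExp_mono_on (μ := μ) hm .univ
    (f := fun ω => ENNReal.ofReal (K₁ + K₂ - V ω) + infConv L₁ L₂ (s₁ + s₂ - V ω))
    (g := fun ω => ENNReal.ofReal (K₁ + K₂ - V ω) + (L₁ (s₁ - (V ω - X ω)) + L₂ (s₂ - X ω)))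
    (.of_forall fun ω _ => by
      gcongr
      refine (infConv_le L₁ L₂ _ (s₁ - (V ω - X ω))).trans_eq ?_
      congr 2
      ring)
  filter_upwards [hle, condLoss_sub_add_condLoss (m := m) (μ := μ) (L₁ := L₁) hL₂ hX hK₁ hK₂
    (fun _ => s₁) (measurable_const (a := s₂))] with ω hω hsum
  exact (hω trivial).trans_eq hsum

variable [IsFiniteMeasure μ] {H₁ H₂ : ℝ → EReal}

theorem oceBounded_sub_le (hm : m ≤ mΩ) (hH₁ : IsLossFunction H₁) (hH₂ : IsLossFunction H₂)
    (hV : Measurable V) (hX : Measurable X) {C : ℝ} (hVC : ∀ ω, V ω ≤ C)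
    (hVX_bdd : BddAbove (Set.range fun ω => V ω - X ω)) (hX_bdd : BddAbove (Set.range X))
    {ρ : Ω → ℝ} (hρ : Measurable[m] ρ)
    (h : ∀ s : ℝ, ∀ᵐ ω ∂μ, (C : EReal) -
      (condLoss m μ (infConv (lossExcess H₁) (lossExcess H₂)) C V (fun _ => s) ω : EReal) ≤ ρ ω) :
    ∀ᵐ ω ∂μ, oceBounded m μ H₁ (fun ω => V ω - X ω) ω ≤ (ρ ω : EReal) - oceBounded m μ H₂ X ω := by
  obtain ⟨K₁, hK₁⟩ := hVX_bdd
  obtain ⟨K₂, hK₂⟩ := hX_bdd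
  replace hK₁ : ∀ ω, V ω - X ω ≤ K₁ := fun ω => hK₁ ⟨ω, rfl⟩
  replace hK₂ : ∀ ω, X ω ≤ K₂ := fun ω => hK₂ ⟨ω, rfl⟩
  have hVK : ∀ ω, V ω ≤ K₁ + K₂ := fun ω => by linarith [hK₁ ω, hK₂ ω]
  have hpair : ∀ s₁ s₂ : ℝ, ∀ᵐ ω ∂μ,
      (K₁ : EReal) - condLoss m μ (lossExcess H₁) K₁ (fun ω => V ω - X ω) (fun _ => s₁) ω ≤
        ρ ω - ((K₂ : EReal) - condLoss m μ (lossExcess H₂) K₂ X (fun _ => s₂) ω) := fun s₁ s₂ => by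
    filter_upwards [h (s₁ + s₂), coe_sub_condLoss_eq hm _ hVC hVK (fun _ => s₁ + s₂),
      condLoss_infConv_le hm hH₂.isLossExcess.lsc.measurable hX hK₁ hK₂ s₁ s₂] with ω hω hshift hle
    refine coe_sub_le_coe_sub_coe_sub (le_trans ?_ (hshift.symm.trans_le hω))
    exact EReal.sub_le_sub le_rfl (EReal.coe_ennreal_le_coe_ennreal_iff.2 hle)
  have hρ_coe : Measurable[m] fun ω => (ρ ω : EReal) := measurable_coe_real_ereal.comp hρ
  refine oceBounded_le (X := fun ω => V ω - X ω)
    (g := fun ω => (ρ ω : EReal) - oceBounded m μ H₂ X ω) hm hH₁ (hV.sub hX) hK₁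
    (hρ_coe.sub (measurable_oceBounded hm X)) fun s₁ => ?_
  have hloss : Measurable[m]
      (condLoss m μ (lossExcess H₁) K₁ (fun ω => V ω - X ω) fun _ => s₁) :=
    measurable_condLExp m μ _
  filter_upwards [oceBounded_le (g := fun ω => (ρ ω : EReal) - ((K₁ : EReal) -
      condLoss m μ (lossExcess H₁) K₁ (fun ω => V ω - X ω) (fun _ => s₁) ω)) hm hH₂ hX hK₂
    (hρ_coe.sub (measurable_const.sub hloss.coe_ereal_ennreal)) fun s₂ => by
      filter_upwards [hpair s₁ s₂] with ω hω using le_coe_sub_comm hω] with ω hω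
  exact le_coe_sub_comm hω

end Transfer

section OptimalTransfer

variable {Ω : Type*} {m m' mΩ : MeasurableSpace Ω} {μ : Measure Ω}

theorem exists_transfer_condLoss_eq (hm' : m ≤ mΩ) {L₁ L₂ : ℝ → ℝ≥0∞} (h₁ : IsLossExcess L₁)
    (h₁_growth : HasLinearGrowth L₁) (h₂ : IsLossExcess L₂) {V σ : Ω → ℝ}
    (hV : Measurable[m] V) (hσ : Measurable[m] σ) {K : ℝ} (hVK : ∀ ω, |V ω| ≤ K)
    (hσK : ∀ ω, |σ ω| ≤ K) :
    ∃ (X : Ω → ℝ) (B : ℝ), Measurable[m] X ∧ (∀ ω, |X ω| ≤ B) ∧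
      ∀ (n : MeasurableSpace Ω) (K₁ K₂ : ℝ), (∀ ω, V ω - X ω ≤ K₁) → (∀ ω, X ω ≤ K₂) →
        ∀ᵐ ω ∂μ, condLoss n μ (infConv L₁ L₂) (K₁ + K₂) V σ ω =
          condLoss n μ L₁ K₁ (fun ω => V ω - X ω) σ ω +
            condLoss n μ L₂ K₂ X (fun _ => 0) ω := by
  obtain ⟨g, hg, hgeq⟩ := exists_lipschitz_eq_infConv h₁ h₁_growth h₂
  have hX : Measurable[m] fun ω => g (σ ω - V ω) - (σ ω - V ω) :=
    (hg.continuous.measurable.comp (hσ.sub hV)).sub (hσ.sub hV)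
  refine ⟨fun ω => g (σ ω - V ω) - (σ ω - V ω), |g 0| + 4 * K, hX, fun ω => ?_,
    fun n K₁ K₂ hK₁ hK₂ => ?_⟩
  · have hdist := hg.dist_le_mul (σ ω - V ω) 0
    rw [NNReal.coe_one, one_mul, Real.dist_eq, Real.dist_eq, sub_zero] at hdist
    grind
  · have hsum := condLoss_sub_add_condLoss (m := n) (μ := μ) (L₁ := L₁) h₂.lsc.measurable
      (hX.mono hm' le_rfl) hK₁ hK₂ σ (measurable_const (a := (0 : ℝ)))
    filter_upwards [hsum] with ω hω
    rw [← hω, condLoss]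
    congr 1 with ω
    rw [← hgeq]
    congr 3 <;> ring

variable [IsFiniteMeasure μ] {H₁ H₂ : ℝ → EReal}

theorem exists_bounded_optimal_transfer (hmm' : m ≤ m') (hm' : m' ≤ mΩ) (hH₁ : IsLossFunction H₁)
    (hH₁_growth : HasLinearGrowth (lossExcess H₁)) (hH₂ : IsLossFunction H₂) {V σ ρ : Ω → ℝ}
    (hV : Measurable[m'] V) (hσ : Measurable[m] σ) (hρ : Measurable[m] ρ) {K : ℝ}
    (hVK : ∀ ω, |V ω| ≤ K) (hσK : ∀ ω, |σ ω| ≤ K) {C : ℝ} (hVC : ∀ ω, V ω ≤ C)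
    (heq : ∀ᵐ ω ∂μ, (C : EReal) -
      (condLoss m μ (infConv (lossExcess H₁) (lossExcess H₂)) C V σ ω : EReal) = ρ ω)
    (hle : ∀ s : ℝ, ∀ᵐ ω ∂μ, (C : EReal) -
      (condLoss m μ (infConv (lossExcess H₁) (lossExcess H₂)) C V (fun _ => s) ω : EReal) ≤ ρ ω) :
    ∃ (X u : Ω → ℝ), Measurable[m'] X ∧ Measurable[m] u ∧
      (∀ᵐ ω ∂μ, oceStep m μ H₂ (fun ω => (X ω : EReal)) ω = u ω) ∧
      ∀ᵐ ω ∂μ, oceStep m μ H₁ (fun ω => ((V ω - X ω : ℝ) : EReal)) ω =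
        ((ρ ω - u ω : ℝ) : EReal) := by
  have hm : m ≤ mΩ := hmm'.trans hm'
  obtain ⟨X, B, hX, hXB, hsplit⟩ := exists_transfer_condLoss_eq (μ := μ) hm' hH₁.isLossExcess
    hH₁_growth hH₂.isLossExcess hV (hσ.mono hmm' le_rfl) hVK hσK
  have hX' : Measurable X := hX.mono hm' le_rfl
  have hZ : Measurable fun ω => V ω - X ω := (hV.sub hX).mono hm' le_rfl
  have hXK₂ : ∀ ω, X ω ≤ B := fun ω => (le_abs_self _).trans (hXB ω)
  have hZ_abs : ∀ ω, |V ω - X ω| ≤ K + B := fun ω =>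
    (abs_sub _ _).trans (add_le_add (hVK ω) (hXB ω))
  have hZK₁ : ∀ ω, V ω - X ω ≤ K + B := fun ω => (le_abs_self _).trans (hZ_abs ω)
  have hVK' : ∀ ω, V ω ≤ K + B + B := fun ω => by linarith [hZK₁ ω, hXK₂ ω]
  refine ⟨X, fun ω => (oceBounded m μ H₂ X ω).toReal, hX,
    (measurable_oceBounded hm X).ereal_toReal, ?_⟩
  rw [← eventually_and]
  filter_upwards [heq, coe_sub_condLoss_eq hm (infConv _ _) hVC hVK' σ, hsplit m _ _ hZK₁ hXK₂,
    le_oceBounded hm hH₁ hZ hZK₁ hσ, le_oceBounded_const hm hH₂ hX' hXK₂ 0,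
    oceBounded_sub_le hm hH₁ hH₂ (hV.mono hm' le_rfl) hX' hVC ⟨_, Set.forall_mem_range.2 hZK₁⟩
      ⟨_, Set.forall_mem_range.2 hXK₂⟩ hρ hle, oceStep_of_bounded (μ := μ) hm hH₂ hX' hXB,
    oceStep_of_bounded (μ := μ) hm hH₁ hZ hZ_abs]
    with ω heq hshift hsplit h₁ h₂ hbound hstep₂ hstep₁
  rw [hshift, hsplit] at heq
  obtain ⟨u, hu₂, hu₁⟩ := exists_coe_eq_of_coe_sub_add_eq heq h₁ h₂ hbound
  rw [hstep₂, hstep₁, hu₁, hu₂, EReal.toReal_coe]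
  exact ⟨rfl, rfl⟩

theorem exists_optimal_transfer (hmm' : m ≤ m') (hm' : m' ≤ mΩ) (hH₁ : IsLossFunction H₁)
    (hH₁_growth : HasLinearGrowth (lossExcess H₁)) (hH₂ : IsLossFunction H₂) {V σ ρ : Ω → ℝ}
    (hV : Measurable[m'] V) (hσ : Measurable[m] σ) (hρ : Measurable[m] ρ) {K : ℝ}
    (hVK : ∀ ω, |V ω| ≤ K) (hσK : ∀ ω, |σ ω| ≤ K) {C : ℝ} (hVC : ∀ ω, V ω ≤ C)
    (heq : ∀ᵐ ω ∂μ, (C : EReal) -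
      (condLoss m μ (infConv (lossExcess H₁) (lossExcess H₂)) C V σ ω : EReal) = ρ ω)
    (hle : ∀ s : ℝ, ∀ᵐ ω ∂μ, (C : EReal) -
      (condLoss m μ (infConv (lossExcess H₁) (lossExcess H₂)) C V (fun _ => s) ω : EReal) ≤ ρ ω) :
    ∃ X : Ω → ℝ, Measurable[m'] X ∧
      (∀ᵐ ω ∂μ, oceStep m μ H₂ (fun ω => (X ω : EReal)) ω = 0) ∧
      ∀ᵐ ω ∂μ, oceStep m μ H₁ (fun ω => ((V ω - X ω : ℝ) : EReal)) ω = (ρ ω : EReal) := by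
  obtain ⟨X, u, hX, hu, hX_eq, hVX_eq⟩ := exists_bounded_optimal_transfer hmm' hm' hH₁ hH₁_growth
    hH₂ hV hσ hρ hVK hσK hVC heq hle
  refine ⟨fun ω => X ω - u ω, hX.sub (hu.mono hmm' le_rfl), ?_, ?_⟩
  · have hshift := oceStep_add (μ := μ) (X := fun ω => (X ω : EReal)) (hmm'.trans hm') hH₂
      (measurable_coe_real_ereal.comp (hX.mono hm' le_rfl)) hu.neg
    filter_upwards [hX_eq, hshift] with ω hω hshift
    simp only [Pi.neg_apply, ← EReal.coe_add, ← sub_eq_add_neg] at hshift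
    rw [hshift, hω, ← EReal.coe_add, add_neg_cancel, EReal.coe_zero]
  · have hshift := oceStep_add (μ := μ) (X := fun ω => ((V ω - X ω : ℝ) : EReal)) (hmm'.trans hm')
      hH₁ (measurable_coe_real_ereal.comp ((hV.sub hX).mono hm' le_rfl)) hu
    filter_upwards [hVX_eq, hshift] with ω hω hshift
    simp only [sub_sub_eq_add_sub, add_sub_right_comm, EReal.coe_add, hshift, hω]
    rw [← EReal.coe_add, sub_add_cancel]

end OptimalTransfer

/-! ### Optimal effort over one period -/

section Norm

variable {E : Type*} [NormedAddCommGroup E]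

theorem exists_mul_norm_sub_le_of_superlinear [ProperSpace E] {c : E → ℝ}
    (hc : Continuous c)
    (hc_superlinear : Tendsto (fun a => c a / ‖a‖) (Bornology.cobounded E) atTop) (κ : ℝ) :
    ∃ C : ℝ, ∀ a, κ * ‖a‖ - C ≤ c a := by
  obtain ⟨a₀, ha₀⟩ := (show Continuous fun a => c a - κ * ‖a‖ by fun_prop).exists_forall_le' 0 <| by
    rw [← Metric.cobounded_eq_cocompact]
    filter_upwards [hc_superlinear.eventually_ge_atTop (κ + |c 0|),
      tendsto_norm_cobounded_atTop.eventually_ge_atTop 1] with a hca ha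
    rw [le_div_iff₀ (by linarith)] at hca
    rw [norm_zero, mul_zero, sub_zero]
    nlinarith [le_abs_self (c 0), abs_nonneg (c 0)]
  exact ⟨-(c a₀ - κ * ‖a₀‖), fun a => by linarith [ha₀ a]⟩

theorem norm_le_norm_fst_add_abs_snd (x : WithLp 2 (E × ℝ)) : ‖x‖ ≤ ‖x.fst‖ + |x.snd| := by
  have hsq := WithLp.prod_norm_sq_eq_of_L2 x
  rw [Real.norm_eq_abs] at hsq
  nlinarith [norm_nonneg x.fst, abs_nonneg x.snd, norm_nonneg x]

end Norm

section NetPayoff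

variable {E : Type*} [NormedAddCommGroup E] [InnerProductSpace ℝ E] {c : E → ℝ}

/-- The payoff of the effort `b` net of its cost `c b`, for the return vector `d` and the additional
payoff `g`. -/
noncomputable def netPayoff (c : E → ℝ) (g : ℝ) (d b : E) : ℝ := g + inner ℝ b d - c b

theorem abs_add_inner_le {g κG κ B : ℝ} {d b : E} (hg : |g| ≤ κG) (hd : ‖d‖ ≤ κ) (hb : ‖b‖ ≤ B) :
    |g + inner ℝ b d| ≤ κG + B * κ :=
  (abs_add_le _ _).trans (add_le_add hg ((abs_real_inner_le_norm b d).trans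
    (mul_le_mul hb hd (norm_nonneg d) ((norm_nonneg b).trans hb))))

theorem exists_norm_le_sub_netPayoff [ProperSpace E] (hc : Continuous c)
    (hc_superlinear : Tendsto (fun a => c a / ‖a‖) (Bornology.cobounded E) atTop) (κ κG : ℝ) :
    ∃ C : ℝ, ∀ {g : ℝ} {d : E}, |g| ≤ κG → ‖d‖ ≤ κ → ∀ b, ‖b‖ ≤ C - netPayoff c g d b := by
  obtain ⟨C, hC⟩ := exists_mul_norm_sub_le_of_superlinear hc hc_superlinear (κ + 1)
  refine ⟨C + κG, fun hg hd b => ?_⟩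
  rw [netPayoff]
  linarith [hC b, (le_abs_self _).trans (abs_add_inner_le hg hd (le_refl ‖b‖))]

theorem exists_abs_netPayoff_le [ProperSpace E] {Ω : Type*} {G : Ω → ℝ} {D b : Ω → E}
    {κ κG : ℝ} (hc : Continuous c) (hGκ : ∀ ω, |G ω| ≤ κG) (hDκ : ∀ ω, ‖D ω‖ ≤ κ)
    (hb : ∃ B, ∀ ω, ‖b ω‖ ≤ B) : ∃ K, ∀ ω, |netPayoff c (G ω) (D ω) (b ω)| ≤ K := by
  obtain ⟨B, hB⟩ := hb
  obtain ⟨K, hK⟩ := (isCompact_closedBall (0 : E) B).exists_bound_of_continuousOn hc.continuousOn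
  exact ⟨κG + B * κ + K, fun ω => (abs_sub _ _).trans (add_le_add
    (abs_add_inner_le (hGκ ω) (hDκ ω) (hB ω)) (hK _ (mem_closedBall_zero_iff.2 (hB ω))))⟩

theorem concaveOn_netPayoff (hc : ConvexOn ℝ Set.univ c) (g : ℝ) (d : E) :
    ConcaveOn ℝ Set.univ (netPayoff c g d) := by
  have hpayoff : ConcaveOn ℝ Set.univ fun b : E => g + inner ℝ b d := by
    refine (((innerₛₗ ℝ d).concaveOn convex_univ).add_const g).congr fun b _ => ?_
    rw [Pi.add_apply, innerₛₗ_apply_apply, real_inner_comm, add_comm]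
  exact hpayoff.sub hc

end NetPayoff

section SocialLoss

variable {E : Type*} [NormedAddCommGroup E] [InnerProductSpace ℝ E] {c : E → ℝ} {L : ℝ → ℝ≥0∞}

theorem convexOn_ofReal_comp {F : Type*} [AddCommGroup F] [Module ℝ F] {f : F → ℝ}
    (hf : ConvexOn ℝ Set.univ f) : ConvexOn ℝ≥0 Set.univ fun x => ENNReal.ofReal (f x) := by
  refine ⟨convex_univ, fun x _ y _ a b _ _ hab => ?_⟩
  calc ENNReal.ofReal (f (a • x + b • y))
      ≤ ENNReal.ofReal (a * f x + b * f y) := ENNReal.ofReal_le_ofReal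
        (hf.2 trivial trivial a.2 b.2 (congrArg NNReal.toReal hab))
    _ ≤ ENNReal.ofReal (a * f x) + ENNReal.ofReal (b * f y) := ENNReal.ofReal_add_le
    _ = a • ENNReal.ofReal (f x) + b • ENNReal.ofReal (f y) := by
        rw [ENNReal.ofReal_mul a.coe_nonneg, ENNReal.ofReal_mul b.coe_nonneg,
          ENNReal.ofReal_coe_nnreal, ENNReal.ofReal_coe_nnreal]
        rfl

/-- The integrand of `condLoss` for a net payoff, as a function of the effort `x.fst` and of the sum
`x.snd` of the payoff shift and the cost of effort. In these coordinates it is jointly convex. -/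
noncomputable def socialLoss (L : ℝ → ℝ≥0∞) (c : E → ℝ) (C g : ℝ) (d : E) (x : WithLp 2 (E × ℝ)) :
    ℝ≥0∞ :=
  ENNReal.ofReal (C - netPayoff c g d x.fst) + L (x.snd - (g + inner ℝ x.fst d))

theorem socialLoss_toLp (C g : ℝ) (d b : E) (s : ℝ) :
    socialLoss L c C g d (WithLp.toLp 2 (b, s + c b)) =
      ENNReal.ofReal (C - netPayoff c g d b) + L (s - netPayoff c g d b) := by
  simp only [socialLoss, netPayoff, WithLp.toLp_fst, WithLp.toLp_snd]
  congr 2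
  ring

theorem convexOn_socialLoss (hL : ConvexOn ℝ≥0 Set.univ L) (hc : ConvexOn ℝ Set.univ c) (C g : ℝ)
    (d : E) : ConvexOn ℝ≥0 Set.univ (socialLoss L c C g d) := by
  have hnet : ConvexOn ℝ Set.univ fun x : WithLp 2 (E × ℝ) => C - netPayoff c g d x.fst :=
    ((convexOn_const C convex_univ).sub (concaveOn_netPayoff hc g d)).comp_linearMap
      (WithLp.fstₗ 2 ℝ E ℝ)
  refine (convexOn_ofReal_comp hnet).add
    ⟨convex_univ, fun x _ y _ a b ha hb hab => (congrArg L ?_).trans_le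
      (hL.2 (Set.mem_univ (x.snd - (g + inner ℝ x.fst d)))
        (Set.mem_univ (y.snd - (g + inner ℝ y.fst d))) ha hb hab)⟩
  have hab' : (a : ℝ) + b = 1 := congrArg NNReal.toReal hab
  simp only [WithLp.add_fst, WithLp.add_snd, WithLp.smul_fst, WithLp.smul_snd, inner_add_left,
    NNReal.smul_def, real_inner_smul_left, smul_eq_mul]
  linear_combination g * hab'

theorem lowerSemicontinuous_socialLoss (hL : LowerSemicontinuous L) (hc : Continuous c) (C g : ℝ)
    (d : E) : LowerSemicontinuous (socialLoss L c C g d) := by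
  have hfst := WithLp.continuous_fst 2 E ℝ
  have hpayoff : Continuous fun x : WithLp 2 (E × ℝ) => g + inner ℝ x.fst d :=
    continuous_const.add (hfst.inner continuous_const)
  exact ((ENNReal.continuous_ofReal.comp (continuous_const.sub
    (hpayoff.sub (hc.comp hfst)))).lowerSemicontinuous).add
      (hL.comp ((WithLp.continuous_snd 2 E ℝ).sub hpayoff))

theorem exists_socialLoss_le (hL : IsLossExcess L) (c : E → ℝ) (C κG : ℝ) :
    ∃ (x₀ : WithLp 2 (E × ℝ)) (C₁ : ℝ), ∀ {g : ℝ} (d : E), |g| ≤ κG →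
      socialLoss L c C g d x₀ ≤ ENNReal.ofReal C₁ := by
  obtain ⟨w, hw⟩ := hL.exists_le_ofReal 1 one_pos
  refine ⟨WithLp.toLp 2 (0, w - κG), |C + κG + c 0| + (1 + 2 * κG), fun {g} d hg => ?_⟩
  obtain ⟨hg_ge, hg_le⟩ := abs_le.1 hg
  simp only [socialLoss, netPayoff, WithLp.toLp_fst, WithLp.toLp_snd, inner_zero_left, add_zero]
  rw [ENNReal.ofReal_add (abs_nonneg _) (by linarith), ENNReal.ofReal_add one_pos.le (by linarith)]
  refine add_le_add (ENNReal.ofReal_le_ofReal ?_)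
    ((hL.le_add_ofReal (w - κG - g) w (by linarith)).trans
      (add_le_add hw (ENNReal.ofReal_le_ofReal (by linarith))))
  linarith [le_abs_self (C + κG + c 0)]

theorem exists_ofReal_le_socialLoss (hL : HasLinearGrowth L) {C κ κG : ℝ}
    (hC : ∀ {g : ℝ} {d : E}, |g| ≤ κG → ‖d‖ ≤ κ → ∀ b, ‖b‖ ≤ C - netPayoff c g d b) (r : ℝ) :
    ∃ K : ℝ, ∀ {g : ℝ} {d : E}, |g| ≤ κG → ‖d‖ ≤ κ → ∀ x, K < ‖x‖ →
      ENNReal.ofReal r ≤ socialLoss L c C g d x := by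
  obtain ⟨ε, B, hε, hB⟩ := hL
  refine ⟨r + ((r + B) / ε + (κG + r * κ)), fun {g d} hg hd x hx => ?_⟩
  rcases le_or_gt r ‖x.fst‖ with hr | hr
  · exact (ENNReal.ofReal_le_ofReal (hr.trans (hC hg hd _))).trans le_self_add
  · refine (ENNReal.ofReal_le_ofReal ?_).trans ((hB _).trans le_add_self)
    have hpayoff := abs_add_inner_le hg hd hr.le
    have hsnd := abs_sub_abs_le_abs_sub x.snd (g + inner ℝ x.fst d)
    have hle : (r + B) / ε ≤ |x.snd - (g + inner ℝ x.fst d)| := by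
      linarith [norm_le_norm_fst_add_abs_snd x]
    rw [div_le_iff₀' hε] at hle
    linarith

end SocialLoss

section OptimalEffort

variable {Ω E : Type*} {m mΩ : MeasurableSpace Ω} {μ : Measure Ω} [NormedAddCommGroup E]
  [InnerProductSpace ℝ E] [FiniteDimensional ℝ E] [MeasurableSpace E] [BorelSpace E]
  {L : ℝ → ℝ≥0∞} {c : E → ℝ} {G : Ω → ℝ} {D : Ω → E}

theorem measurable_netPayoff (hc : Measurable c) (hG : Measurable G) (hD : Measurable D)
    {b : Ω → E} (hb : Measurable b) : Measurable fun ω => netPayoff c (G ω) (D ω) (b ω) :=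
  (hG.add (hb.inner hD)).sub (hc.comp hb)

theorem isConvexIntegrand_socialLoss (hL : IsLossExcess L) (hc : ConvexOn ℝ Set.univ c)
    (hG : Measurable G) (hD : Measurable D) (C : ℝ) :
    IsConvexIntegrand fun ω => socialLoss L c C (G ω) (D ω) where
  measurable_comp {x} hx := by
    have hfst : Measurable fun ω => (x ω).fst := (WithLp.continuous_fst 2 E ℝ).measurable.comp hx
    have hsnd : Measurable fun ω => (x ω).snd := (WithLp.continuous_snd 2 E ℝ).measurable.comp hx
    exact (measurable_const.sub (measurable_netPayoff
      (continuousOn_univ.1 (hc.continuousOn isOpen_univ)).measurable hG hD hfst)).ennreal_ofReal.add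
        (hL.lsc.measurable.comp (hsnd.sub (hG.add (hfst.inner hD))))
  convex ω := convexOn_socialLoss hL.convex hc C (G ω) (D ω)
  lsc ω := lowerSemicontinuous_socialLoss hL.lsc
    (continuousOn_univ.1 (hc.continuousOn isOpen_univ)) C (G ω) (D ω)

theorem exists_bounded_coe_sub_eq {Λ : Ω → ℝ≥0∞} (hΛ : Measurable[m] Λ) {C₁ : ℝ}
    (hΛ_le : ∀ᵐ ω ∂μ, Λ ω ≤ ENNReal.ofReal C₁) (C : ℝ) :
    ∃ ρ : Ω → ℝ, Measurable[m] ρ ∧ (∃ K, ∀ ω, |ρ ω| ≤ K) ∧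
      ∀ᵐ ω ∂μ, (C : EReal) - (Λ ω : EReal) = ρ ω := by
  refine ⟨fun ω => C - (min (Λ ω) (ENNReal.ofReal C₁)).toReal,
    measurable_const.sub (hΛ.min measurable_const).ennreal_toReal,
    ⟨|C| + (ENNReal.ofReal C₁).toReal, fun ω => ?_⟩, ?_⟩
  · refine (abs_sub _ _).trans (add_le_add_right ?_ _)
    rw [abs_of_nonneg ENNReal.toReal_nonneg]
    exact ENNReal.toReal_mono ENNReal.ofReal_ne_top (min_le_right _ _)
  · filter_upwards [hΛ_le] with ω hω
    rw [min_eq_left hω, EReal.coe_sub,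
      EReal.coe_ennreal_toReal (ne_top_of_le_ne_top ENNReal.ofReal_ne_top hω)]

variable [IsFiniteMeasure μ] {κ κG C : ℝ}

theorem exists_socialLoss_minimizer (hm : m ≤ mΩ) (hL : IsLossExcess L)
    (hL_growth : HasLinearGrowth L) (hc : ConvexOn ℝ Set.univ c) (hG : Measurable G)
    (hD : Measurable D) (hGκ : ∀ ω, |G ω| ≤ κG) (hDκ : ∀ ω, ‖D ω‖ ≤ κ)
    (hC : ∀ {g : ℝ} {d : E}, |g| ≤ κG → ‖d‖ ≤ κ → ∀ b, ‖b‖ ≤ C - netPayoff c g d b) :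
    ∃ (x : Ω → WithLp 2 (E × ℝ)) (K C₁ : ℝ), Measurable[m] x ∧ (∀ ω, ‖x ω‖ ≤ K) ∧
      (∀ᵐ ω ∂μ, condLExp m μ (fun ω => socialLoss L c C (G ω) (D ω) (x ω)) ω ≤
        ENNReal.ofReal C₁) ∧
      ∀ y : Ω → WithLp 2 (E × ℝ), Measurable[m] y →
        condLExp m μ (fun ω => socialLoss L c C (G ω) (D ω) (x ω)) ≤ᵐ[μ]
          condLExp m μ fun ω => socialLoss L c C (G ω) (D ω) (y ω) := by
  obtain ⟨x₀, C₁, hx₀⟩ := exists_socialLoss_le hL c C κG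
  obtain ⟨K, hK⟩ := exists_ofReal_le_socialLoss hL_growth hC C₁
  obtain ⟨x, hx, hxK, hmin⟩ := (isConvexIntegrand_socialLoss hL hc hG hD C
    ).exists_measurable_condLExp_minimizer (μ := μ) hm ENNReal.ofReal_ne_top (le_max_left ‖x₀‖ K)
      (.of_forall fun ω => hx₀ (D ω) (hGκ ω))
      (.of_forall fun ω x hx => hK (hGκ ω) (hDκ ω) x ((le_max_right _ _).trans_lt hx))
  refine ⟨x, _, C₁, hx, hxK, ?_, hmin⟩
  filter_upwards [hmin (fun _ => x₀) measurable_const, condLExp_mono (mΩ := m) (P := μ)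
    (.of_forall fun ω => hx₀ (D ω) (hGκ ω))] with ω hω hω₀
  refine (hω.trans hω₀).trans_eq ?_
  rw [condLExp_const hm]

theorem exists_optimal_effort (hm : m ≤ mΩ) (hL : IsLossExcess L)
    (hL_growth : HasLinearGrowth L) (hc : ConvexOn ℝ Set.univ c)
    (hc_superlinear : Tendsto (fun a => c a / ‖a‖) (Bornology.cobounded E) atTop)
    (hG : Measurable G) (hD : Measurable D) (hGκ : ∀ ω, |G ω| ≤ κG) (hDκ : ∀ ω, ‖D ω‖ ≤ κ) :
    ∃ (a : Ω → E) (σ ρ : Ω → ℝ) (C : ℝ), Measurable[m] a ∧ Measurable[m] σ ∧ Measurable[m] ρ ∧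
      (∃ K, ∀ ω, ‖a ω‖ ≤ K) ∧ (∃ K, ∀ ω, |σ ω| ≤ K) ∧ (∃ K, ∀ ω, |ρ ω| ≤ K) ∧
      (∀ ω b, netPayoff c (G ω) (D ω) b ≤ C) ∧
      (∀ᵐ ω ∂μ, (C : EReal) -
        (condLoss m μ L C (fun ω => netPayoff c (G ω) (D ω) (a ω)) σ ω : EReal) = ρ ω) ∧
      ∀ (b : Ω → E) (τ : Ω → ℝ), Measurable[m] b → Measurable[m] τ → ∀ᵐ ω ∂μ, (C : EReal) -
        (condLoss m μ L C (fun ω => netPayoff c (G ω) (D ω) (b ω)) τ ω : EReal) ≤ ρ ω := by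
  have hc_cont : Continuous c := continuousOn_univ.1 (hc.continuousOn isOpen_univ)
  obtain ⟨C, hC⟩ := exists_norm_le_sub_netPayoff hc_cont hc_superlinear κ κG
  obtain ⟨x, K, C₁, hx, hxK, hx_le, hmin⟩ :=
    exists_socialLoss_minimizer (μ := μ) hm hL hL_growth hc hG hD hGκ hDκ hC
  obtain ⟨ρ, hρ, hρ_bdd, hρ_eq⟩ :=
    exists_bounded_coe_sub_eq (measurable_condLExp m μ _) hx_le C
  have ha : Measurable[m] fun ω => (x ω).fst :=
    (WithLp.continuous_fst 2 E ℝ).measurable.comp hx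
  have haK : ∀ ω, ‖(x ω).fst‖ ≤ K := fun ω => (WithLp.norm_fst_le _ _).trans (hxK ω)
  obtain ⟨B, hB⟩ :=
    (isCompact_closedBall (0 : E) K).exists_bound_of_continuousOn hc_cont.continuousOn
  have hσ_bdd : ∀ ω, |(x ω).snd - c (x ω).fst| ≤ K + B := fun ω => (abs_sub _ _).trans
    (add_le_add ((WithLp.norm_snd_le _ _).trans (hxK ω))
      (hB _ (mem_closedBall_zero_iff.2 (haK ω))))
  have hcondLoss : ∀ (b : Ω → E) (τ : Ω → ℝ),
      condLoss m μ L C (fun ω => netPayoff c (G ω) (D ω) (b ω)) τ = condLExp m μ fun ω =>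
        socialLoss L c C (G ω) (D ω) (WithLp.toLp 2 (b ω, τ ω + c (b ω))) := fun b τ => by
    simp only [condLoss, socialLoss_toLp]
  refine ⟨fun ω => (x ω).fst, fun ω => (x ω).snd - c (x ω).fst, ρ, C, ha,
    ((WithLp.continuous_snd 2 E ℝ).measurable.comp hx).sub (hc_cont.measurable.comp ha), hρ,
    ⟨K, haK⟩, ⟨_, hσ_bdd⟩, hρ_bdd,
    fun ω b => sub_nonneg.1 ((norm_nonneg b).trans (hC (hGκ ω) (hDκ ω) b)), ?_,
    fun b τ hb hτ => ?_⟩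
  · simp only [hcondLoss, sub_add_cancel]
    exact hρ_eq
  · filter_upwards [hρ_eq, hmin (fun ω => WithLp.toLp 2 (b ω, τ ω + c (b ω)))
      ((WithLp.prod_continuous_toLp 2 E ℝ).measurable.comp
        (hb.prodMk (hτ.add (hc_cont.measurable.comp hb))))] with ω hω hle
    rw [← hω, hcondLoss]
    exact EReal.sub_le_sub le_rfl (EReal.coe_ennreal_le_coe_ennreal_iff.2 hle)

end OptimalEffort

section RiskSharing

theorem norm_indicator_norm_le_le {α F : Type*} [SeminormedAddGroup F] (f : α → F) (r : ℝ) (x : α) :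
    ‖{y | ‖f y‖ ≤ r}.indicator f x‖ ≤ |r| := by
  rcases le_or_gt ‖f x‖ r with h | h
  · exact (norm_indicator_le_norm_self f x).trans (h.trans (le_abs_self r))
  · rw [Set.indicator_of_notMem (show x ∉ {y | ‖f y‖ ≤ r} from h.not_ge), norm_zero]
    exact abs_nonneg r

variable {Ω E : Type*} {m m' mΩ : MeasurableSpace Ω} {μ : Measure Ω} [IsFiniteMeasure μ]
  {H₁ H₂ : ℝ → EReal}

theorem oceStep_sub_le (hm : m ≤ mΩ) (hH₁ : IsLossFunction H₁) (hH₂ : IsLossFunction H₂)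
    {V ρ : Ω → ℝ} {K C : ℝ} (hV : Measurable V) (hVK : ∀ ω, |V ω| ≤ K) (hVC : ∀ ω, V ω ≤ C)
    (hρ : Measurable[m] ρ)
    (h : ∀ s : ℝ, ∀ᵐ ω ∂μ, (C : EReal) -
      (condLoss m μ (infConv (lossExcess H₁) (lossExcess H₂)) C V (fun _ => s) ω : EReal) ≤ ρ ω)
    {Y : Ω → EReal} (hY : Measurable Y) :
    ∀ᵐ ω ∂μ, oceStep m μ H₁ (fun ω => (V ω : EReal) - Y ω) ω ≤
      (ρ ω : EReal) - oceStep m μ H₂ Y ω := by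
  refine oceStep_coe_sub_le hm hH₁ hV hVK (fun X hX ⟨B, hB⟩ => ?_) hY
  exact oceBounded_sub_le hm hH₁ hH₂ hV hX hVC
    ⟨K + B, Set.forall_mem_range.2 fun ω => (le_abs_self _).trans
      ((abs_sub _ _).trans (add_le_add (hVK ω) (hB ω)))⟩
    ⟨B, Set.forall_mem_range.2 fun ω => (le_abs_self _).trans (hB ω)⟩ hρ h

theorem oceStep_comp_le_of_forall_bounded [NormedAddCommGroup E] [MeasurableSpace E]
    [OpensMeasurableSpace E] (hm : m ≤ mΩ) (hH₁ : IsLossFunction H₁) {V : Ω → E → EReal}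
    (hV : ∀ b : Ω → E, Measurable[m] b → Measurable fun ω => V ω (b ω)) {R : Ω → EReal}
    (h : ∀ b : Ω → E, Measurable[m] b → (∃ K, ∀ ω, ‖b ω‖ ≤ K) →
      ∀ᵐ ω ∂μ, oceStep m μ H₁ (fun ω => V ω (b ω)) ω ≤ R ω)
    {b : Ω → E} (hb : Measurable[m] b) :
    ∀ᵐ ω ∂μ, oceStep m μ H₁ (fun ω => V ω (b ω)) ω ≤ R ω := by
  have hlocal : ∀ j : ℕ, ∀ᵐ ω ∂μ, ‖b ω‖ ≤ j →
      oceStep m μ H₁ (fun ω => V ω (b ω)) ω ≤ R ω := fun j => by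
    let A : Set Ω := {ω | ‖b ω‖ ≤ j}
    have hA : MeasurableSet[m] A := (measurable_norm.comp hb) measurableSet_Iic
    have hb' : Measurable[m] (A.indicator b) := hb.indicator hA
    filter_upwards [h _ hb' ⟨|j|, norm_indicator_norm_le_le b j⟩,
      oceStep_mono_on (μ := μ) hm hH₁ (hV b hb) (hV _ hb') hA
        (.of_forall fun ω hω => by rw [Set.indicator_of_mem hω])] with ω hω hmono hωA
    exact (hmono hωA).trans hω
  filter_upwards [ae_all_iff.2 hlocal] with ω hω
  obtain ⟨j, hj⟩ := exists_nat_ge ‖b ω‖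
  exact hω j hj

variable [NormedAddCommGroup E] [InnerProductSpace ℝ E] [FiniteDimensional ℝ E]
  [MeasurableSpace E] [BorelSpace E] {c : E → ℝ} {D : Ω → E} {G : Ω → ℝ} {κ κG : ℝ}

theorem exists_net_risk_sharing (hmm' : m ≤ m') (hm' : m' ≤ mΩ) (hH₁ : IsLossFunction H₁)
    (hH₁_growth : HasLinearGrowth (lossExcess H₁)) (hH₂ : IsLossFunction H₂)
    (hH₂_growth : HasLinearGrowth (lossExcess H₂)) (hc : ConvexOn ℝ Set.univ c)
    (hc_superlinear : Tendsto (fun a => c a / ‖a‖) (Bornology.cobounded E) atTop)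
    (hG : Measurable[m'] G) (hD : Measurable[m'] D) (hGκ : ∀ ω, |G ω| ≤ κG)
    (hDκ : ∀ ω, ‖D ω‖ ≤ κ) :
    ∃ (a : Ω → E) (X ρ : Ω → ℝ), Measurable[m] a ∧ Measurable[m'] X ∧ Measurable[m] ρ ∧
      (∃ K, ∀ ω, |ρ ω| ≤ K) ∧ (∀ᵐ ω ∂μ, oceStep m μ H₂ (fun ω => (X ω : EReal)) ω = 0) ∧
      (∀ᵐ ω ∂μ, oceStep m μ H₁
        (fun ω => ((netPayoff c (G ω) (D ω) (a ω) - X ω : ℝ) : EReal)) ω = (ρ ω : EReal)) ∧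
      ∀ b : Ω → E, Measurable[m] b → ∀ Y : Ω → EReal, Measurable Y → ∀ᵐ ω ∂μ,
        oceStep m μ H₁ (fun ω => (netPayoff c (G ω) (D ω) (b ω) : EReal) - Y ω) ω ≤
          (ρ ω : EReal) - oceStep m μ H₂ Y ω := by
  have hm : m ≤ mΩ := hmm'.trans hm'
  have hc_cont : Continuous c := continuousOn_univ.1 (hc.continuousOn isOpen_univ)
  have hV : ∀ {b : Ω → E}, Measurable[m] b →
      Measurable[m'] fun ω => netPayoff c (G ω) (D ω) (b ω) := fun hb =>
    measurable_netPayoff hc_cont.measurable hG hD (hb.mono hmm' le_rfl)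
  obtain ⟨a, σ, ρ, C, ha, hσ, hρ, ha_bdd, ⟨Kσ, hσK⟩, hρ_bdd, hC, heq, hle⟩ :=
    exists_optimal_effort (μ := μ) hm (isLossExcess_infConv hH₁.isLossExcess hH₁_growth
      hH₂.isLossExcess) (hasLinearGrowth_infConv hH₁_growth hH₂_growth) hc hc_superlinear
      (hG.mono hm' le_rfl) (hD.mono hm' le_rfl) hGκ hDκ
  obtain ⟨Ka, hKa⟩ := exists_abs_netPayoff_le hc_cont hGκ hDκ ha_bdd
  obtain ⟨X, hX, hX_eq, hVX_eq⟩ := exists_optimal_transfer hmm' hm' hH₁ hH₁_growth hH₂ (hV ha) hσ hρ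
    (fun ω => (hKa ω).trans (le_max_left Ka Kσ)) (fun ω => (hσK ω).trans (le_max_right Ka Kσ))
    (fun ω => hC ω _) heq fun s => hle a _ ha measurable_const
  refine ⟨a, X, ρ, ha, hX, hρ, hρ_bdd, hX_eq, hVX_eq, fun b hb Y hY => ?_⟩
  refine oceStep_comp_le_of_forall_bounded
    (V := fun ω e => (netPayoff c (G ω) (D ω) e : EReal) - Y ω)
    (R := fun ω => (ρ ω : EReal) - oceStep m μ H₂ Y ω) hm hH₁
    (fun b hb => (measurable_coe_real_ereal.comp ((hV hb).mono hm' le_rfl)).sub hY)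
    (fun b hb hb_bdd => ?_) hb
  obtain ⟨K, hK⟩ := exists_abs_netPayoff_le hc_cont hGκ hDκ hb_bdd
  exact oceStep_sub_le hm hH₁ hH₂ ((hV hb).mono hm' le_rfl) hK (fun ω => hC ω _) hρ
    (fun s => hle b _ hb measurable_const) hY

theorem oceStep_payoff_sub_congr (hm : m ≤ mΩ) (hH₁ : IsLossFunction H₁) (hc : Measurable c)
    (hG : Measurable G) (hD : Measurable D) {D' : Ω → E} (hD' : Measurable D') (hD'D : D' =ᵐ[μ] D)
    {b : Ω → E} (hb : Measurable b) {Y : Ω → EReal} (hY : Measurable Y) :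
    oceStep m μ H₁ (fun ω => ((G ω + inner ℝ (b ω) (D ω) : ℝ) : EReal) - Y ω) =ᵐ[μ]
      oceStep m μ H₁ fun ω => (netPayoff c (G ω) (D' ω) (b ω) : EReal) -
        (Y ω - (c (b ω) : EReal)) := by
  refine oceStep_congr hm hH₁ ((measurable_coe_real_ereal.comp (hG.add (hb.inner hD))).sub hY)
    ((measurable_coe_real_ereal.comp (measurable_netPayoff hc hG hD' hb)).sub
      (hY.sub (measurable_coe_real_ereal.comp (hc.comp hb)))) ?_
  filter_upwards [hD'D] with ω hω
  rw [hω, ← coe_sub_sub_coe_sub (netPayoff c (G ω) (D ω) (b ω)), netPayoff, sub_sub_cancel]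

theorem exists_risk_sharing (hmm' : m ≤ m') (hm' : m' ≤ mΩ) (hH₁ : IsLossFunction H₁)
    (hH₁_growth : HasLinearGrowth (lossExcess H₁)) (hH₂ : IsLossFunction H₂)
    (hH₂_growth : HasLinearGrowth (lossExcess H₂)) (hc : ConvexOn ℝ Set.univ c)
    (hc_superlinear : Tendsto (fun a => c a / ‖a‖) (Bornology.cobounded E) atTop)
    (hG : Measurable[m'] G) (hD : Measurable[m'] D) (hGκ : ∀ ω, |G ω| ≤ κG)
    (hDκ : ∀ᵐ ω ∂μ, ‖D ω‖ ≤ κ) :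
    ∃ (a : Ω → E) (X ρ : Ω → ℝ), Measurable[m] a ∧ Measurable[m'] X ∧ Measurable[m] ρ ∧
      (∃ K, ∀ ω, |ρ ω| ≤ K) ∧
      (∀ᵐ ω ∂μ, oceStep m μ H₂ (fun ω => (X ω : EReal)) ω = (c (a ω) : EReal)) ∧
      (∀ᵐ ω ∂μ, oceStep m μ H₁
        (fun ω => ((G ω + inner ℝ (a ω) (D ω) - X ω : ℝ) : EReal)) ω = (ρ ω : EReal)) ∧
      ∀ b : Ω → E, Measurable[m] b → ∀ Y : Ω → EReal, Measurable Y → ∀ᵐ ω ∂μ,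
        oceStep m μ H₁ (fun ω => ((G ω + inner ℝ (b ω) (D ω) : ℝ) : EReal) - Y ω) ω ≤
          ((ρ ω + c (b ω) : ℝ) : EReal) - oceStep m μ H₂ Y ω := by
  have hm : m ≤ mΩ := hmm'.trans hm'
  have hc_meas : Measurable c := (continuousOn_univ.1 (hc.continuousOn isOpen_univ)).measurable
  let D' : Ω → E := {ω | ‖D ω‖ ≤ κ}.indicator D
  have hD' : Measurable[m'] D' := hD.indicator ((measurable_norm.comp hD) measurableSet_Iic)
  have hD'D : D' =ᵐ[μ] D := hDκ.mono fun ω hω =>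
    Set.indicator_of_mem (show ω ∈ {ω | ‖D ω‖ ≤ κ} from hω) D
  have hnet {b : Ω → E} (hb : Measurable[m] b) {Y : Ω → EReal} (hY : Measurable Y) :=
    oceStep_payoff_sub_congr hm hH₁ hc_meas (hG.mono hm' le_rfl)
      (hD.mono hm' le_rfl) (hD'.mono hm' le_rfl) hD'D (hb.mono hm le_rfl) hY
  obtain ⟨a, X, ρ, ha, hX, hρ, hρ_bdd, hX_eq, hVX_eq, hle⟩ := exists_net_risk_sharing (μ := μ)
    hmm' hm' hH₁ hH₁_growth hH₂ hH₂_growth hc hc_superlinear hG hD' hGκ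
    (norm_indicator_norm_le_le D κ)
  have hca : Measurable[m] fun ω => c (a ω) := hc_meas.comp ha
  have hXc : Measurable[m'] fun ω => X ω + c (a ω) := hX.add (hca.mono hmm' le_rfl)
  refine ⟨a, fun ω => X ω + c (a ω), ρ, ha, hXc, hρ, hρ_bdd, ?_, ?_, fun b hb Y hY => ?_⟩
  · filter_upwards [hX_eq, oceStep_add (μ := μ) (X := fun ω => (X ω : EReal)) hm hH₂
      (measurable_coe_real_ereal.comp (hX.mono hm' le_rfl)) hca] with ω hω hshift
    simp only [EReal.coe_add, hshift, hω, zero_add]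
  · filter_upwards [hVX_eq, hnet ha (Y := fun ω => ((X ω + c (a ω) : ℝ) : EReal))
      (measurable_coe_real_ereal.comp (hXc.mono hm' le_rfl))] with ω hω hnet
    simp only [← EReal.coe_sub, add_sub_cancel_right] at hnet
    rw [hnet, hω]
  · have hcb : Measurable[m] fun ω => c (b ω) := hc_meas.comp hb
    filter_upwards [hnet hb hY, hle b hb (fun ω => Y ω - (c (b ω) : EReal))
      (hY.sub (measurable_coe_real_ereal.comp (hcb.mono hm le_rfl))),
      oceStep_add (μ := μ) hm hH₂ hY hcb.neg] with ω hnet hω hshift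
    simp only [Pi.neg_apply, EReal.coe_neg, ← sub_eq_add_neg] at hshift
    rw [hnet, ← coe_sub_sub_coe_sub (ρ ω), add_sub_cancel_left, ← hshift]
    exact hω

end RiskSharing

/-! ### Pasted utilities -/

theorem exists_backward_recursion {α : Type*} (T : ℕ) {Q : ℕ → α → Prop} {S : ℕ → α → α → Prop}
    {x₀ : α} (h0 : Q T x₀) (hstep : ∀ t < T, ∀ x, Q (t + 1) x → ∃ y, Q t y ∧ S t y x) :
    ∃ f : ℕ → α, f T = x₀ ∧ (∀ t ≤ T, Q t (f t)) ∧ ∀ t < T, S t (f t) (f (t + 1)) := by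
  suffices h : ∀ t ≤ T, ∃ f : ℕ → α, f T = x₀ ∧ (∀ s, t ≤ s → s ≤ T → Q s (f s)) ∧
      ∀ s, t ≤ s → s < T → S s (f s) (f (s + 1)) by
    simpa using h 0 (Nat.zero_le T)
  intro t ht
  induction ht using Nat.decreasingInduction with
  | self =>
    exact ⟨fun _ => x₀, rfl, fun s hTs hsT => hsT.antisymm hTs ▸ h0,
      fun s hTs hsT => absurd hsT hTs.not_gt⟩
  | of_succ t ht ih =>
    obtain ⟨f, hfT, hQ, hS⟩ := ih
    obtain ⟨y, hQy, hSy⟩ := hstep t ht _ (hQ (t + 1) le_rfl ht)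
    refine ⟨Function.update f t y, by rwa [Function.update_of_ne ht.ne'], fun s hts hsT => ?_,
      fun s hts hsT => ?_⟩ <;> rcases hts.eq_or_lt with rfl | hts
    · rwa [Function.update_self]
    · rw [Function.update_of_ne hts.ne']
      exact hQ s hts hsT
    · rwa [Function.update_self, Function.update_of_ne (Nat.succ_ne_self t)]
    · rw [Function.update_of_ne hts.ne', Function.update_of_ne (hts.trans s.lt_succ_self).ne']
      exact hS s hts hsT

theorem pasteSteps_congr {Ω : Type*} {u u' : ℕ → (Ω → EReal) → (Ω → EReal)} {k t : ℕ}
    (h : ∀ s, t ≤ s → s < t + k → u s = u' s) : pasteSteps u k t = pasteSteps u' k t := by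
  induction k generalizing t with
  | zero => rfl
  | succ k ih =>
    ext1 X
    rw [pasteSteps, pasteSteps, ih fun s hs hsk => h s (by omega) (by omega),
      h t le_rfl (by omega)]

section OceUtility

variable {Ω : Type*} {mΩ : MeasurableSpace Ω} {μ : Measure Ω}
  {𝒢 : ℕ → MeasurableSpace Ω} {T : ℕ} {H : ℕ → ℝ → EReal}

theorem oceUtility_self (X : Ω → EReal) : oceUtility μ 𝒢 T H T X = X := by
  rw [oceUtility, Nat.sub_self, pasteSteps]

theorem oceUtility_of_lt {t : ℕ} (ht : t < T) (X : Ω → EReal) :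
    oceUtility μ 𝒢 T H t X = oceStep (𝒢 t) μ (H t) (oceUtility μ 𝒢 T H (t + 1) X) := by
  rw [oceUtility, oceUtility, show T - t = (T - (t + 1)) + 1 by omega, pasteSteps]

variable [IsFiniteMeasure μ]

theorem measurable_oceUtility (h𝒢 : ∀ t < T, 𝒢 t ≤ mΩ) {X : Ω → EReal} (hX : Measurable X)
    {t : ℕ} (ht : t ≤ T) : Measurable (oceUtility μ 𝒢 T H t X) := by
  rcases ht.eq_or_lt with rfl | ht
  · rwa [oceUtility_self]
  · rw [oceUtility_of_lt ht]
    exact (measurable_oceStep (h𝒢 t ht) _).mono (h𝒢 t ht) le_rfl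

theorem oceUtility_le (h𝒢 : ∀ t < T, 𝒢 t ≤ mΩ) (hH : ∀ t < T, IsLossFunction (H t))
    {J : ℕ → Ω → EReal} (hJ : ∀ t ≤ T, Measurable (J t))
    (hstep : ∀ t < T, oceStep (𝒢 t) μ (H t) (J (t + 1)) ≤ᵐ[μ] J t)
    {t : ℕ} (ht : t ≤ T) : oceUtility μ 𝒢 T H t (J T) ≤ᵐ[μ] J t := by
  induction ht using Nat.decreasingInduction with
  | self => rw [oceUtility_self]
  | of_succ t ht ih =>
    rw [oceUtility_of_lt ht]
    exact (oceStep_mono (h𝒢 t ht) (hH t ht) (measurable_oceUtility h𝒢 (hJ T le_rfl) ht)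
      (hJ _ ht) ih).trans (hstep t ht)

theorem le_oceUtility (h𝒢 : ∀ t < T, 𝒢 t ≤ mΩ) (hH : ∀ t < T, IsLossFunction (H t))
    {J : ℕ → Ω → EReal} (hJ : ∀ t ≤ T, Measurable (J t))
    (hstep : ∀ t < T, J t ≤ᵐ[μ] oceStep (𝒢 t) μ (H t) (J (t + 1)))
    {t : ℕ} (ht : t ≤ T) : J t ≤ᵐ[μ] oceUtility μ 𝒢 T H t (J T) := by
  induction ht using Nat.decreasingInduction with
  | self => rw [oceUtility_self]
  | of_succ t ht ih =>
    rw [oceUtility_of_lt ht]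
    exact (hstep t ht).trans (oceStep_mono (h𝒢 t ht) (hH t ht) (hJ _ ht)
      (measurable_oceUtility h𝒢 (hJ T le_rfl) ht) ih)

theorem oceUtility_of_measurable (h𝒢 : ∀ t < T, 𝒢 t ≤ mΩ) (h𝒢_mono : ∀ t < T, 𝒢 t ≤ 𝒢 (t + 1))
    (hH : ∀ t < T, IsLossFunction (H t)) {X : Ω → EReal} (hXΩ : Measurable X) {t : ℕ} (ht : t ≤ T)
    (hX : Measurable[𝒢 t] X) : oceUtility μ 𝒢 T H t X =ᵐ[μ] X := by
  induction ht using Nat.decreasingInduction with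
  | self => rw [oceUtility_self]
  | of_succ t ht ih =>
    rw [oceUtility_of_lt ht]
    exact (oceStep_congr (h𝒢 t ht) (hH t ht) (measurable_oceUtility h𝒢 hXΩ ht) hXΩ
      (ih (hX.mono (h𝒢_mono t ht) le_rfl))).trans (oceStep_of_measurable (h𝒢 t ht) (hH t ht) hX)

end OceUtility

/-! ### Gains and utilities in the Principal-Agent model -/

theorem coe_sub_add_coe_add_coe (x y z : ℝ) (v : EReal) :
    (x : EReal) - (v + (z : EReal)) + (y : EReal) = ((x + y - z : ℝ) : EReal) - v := by
  induction v with
  | bot => rw [EReal.bot_add, EReal.coe_sub_bot, EReal.coe_sub_bot, EReal.top_add_coe]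
  | top => rw [EReal.top_add_coe, EReal.sub_top, EReal.sub_top, EReal.bot_add]
  | coe v =>
    norm_cast
    ring

namespace PAModel

variable {Ω : Type*} {N : ℕ} (M : PAModel Ω N)

theorem wealth_succ (A : ℕ → Ω → EuclideanSpace ℝ (Fin N)) (t : ℕ) (ω : Ω) :
    M.wealth A (t + 1) ω = M.wealth A t ω + M.gain t (A t) ω := by
  rw [wealth, wealth, Finset.sum_range_succ, add_assoc]

/-- The simple returns `diag(P_t)⁻¹ (P_{t+1} - P_t)` of the stocks between `t` and `t + 1`. -/
noncomputable def returns (t : ℕ) (ω : Ω) : EuclideanSpace ℝ (Fin N) :=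
  WithLp.toLp 2 fun i => (M.P (t + 1) ω i - M.P t ω i) / M.P t ω i

theorem gain_eq_inner (t : ℕ) (a : Ω → EuclideanSpace ℝ (Fin N)) (ω : Ω) :
    M.gain t a ω = inner ℝ (a ω) (M.returns t ω) := by
  simp only [gain, PiLp.inner_apply, returns, RCLike.inner_apply, conj_trivial, mul_comm]

theorem norm_returns_le {K : ℝ} {t : ℕ} {ω : Ω}
    (h : ∀ i, 0 < M.P t ω i ∧ |M.P (t + 1) ω i - M.P t ω i| ≤ K * M.P t ω i) :
    ‖M.returns t ω‖ ≤ √(∑ _i : Fin N, K ^ 2) := by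
  rw [EuclideanSpace.norm_eq]
  gcongr with i
  obtain ⟨hpos, hle⟩ := h i
  rwa [returns, Real.norm_eq_abs, abs_div, abs_of_pos hpos, div_le_iff₀ hpos]

/-- The part `∑_{s < t} β_s (W^A_{s+1} - W^A_s)` of the gains up to time `t` that the contract
passes on to the Agent. -/
noncomputable def sharedGains (β : ℕ → Ω → ℝ) (A : ℕ → Ω → EuclideanSpace ℝ (Fin N)) (t : ℕ)
    (ω : Ω) : ℝ :=
  ∑ s ∈ Finset.range t, β s ω * M.gain s (A s) ω

/-- The shared gains up to time `t` less the costs of the efforts made until then. -/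
noncomputable def netGains (β : ℕ → Ω → ℝ) (A : ℕ → Ω → EuclideanSpace ℝ (Fin N)) (t : ℕ)
    (ω : Ω) : ℝ :=
  M.sharedGains β A t ω - ∑ s ∈ Finset.range t, M.c s (A s ω)

theorem payment_eq (Θ : Ω → ℝ) (β : ℕ → Ω → ℝ) (A : ℕ → Ω → EuclideanSpace ℝ (Fin N)) (ω : Ω) :
    M.payment Θ β A ω = Θ ω + M.sharedGains β A M.T ω := by
  simp only [payment, sharedGains, wealth_succ, add_sub_cancel_left]

theorem payment_one (Θ : Ω → ℝ) (A : ℕ → Ω → EuclideanSpace ℝ (Fin N)) (ω : Ω) :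
    M.payment Θ (fun _ _ => 1) A ω = Θ ω + (M.wealth A M.T ω - M.W₀) := by
  simp only [payment_eq, sharedGains, wealth, one_mul, add_sub_cancel_left]

theorem payment_sub_cost_eq (Θ : Ω → ℝ) (β : ℕ → Ω → ℝ) (A : ℕ → Ω → EuclideanSpace ℝ (Fin N))
    (ω : Ω) : M.payment Θ β A ω - M.cost A ω = Θ ω + M.netGains β A M.T ω := by
  rw [payment_eq, cost, netGains, add_sub_assoc]

theorem netGains_succ (β : ℕ → Ω → ℝ) (A : ℕ → Ω → EuclideanSpace ℝ (Fin N)) (t : ℕ) (ω : Ω) :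
    M.netGains β A (t + 1) ω =
      β t ω * M.gain t (A t) ω + (M.netGains β A t ω - M.c t (A t ω)) := by
  simp only [netGains, sharedGains, Finset.sum_range_succ]
  ring

section Measurability

variable {M}

theorem priceInfo_mono {s t : ℕ} (h : s ≤ t) : M.priceInfo s ≤ M.priceInfo t :=
  iSup_le fun r => iSup_le fun hr => le_iSup₂_of_le r (hr.trans h) le_rfl

theorem priceInfo_le {mΩ : MeasurableSpace Ω} (hP : ∀ t ≤ M.T, Measurable (M.P t)) {t : ℕ}
    (ht : t ≤ M.T) : M.priceInfo t ≤ mΩ :=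
  iSup₂_le fun s hs => (hP s (hs.trans ht)).comap_le

theorem measurable_of_priceInfo_succ {γ : Type*} [MeasurableSpace γ] {t : ℕ} {f : Ω → γ}
    (hf : Measurable[M.priceInfo t] f) : Measurable[M.priceInfo (t + 1)] f :=
  hf.mono (priceInfo_mono t.le_succ) le_rfl

variable (M) in
theorem measurable_returns (t : ℕ) : Measurable[M.priceInfo (t + 1)] (M.returns t) := by
  have hcoord : ∀ s ≤ t + 1, ∀ i, Measurable[M.priceInfo (t + 1)] fun ω => M.P s ω i :=
    fun s hs i => (measurable_pi_apply i).comp ((PiLp.continuous_ofLp 2 _).measurable.comp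
      (Measurable.of_comap_le (le_iSup₂_of_le s hs le_rfl)))
  refine (PiLp.continuous_toLp 2 _).measurable.comp
    (@measurable_pi_lambda _ _ _ (M.priceInfo (t + 1)) _ _ fun i => ?_)
  exact ((hcoord _ le_rfl i).sub (hcoord _ t.le_succ i)).div (hcoord _ t.le_succ i)

theorem measurable_gain {t : ℕ} {a : Ω → EuclideanSpace ℝ (Fin N)}
    (ha : Measurable[M.priceInfo t] a) : Measurable[M.priceInfo (t + 1)] (M.gain t a) := by
  rw [show M.gain t a = _ from funext (M.gain_eq_inner t a)]
  exact (ha.mono (priceInfo_mono t.le_succ) le_rfl).inner (M.measurable_returns t)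

theorem measurable_sum_range {x : ℕ → Ω → ℝ} {t : ℕ}
    (hx : ∀ s < t, Measurable[M.priceInfo (s + 1)] (x s)) :
    Measurable[M.priceInfo t] fun ω => ∑ s ∈ Finset.range t, x s ω :=
  Finset.measurable_fun_sum _ fun s hs =>
    (hx s (Finset.mem_range.1 hs)).mono (priceInfo_mono (Finset.mem_range.1 hs)) le_rfl

theorem IsEffort.measurable_wealth {A : ℕ → Ω → EuclideanSpace ℝ (Fin N)} (hA : M.IsEffort A)
    {t : ℕ} (ht : t ≤ M.T) : Measurable[M.priceInfo t] (M.wealth A t) :=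
  measurable_const.add (measurable_sum_range fun s hs => measurable_gain (hA s (hs.trans_le ht)))

theorem IsEffort.measurable_sharedGains {β : ℕ → Ω → ℝ} {A : ℕ → Ω → EuclideanSpace ℝ (Fin N)}
    (hA : M.IsEffort A) (hβ : ∀ t < M.T, Measurable[M.priceInfo t] (β t)) {t : ℕ} (ht : t ≤ M.T) :
    Measurable[M.priceInfo t] (M.sharedGains β A t) :=
  measurable_sum_range fun s hs => (measurable_of_priceInfo_succ (hβ s (hs.trans_le ht))).mul
    (measurable_gain (hA s (hs.trans_le ht)))

theorem IsEffort.measurable_netGains {β : ℕ → Ω → ℝ} {A : ℕ → Ω → EuclideanSpace ℝ (Fin N)}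
    (hA : M.IsEffort A) (hβ : ∀ t < M.T, Measurable[M.priceInfo t] (β t))
    (hc : ∀ t < M.T, Measurable (M.c t)) {t : ℕ} (ht : t ≤ M.T) :
    Measurable[M.priceInfo t] (M.netGains β A t) :=
  (hA.measurable_sharedGains hβ ht).sub (measurable_sum_range fun s hs =>
    measurable_of_priceInfo_succ ((hc s (hs.trans_le ht)).comp (hA s (hs.trans_le ht))))

theorem IsEffort.principalInfo_eq {A : ℕ → Ω → EuclideanSpace ℝ (Fin N)} (hA : M.IsEffort A)
    {t : ℕ} (ht : t ≤ M.T) : M.principalInfo A t = M.priceInfo t :=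
  sup_eq_left.2 (iSup₂_le fun _ hs =>
    ((hA.measurable_wealth (hs.trans ht)).mono (priceInfo_mono hs) le_rfl).comap_le)

theorem exists_eq_function_of_path {Θ : Ω → ℝ} (hΘ : Measurable[M.priceInfo M.T] Θ) :
    ∃ d : (Fin (M.T + 1) → EuclideanSpace ℝ (Fin N)) → ℝ, Measurable d ∧
      ∀ ω, Θ ω = d fun s => M.P (s : ℕ) ω := by
  let path : Ω → Fin (M.T + 1) → EuclideanSpace ℝ (Fin N) := fun ω s => M.P (s : ℕ) ω
  have hle : M.priceInfo M.T ≤ MeasurableSpace.comap path inferInstance :=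
    iSup₂_le fun s hs => Measurable.comap_le <|
      (measurable_pi_apply (⟨s, by omega⟩ : Fin (M.T + 1))).comp (comap_measurable path)
  obtain ⟨d, hd, h⟩ := (hΘ.mono hle le_rfl).exists_eq_measurable_comp
  exact ⟨d, hd, congrFun h⟩

variable {mΩ : MeasurableSpace Ω} {μ : Measure Ω}

theorem IsEffort.principalU_eq {A : ℕ → Ω → EuclideanSpace ℝ (Fin N)} (hA : M.IsEffort A)
    (X : Ω → EReal) : M.principalU μ A 0 X = oceUtility μ M.priceInfo M.T M.Hp 0 X :=
  congrFun (pasteSteps_congr fun s _ hs => by rw [hA.principalInfo_eq (by omega)]) X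

theorem IsAgentValue.measurable {Θ : Ω → ℝ} {β : ℕ → Ω → ℝ} {V : ℕ → Ω → EReal}
    (hV : M.IsAgentValue μ Θ β V) (hΘ : Measurable[M.priceInfo M.T] Θ) {t : ℕ} (ht : t ≤ M.T) :
    Measurable[M.priceInfo t] (V t) := by
  rcases ht.eq_or_lt with rfl | ht
  · rw [show V M.T = fun ω => (Θ ω : EReal) from funext hV.1]
    exact measurable_coe_real_ereal.comp hΘ
  · exact (hV.2 t ht).measurable

end Measurability

end PAModel

/-! ### Bounds on the utilities of the Agent and of the Principal -/

namespace PAModel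

variable {Ω : Type*} {N : ℕ} {M : PAModel Ω N} {mΩ : MeasurableSpace Ω} {μ : Measure Ω}
  [IsFiniteMeasure μ]

section Agent

variable {Θ : Ω → ℝ} {β : ℕ → Ω → ℝ} {V : ℕ → Ω → EReal} {B : ℕ → Ω → EuclideanSpace ℝ (Fin N)}

theorem measurable_add_gain {t : ℕ} {X : Ω → EReal} (hX : Measurable[M.priceInfo (t + 1)] X)
    {b : Ω → ℝ} (hb : Measurable[M.priceInfo t] b) {a : Ω → EuclideanSpace ℝ (Fin N)}
    (ha : Measurable[M.priceInfo t] a) :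
    Measurable[M.priceInfo (t + 1)] fun ω => X ω + ((b ω * M.gain t a ω : ℝ) : EReal) :=
  hX.add (measurable_coe_real_ereal.comp
    ((measurable_of_priceInfo_succ hb).mul (measurable_gain ha)))

theorem agentObjective_ae_eq (hP : ∀ t ≤ M.T, Measurable (M.P t))
    (hHa : ∀ t < M.T, IsLossFunction (M.Ha t)) {t : ℕ} (ht : t < M.T) {X : Ω → EReal}
    (hX : Measurable[M.priceInfo (t + 1)] X) {b : Ω → ℝ} (hb : Measurable[M.priceInfo t] b)
    {a : Ω → EuclideanSpace ℝ (Fin N)} (ha : Measurable[M.priceInfo t] a) :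
    ∀ᵐ ω ∂μ, M.agentObjective μ t X b a ω =
      oceStep (M.priceInfo t) μ (M.Ha t)
        (fun ω' => X ω' + ((b ω' * M.gain t a ω' : ℝ) : EReal)) ω - (M.c t (a ω) : EReal) := by
  have h𝒢 : ∀ s < M.T, M.priceInfo s ≤ mΩ := fun s hs => priceInfo_le hP hs.le
  have hY := measurable_add_gain hX hb ha
  have hYΩ := hY.mono (priceInfo_le hP ht) le_rfl
  filter_upwards [oceStep_congr (h𝒢 t ht) (hHa t ht) (measurable_oceUtility h𝒢 hYΩ ht) hYΩ
    (oceUtility_of_measurable (μ := μ) h𝒢 (fun s _ => priceInfo_mono s.le_succ) hHa hYΩ ht hY)]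
    with ω hω
  rw [agentObjective, agentU, oceUtility_of_lt ht, hω]

theorem oceStep_add_netGains (hP : ∀ t ≤ M.T, Measurable (M.P t))
    (hHa : ∀ t < M.T, IsLossFunction (M.Ha t)) (hc : ∀ t < M.T, Measurable (M.c t))
    (hV : ∀ t ≤ M.T, Measurable[M.priceInfo t] (V t))
    (hβ : ∀ t < M.T, Measurable[M.priceInfo t] (β t)) (hB : M.IsEffort B) {t : ℕ} (ht : t < M.T) :
    ∀ᵐ ω ∂μ, oceStep (M.priceInfo t) μ (M.Ha t)
        (fun ω => V (t + 1) ω + (M.netGains β B (t + 1) ω : EReal)) ω =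
      M.agentObjective μ t (V (t + 1)) (β t) (B t) ω + (M.netGains β B t ω : EReal) := by
  have hY := measurable_add_gain (hV (t + 1) ht) (hβ t ht) (hB t ht)
  have hr : Measurable[M.priceInfo t] fun ω => M.netGains β B t ω - M.c t (B t ω) :=
    (hB.measurable_netGains hβ hc ht.le).sub ((hc t ht).comp (hB t ht))
  simp only [netGains_succ, EReal.coe_add, ← add_assoc]
  filter_upwards [agentObjective_ae_eq (μ := μ) hP hHa ht (hV (t + 1) ht) (hβ t ht) (hB t ht),
    oceStep_add (μ := μ) (priceInfo_le hP ht.le) (hHa t ht) (hY.mono (priceInfo_le hP ht) le_rfl)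
      hr] with ω hobj hshift
  rw [hobj, hshift, EReal.coe_sub, sub_eq_add_neg, sub_eq_add_neg, add_assoc, add_comm (-_)]

theorem measurable_add_netGains (hP : ∀ t ≤ M.T, Measurable (M.P t))
    (hc : ∀ t < M.T, Measurable (M.c t)) (hV : ∀ t ≤ M.T, Measurable[M.priceInfo t] (V t))
    (hβ : ∀ t < M.T, Measurable[M.priceInfo t] (β t)) (hB : M.IsEffort B) {t : ℕ} (ht : t ≤ M.T) :
    Measurable fun ω => V t ω + (M.netGains β B t ω : EReal) :=
  ((hV t ht).add (measurable_coe_real_ereal.comp (hB.measurable_netGains hβ hc ht))).mono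
    (priceInfo_le hP ht) le_rfl

theorem coe_payment_sub_cost (hΘ : ∀ ω, V M.T ω = (Θ ω : EReal)) :
    (fun ω => ((M.payment Θ β B ω - M.cost B ω : ℝ) : EReal)) =
      fun ω => V M.T ω + (M.netGains β B M.T ω : EReal) :=
  funext fun ω => by rw [hΘ, ← EReal.coe_add, payment_sub_cost_eq]

theorem agentU_le_value (hP : ∀ t ≤ M.T, Measurable (M.P t))
    (hHa : ∀ t < M.T, IsLossFunction (M.Ha t)) (hc : ∀ t < M.T, Measurable (M.c t))
    (hΘ : ∀ ω, V M.T ω = (Θ ω : EReal)) (hV : ∀ t ≤ M.T, Measurable[M.priceInfo t] (V t))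
    (hβ : ∀ t < M.T, Measurable[M.priceInfo t] (β t)) (hB : M.IsEffort B)
    (hobj : ∀ t < M.T, M.agentObjective μ t (V (t + 1)) (β t) (B t) ≤ᵐ[μ] V t) :
    M.agentU μ 0 (fun ω => ((M.payment Θ β B ω - M.cost B ω : ℝ) : EReal)) ≤ᵐ[μ] V 0 := by
  rw [coe_payment_sub_cost hΘ]
  refine (oceUtility_le (J := fun t ω => V t ω + (M.netGains β B t ω : EReal))
    (fun s hs => priceInfo_le hP hs.le) hHa (fun t => measurable_add_netGains hP hc hV hβ hB)
    (fun t ht => ?_) (Nat.zero_le _)).trans (.of_forall fun ω => by simp [netGains, sharedGains])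
  filter_upwards [oceStep_add_netGains (μ := μ) hP hHa hc hV hβ hB ht, hobj t ht] with ω hstep hle
  rw [hstep]
  gcongr

theorem value_le_agentU (hP : ∀ t ≤ M.T, Measurable (M.P t))
    (hHa : ∀ t < M.T, IsLossFunction (M.Ha t)) (hc : ∀ t < M.T, Measurable (M.c t))
    (hΘ : ∀ ω, V M.T ω = (Θ ω : EReal)) (hV : ∀ t ≤ M.T, Measurable[M.priceInfo t] (V t))
    (hβ : ∀ t < M.T, Measurable[M.priceInfo t] (β t)) (hB : M.IsEffort B)
    (hobj : ∀ t < M.T, V t ≤ᵐ[μ] M.agentObjective μ t (V (t + 1)) (β t) (B t)) :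
    V 0 ≤ᵐ[μ] M.agentU μ 0 (fun ω => ((M.payment Θ β B ω - M.cost B ω : ℝ) : EReal)) := by
  rw [coe_payment_sub_cost hΘ]
  refine EventuallyLE.trans (.of_forall fun ω => by simp [netGains, sharedGains])
    (le_oceUtility (J := fun t ω => V t ω + (M.netGains β B t ω : EReal))
      (fun s hs => priceInfo_le hP hs.le) hHa (fun t => measurable_add_netGains hP hc hV hβ hB)
      (fun t ht => ?_) (Nat.zero_le _))
  filter_upwards [oceStep_add_netGains (μ := μ) hP hHa hc hV hβ hB ht, hobj t ht] with ω hstep hle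
  rw [hstep]
  gcongr

theorem IsAgentValue.agentOptimalUtility_le (hVal : M.IsAgentValue μ Θ β V)
    (hP : ∀ t ≤ M.T, Measurable (M.P t)) (hHa : ∀ t < M.T, IsLossFunction (M.Ha t))
    (hc : ∀ t < M.T, Measurable (M.c t)) (hΘ : Measurable[M.priceInfo M.T] Θ)
    (hβ : ∀ t < M.T, Measurable[M.priceInfo t] (β t)) :
    M.agentOptimalUtility μ Θ β ≤ᵐ[μ] V 0 := by
  refine (isEssSup_essSupFamily (priceInfo_le hP (Nat.zero_le _)) μ _).least _
    (hVal.measurable hΘ (Nat.zero_le _)) ?_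
  rintro _ ⟨B, hB, rfl⟩
  exact agentU_le_value hP hHa hc hVal.1 (fun t ht => hVal.measurable hΘ ht) hβ hB
    fun t ht => (hVal.2 t ht).le _ ⟨B t, hB t ht, rfl⟩

end Agent

section Principal

variable {G : ℕ → Ω → ℝ} {Θ : Ω → ℝ} {β : ℕ → Ω → ℝ} {V : ℕ → Ω → EReal}
  {A : ℕ → Ω → EuclideanSpace ℝ (Fin N)}

/-- If Principal and Agent share the payoff `G` at time `t + 1` together with the gains of the
period, then the sum of their one-step utilities, net of the cost of effort, is at most `ρ`,
whatever the effort `b` and the amount `Y` that goes to the Agent. -/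
def IsSocialBound (M : PAModel Ω N) (μ : Measure Ω) (t : ℕ) (G ρ : Ω → ℝ) : Prop :=
  ∀ b : Ω → EuclideanSpace ℝ (Fin N), Measurable[M.priceInfo t] b →
    ∀ Y : Ω → EReal, Measurable Y → ∀ᵐ ω ∂μ,
      oceStep (M.priceInfo t) μ (M.Hp t)
          (fun ω => ((G ω + M.gain t b ω : ℝ) : EReal) - Y ω) ω ≤
        ((ρ ω + M.c t (b ω) : ℝ) : EReal) - oceStep (M.priceInfo t) μ (M.Ha t) Y ω

/-- What the Principal can still hope for at time `t` under a contract with shares `β` and Agent's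
value process `V`, if the effort `A` is made and `G` bounds the social surplus of the future. -/
noncomputable def residualSurplus (M : PAModel Ω N) (G : ℕ → Ω → ℝ) (β : ℕ → Ω → ℝ)
    (V : ℕ → Ω → EReal) (A : ℕ → Ω → EuclideanSpace ℝ (Fin N)) (t : ℕ) (ω : Ω) : EReal :=
  ((M.wealth A t ω + G t ω - M.sharedGains β A t ω : ℝ) : EReal) - V t ω

theorem residualSurplus_succ (t : ℕ) (ω : Ω) :
    M.residualSurplus G β V A (t + 1) ω =
      ((G (t + 1) ω + M.gain t (A t) ω : ℝ) : EReal) -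
        (V (t + 1) ω + ((β t ω * M.gain t (A t) ω : ℝ) : EReal)) +
        ((M.wealth A t ω - M.sharedGains β A t ω : ℝ) : EReal) := by
  rw [coe_sub_add_coe_add_coe, residualSurplus, wealth_succ, sharedGains, Finset.sum_range_succ,
    ← sharedGains]
  congr 2
  ring

theorem measurable_residualSurplus (hP : ∀ t ≤ M.T, Measurable (M.P t))
    (hG : ∀ t ≤ M.T, Measurable[M.priceInfo t] (G t))
    (hV : ∀ t ≤ M.T, Measurable[M.priceInfo t] (V t))
    (hβ : ∀ t < M.T, Measurable[M.priceInfo t] (β t)) (hA : M.IsEffort A) {t : ℕ} (ht : t ≤ M.T) :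
    Measurable (M.residualSurplus G β V A t) :=
  ((measurable_coe_real_ereal.comp (((hA.measurable_wealth ht).add (hG t ht)).sub
    (hA.measurable_sharedGains hβ ht))).sub (hV t ht)).mono (priceInfo_le hP ht) le_rfl

theorem oceStep_residualSurplus_le (hP : ∀ t ≤ M.T, Measurable (M.P t))
    (hHa : ∀ t < M.T, IsLossFunction (M.Ha t)) (hHp : ∀ t < M.T, IsLossFunction (M.Hp t))
    (hG : ∀ t ≤ M.T, Measurable[M.priceInfo t] (G t))
    (hV : ∀ t ≤ M.T, Measurable[M.priceInfo t] (V t))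
    (hβ : ∀ t < M.T, Measurable[M.priceInfo t] (β t)) (hA : M.IsEffort A) {t : ℕ} (ht : t < M.T)
    (hG_bound : M.IsSocialBound μ t (G (t + 1)) (G t))
    (hobj : M.agentObjective μ t (V (t + 1)) (β t) (A t) =ᵐ[μ] V t) :
    oceStep (M.priceInfo t) μ (M.Hp t) (M.residualSurplus G β V A (t + 1)) ≤ᵐ[μ]
      M.residualSurplus G β V A t := by
  have hY := measurable_add_gain (hV (t + 1) ht) (hβ t ht) (hA t ht)
  have hr : Measurable[M.priceInfo t] fun ω => M.wealth A t ω - M.sharedGains β A t ω :=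
    (hA.measurable_wealth ht.le).sub (hA.measurable_sharedGains hβ ht.le)
  rw [show M.residualSurplus G β V A (t + 1) = _ from funext (residualSurplus_succ t)]
  filter_upwards [hobj,
    oceStep_add (μ := μ) (priceInfo_le hP ht.le) (hHp t ht) (((measurable_coe_real_ereal.comp
      ((hG (t + 1) ht).add (measurable_gain (hA t ht)))).sub hY).mono (priceInfo_le hP ht) le_rfl)
      hr,
    hG_bound (A t) (hA t ht) _ (hY.mono (priceInfo_le hP ht) le_rfl),
    agentObjective_ae_eq (μ := μ) hP hHa ht (hV (t + 1) ht) (hβ t ht) (hA t ht)]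
    with ω hobj hshift hbound hagent
  rw [← EReal.sub_add_cancel (a := oceStep _ _ (M.Ha t) _ _) (b := M.c t (A t ω)), ← hagent, hobj]
    at hbound
  refine hshift.trans_le ((add_le_add_left hbound _).trans_eq ?_)
  rw [coe_sub_add_coe_add_coe, residualSurplus]
  congr 2
  ring

theorem principalUtility_le (hP : ∀ t ≤ M.T, Measurable (M.P t))
    (hHa : ∀ t < M.T, IsLossFunction (M.Ha t)) (hHp : ∀ t < M.T, IsLossFunction (M.Hp t))
    (hGT : G M.T = 0) (hG : ∀ t ≤ M.T, Measurable[M.priceInfo t] (G t))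
    (hG_bound : ∀ t < M.T, M.IsSocialBound μ t (G (t + 1)) (G t))
    (hΘ : ∀ ω, V M.T ω = (Θ ω : EReal)) (hV : ∀ t ≤ M.T, Measurable[M.priceInfo t] (V t))
    (hβ : ∀ t < M.T, Measurable[M.priceInfo t] (β t)) (hA : M.IsEffort A)
    (hobj : ∀ t < M.T, M.agentObjective μ t (V (t + 1)) (β t) (A t) =ᵐ[μ] V t) :
    M.principalUtility μ Θ β A ≤ᵐ[μ] fun ω => ((M.W₀ + G 0 ω : ℝ) : EReal) - V 0 ω := by
  have hterminal : (fun ω => ((M.wealth A M.T ω - M.payment Θ β A ω : ℝ) : EReal)) =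
      M.residualSurplus G β V A M.T := by
    ext ω
    rw [residualSurplus, hΘ, ← EReal.coe_sub, payment_eq, hGT, Pi.zero_apply, add_zero, sub_sub,
      add_comm (Θ ω)]
  rw [principalUtility, hA.principalU_eq, hterminal]
  exact (oceUtility_le (fun t ht => priceInfo_le hP ht.le) hHp
    (fun t => measurable_residualSurplus hP hG hV hβ hA) (fun t ht => oceStep_residualSurplus_le
      hP hHa hHp hG hV hβ hA ht (hG_bound t ht) (hobj t ht)) (Nat.zero_le _)).trans
    (.of_forall fun ω => by simp [residualSurplus, wealth, sharedGains])

end Principal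

end PAModel

/-! ### Efficient risk sharing and the optimal contract -/

namespace PAModel

variable {Ω : Type*} {N : ℕ} {mΩ : MeasurableSpace Ω}

/-- The effort `a` and the transfer `X` to the Agent share the payoff `G` at time `t + 1` and the
gains of the period efficiently: the transfer just compensates the Agent for the cost of effort, and
leaves the Principal with the whole social surplus `ρ`. -/
structure IsEfficientStep (M : PAModel Ω N) (μ : Measure Ω) (t : ℕ)
    (a : Ω → EuclideanSpace ℝ (Fin N)) (X G ρ : Ω → ℝ) : Prop where
  measurable_effort : Measurable[M.priceInfo t] a
  measurable_transfer : Measurable[M.priceInfo (t + 1)] X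
  agent : ∀ᵐ ω ∂μ,
    oceStep (M.priceInfo t) μ (M.Ha t) (fun ω => (X ω : EReal)) ω = (M.c t (a ω) : EReal)
  principal : ∀ᵐ ω ∂μ, oceStep (M.priceInfo t) μ (M.Hp t)
    (fun ω => ((G ω + M.gain t a ω - X ω : ℝ) : EReal)) ω = (ρ ω : EReal)
  socialBound : M.IsSocialBound μ t G ρ

/-- Efforts `A` and transfers `X` that share the gains efficiently in each period, where `G t` is
the social surplus of the periods from time `t` on. -/
structure IsEfficientSharing (M : PAModel Ω N) (μ : Measure Ω) (G X : ℕ → Ω → ℝ)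
    (A : ℕ → Ω → EuclideanSpace ℝ (Fin N)) : Prop where
  terminal : G M.T = 0
  measurable_surplus : ∀ t ≤ M.T, Measurable[M.priceInfo t] (G t)
  step : ∀ t < M.T, M.IsEfficientStep μ t (A t) (X t) (G (t + 1)) (G t)

variable {M : PAModel Ω N} {μ : Measure Ω}

/-- The utility promised to the Agent at time `t` by the contract with `β = 1` that supports the
efforts `A` with the transfers `X`: the reservation utility plus the transfers made so far, less the
gains that the Agent keeps. -/
noncomputable def promisedUtility (M : PAModel Ω N) (X : ℕ → Ω → ℝ)
    (A : ℕ → Ω → EuclideanSpace ℝ (Fin N)) (t : ℕ) (ω : Ω) : ℝ :=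
  M.R + ∑ s ∈ Finset.range t, (X s ω - M.gain s (A s) ω)

theorem promisedUtility_zero (X : ℕ → Ω → ℝ) (A : ℕ → Ω → EuclideanSpace ℝ (Fin N)) (ω : Ω) :
    M.promisedUtility X A 0 ω = M.R := by
  rw [promisedUtility, Finset.sum_range_zero, add_zero]

theorem promisedUtility_succ (X : ℕ → Ω → ℝ) (A : ℕ → Ω → EuclideanSpace ℝ (Fin N)) (t : ℕ)
    (ω : Ω) : M.promisedUtility X A (t + 1) ω =
      X t ω - M.gain t (A t) ω + M.promisedUtility X A t ω := by
  rw [promisedUtility, promisedUtility, Finset.sum_range_succ]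
  ring

namespace IsEfficientSharing

variable {G X : ℕ → Ω → ℝ} {A : ℕ → Ω → EuclideanSpace ℝ (Fin N)}

theorem isEffort (h : M.IsEfficientSharing μ G X A) : M.IsEffort A :=
  fun t ht => (h.step t ht).measurable_effort

theorem measurable_promisedUtility (h : M.IsEfficientSharing μ G X A) {t : ℕ} (ht : t ≤ M.T) :
    Measurable[M.priceInfo t] (M.promisedUtility X A t) :=
  measurable_const.add (measurable_sum_range fun s hs =>
    (h.step s (hs.trans_le ht)).measurable_transfer.sub
      (measurable_gain (h.isEffort s (hs.trans_le ht))))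

theorem measurable_transfer_add_gain_sub (h : M.IsEfficientSharing μ G X A) {t : ℕ} (ht : t < M.T)
    {b : Ω → EuclideanSpace ℝ (Fin N)} (hb : Measurable[M.priceInfo t] b) :
    Measurable[M.priceInfo (t + 1)] fun ω =>
      ((X t ω + M.gain t b ω - M.gain t (A t) ω : ℝ) : EReal) :=
  measurable_coe_real_ereal.comp (((h.step t ht).measurable_transfer.add (measurable_gain hb)).sub
    (measurable_gain (h.isEffort t ht)))

variable [IsFiniteMeasure μ]

theorem agentObjective_promisedUtility (h : M.IsEfficientSharing μ G X A)
    (hP : ∀ t ≤ M.T, Measurable (M.P t)) (hHa : ∀ t < M.T, IsLossFunction (M.Ha t))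
    {t : ℕ} (ht : t < M.T)
    {b : Ω → EuclideanSpace ℝ (Fin N)} (hb : Measurable[M.priceInfo t] b) :
    ∀ᵐ ω ∂μ,
      M.agentObjective μ t (fun ω => (M.promisedUtility X A (t + 1) ω : EReal)) (fun _ => 1) b ω =
        oceStep (M.priceInfo t) μ (M.Ha t)
          (fun ω => ((X t ω + M.gain t b ω - M.gain t (A t) ω : ℝ) : EReal)) ω +
          ((M.promisedUtility X A t ω - M.c t (b ω) : ℝ) : EReal) := by
  have hpayoff : ∀ ω, (M.promisedUtility X A (t + 1) ω : EReal) + ((1 * M.gain t b ω : ℝ) : EReal) =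
      ((X t ω + M.gain t b ω - M.gain t (A t) ω : ℝ) : EReal) +
        (M.promisedUtility X A t ω : EReal) := fun ω => by
    rw [promisedUtility_succ, ← EReal.coe_add, ← EReal.coe_add]
    congr 1
    ring
  filter_upwards [agentObjective_ae_eq (μ := μ) hP hHa ht
      (X := fun ω => (M.promisedUtility X A (t + 1) ω : EReal))
      (measurable_coe_real_ereal.comp (h.measurable_promisedUtility ht))
      (b := fun _ => 1) measurable_const hb,
    oceStep_add (μ := μ) (priceInfo_le hP ht.le) (hHa t ht)
      ((h.measurable_transfer_add_gain_sub ht hb).mono (priceInfo_le hP ht) le_rfl)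
      (h.measurable_promisedUtility ht.le)] with ω hobj hshift
  simp only [hpayoff] at hobj
  rw [hobj, hshift, EReal.coe_sub, sub_eq_add_neg, sub_eq_add_neg, add_assoc]

theorem agentObjective_le_promisedUtility (h : M.IsEfficientSharing μ G X A)
    (hP : ∀ t ≤ M.T, Measurable (M.P t)) (hHa : ∀ t < M.T, IsLossFunction (M.Ha t))
    {t : ℕ} (ht : t < M.T)
    {b : Ω → EuclideanSpace ℝ (Fin N)} (hb : Measurable[M.priceInfo t] b) :
    M.agentObjective μ t (fun ω => (M.promisedUtility X A (t + 1) ω : EReal)) (fun _ => 1) b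
      ≤ᵐ[μ] fun ω => (M.promisedUtility X A t ω : EReal) := by
  have hpayoff : ∀ ω, ((G (t + 1) ω + M.gain t b ω : ℝ) : EReal) -
      ((X t ω + M.gain t b ω - M.gain t (A t) ω : ℝ) : EReal) =
        ((G (t + 1) ω + M.gain t (A t) ω - X t ω : ℝ) : EReal) := fun ω => by
    rw [← EReal.coe_sub]
    congr 1
    ring
  filter_upwards [h.agentObjective_promisedUtility hP hHa ht hb, (h.step t ht).principal,
    (h.step t ht).socialBound b hb _
      ((h.measurable_transfer_add_gain_sub ht hb).mono (priceInfo_le hP ht) le_rfl)]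
    with ω hobj hprincipal hbound
  simp only [hpayoff] at hbound
  rw [hprincipal] at hbound
  have hagent := le_coe_sub_comm hbound
  rw [← EReal.coe_sub, add_sub_cancel_left] at hagent
  rw [hobj]
  refine (add_le_add_left hagent _).trans_eq ?_
  rw [← EReal.coe_add, add_sub_cancel]

theorem agentObjective_eq_promisedUtility (h : M.IsEfficientSharing μ G X A)
    (hP : ∀ t ≤ M.T, Measurable (M.P t)) (hHa : ∀ t < M.T, IsLossFunction (M.Ha t))
    {t : ℕ} (ht : t < M.T) :
    M.agentObjective μ t (fun ω => (M.promisedUtility X A (t + 1) ω : EReal)) (fun _ => 1) (A t)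
      =ᵐ[μ] fun ω => (M.promisedUtility X A t ω : EReal) := by
  filter_upwards [h.agentObjective_promisedUtility hP hHa ht (h.isEffort t ht),
    (h.step t ht).agent] with ω hobj hagent
  simp only [hobj, add_sub_cancel_right, hagent]
  rw [← EReal.coe_add, add_sub_cancel]

theorem isAgentValue (h : M.IsEfficientSharing μ G X A)
    (hP : ∀ t ≤ M.T, Measurable (M.P t)) (hHa : ∀ t < M.T, IsLossFunction (M.Ha t)) :
    M.IsAgentValue μ (M.promisedUtility X A M.T) (fun _ _ => 1)
      fun t ω => (M.promisedUtility X A t ω : EReal) := by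
  refine ⟨fun ω => rfl, fun t ht => ⟨measurable_coe_real_ereal.comp
    (h.measurable_promisedUtility ht.le), ?_, fun g' _ hg' => ?_⟩⟩
  · rintro _ ⟨b, hb, rfl⟩
    exact h.agentObjective_le_promisedUtility hP hHa ht hb
  · exact (h.agentObjective_eq_promisedUtility hP hHa ht).symm.le.trans
      (hg' _ ⟨A t, h.isEffort t ht, rfl⟩)

theorem agentOptimalUtility_eq (h : M.IsEfficientSharing μ G X A)
    (hP : ∀ t ≤ M.T, Measurable (M.P t)) (hHa : ∀ t < M.T, IsLossFunction (M.Ha t))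
    (hc : ∀ t < M.T, Measurable (M.c t)) :
    M.agentOptimalUtility μ (M.promisedUtility X A M.T) (fun _ _ => 1) =ᵐ[μ]
      fun _ => (M.R : EReal) := by
  have hV := h.isAgentValue hP hHa
  have hΘ := h.measurable_promisedUtility le_rfl
  have hattained := value_le_agentU hP hHa hc hV.1 (fun t ht => hV.measurable hΘ ht)
    (fun _ _ => measurable_const) h.isEffort
    fun t ht => (h.agentObjective_eq_promisedUtility hP hHa ht).symm.le
  have hle := hV.agentOptimalUtility_le hP hHa hc hΘ fun _ _ => measurable_const
  simp only [promisedUtility_zero] at hattained hle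
  exact hle.antisymm (hattained.trans
    ((isEssSup_essSupFamily (priceInfo_le hP (Nat.zero_le _)) μ _).le _ ⟨A, h.isEffort, rfl⟩))

theorem oceStep_surplus_sub_promisedUtility (h : M.IsEfficientSharing μ G X A)
    (hP : ∀ t ≤ M.T, Measurable (M.P t)) {t : ℕ} (ht : t < M.T) (hHp : IsLossFunction (M.Hp t)) :
    oceStep (M.priceInfo t) μ (M.Hp t)
        (fun ω => ((M.W₀ + G (t + 1) ω - M.promisedUtility X A (t + 1) ω : ℝ) : EReal)) =ᵐ[μ]
      fun ω => ((M.W₀ + G t ω - M.promisedUtility X A t ω : ℝ) : EReal) := by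
  have hsplit : ∀ ω, ((M.W₀ + G (t + 1) ω - M.promisedUtility X A (t + 1) ω : ℝ) : EReal) =
      ((G (t + 1) ω + M.gain t (A t) ω - X t ω : ℝ) : EReal) +
        ((M.W₀ - M.promisedUtility X A t ω : ℝ) : EReal) := fun ω => by
    rw [promisedUtility_succ, ← EReal.coe_add]
    congr 1
    ring
  have hshare : Measurable[M.priceInfo (t + 1)]
      fun ω => G (t + 1) ω + M.gain t (A t) ω - X t ω :=
    ((h.measurable_surplus (t + 1) ht).add (measurable_gain (h.isEffort t ht))).sub
      (h.step t ht).measurable_transfer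
  filter_upwards [(h.step t ht).principal, oceStep_add (μ := μ)
    (X := fun ω => ((G (t + 1) ω + M.gain t (A t) ω - X t ω : ℝ) : EReal))
    (r := fun ω => M.W₀ - M.promisedUtility X A t ω) (priceInfo_le hP ht.le) hHp
    (measurable_coe_real_ereal.comp (hshare.mono (priceInfo_le hP ht) le_rfl))
    (measurable_const.sub (h.measurable_promisedUtility ht.le))] with ω hprincipal hshift
  simp only [hsplit, hshift, hprincipal]
  rw [← EReal.coe_add]
  congr 1
  ring

theorem principalUtility_eq (h : M.IsEfficientSharing μ G X A)
    (hP : ∀ t ≤ M.T, Measurable (M.P t)) (hHp : ∀ t < M.T, IsLossFunction (M.Hp t)) :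
    M.principalUtility μ (M.promisedUtility X A M.T) (fun _ _ => 1) A =ᵐ[μ]
      fun ω => ((M.W₀ + G 0 ω - M.R : ℝ) : EReal) := by
  let J : ℕ → Ω → EReal := fun t ω => ((M.W₀ + G t ω - M.promisedUtility X A t ω : ℝ) : EReal)
  have hJ : ∀ t ≤ M.T, Measurable (J t) := fun t ht => (measurable_coe_real_ereal.comp
    ((measurable_const.add (h.measurable_surplus t ht)).sub
      (h.measurable_promisedUtility ht))).mono (priceInfo_le hP ht) le_rfl
  have hJ_step : ∀ t < M.T, oceStep (M.priceInfo t) μ (M.Hp t) (J (t + 1)) =ᵐ[μ] J t :=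
    fun t ht => h.oceStep_surplus_sub_promisedUtility hP ht (hHp t ht)
  have hJ_zero : J 0 = fun ω => ((M.W₀ + G 0 ω - M.R : ℝ) : EReal) := by
    simp only [J, promisedUtility_zero]
  have hJ_terminal : (fun ω => ((M.wealth A M.T ω -
      M.payment (M.promisedUtility X A M.T) (fun _ _ => 1) A ω : ℝ) : EReal)) = J M.T := by
    ext ω
    simp only [J, payment_one, h.terminal, Pi.zero_apply]
    congr 1
    ring
  rw [principalUtility, h.isEffort.principalU_eq, hJ_terminal, ← hJ_zero]
  exact (oceUtility_le (fun t ht => priceInfo_le hP ht.le) hHp hJ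
    (fun t ht => (hJ_step t ht).le) (Nat.zero_le _)).antisymm
    (le_oceUtility (fun t ht => priceInfo_le hP ht.le) hHp hJ
      (fun t ht => (hJ_step t ht).symm.le) (Nat.zero_le _))

theorem isOptimalContract (h : M.IsEfficientSharing μ G X A)
    (hP : ∀ t ≤ M.T, Measurable (M.P t)) (hHa : ∀ t < M.T, IsLossFunction (M.Ha t))
    (hHp : ∀ t < M.T, IsLossFunction (M.Hp t)) (hc : ∀ t < M.T, Measurable (M.c t)) :
    M.IsOptimalContract μ (M.promisedUtility X A M.T) (fun _ _ => 1) A where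
  incentiveCompatible := ⟨h.measurable_promisedUtility le_rfl, h.isEffort,
    fun _ _ => measurable_const, _, h.isAgentValue hP hHa,
    fun _ ht => h.agentObjective_eq_promisedUtility hP hHa ht⟩
  individuallyRational := (h.agentOptimalUtility_eq hP hHa hc).symm.le
  optimal Θ' β' A' hIC hIR := by
    obtain ⟨V', hV', hattained⟩ := hIC.attained
    have hβ' : ∀ t < M.T, Measurable[M.priceInfo t] (β' t) := fun t ht => by
      rw [← hIC.effort.principalInfo_eq ht.le]
      exact hIC.share_measurable t ht
    filter_upwards [principalUtility_le hP hHa hHp h.terminal h.measurable_surplus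
        (fun t ht => (h.step t ht).socialBound) hV'.1
        (fun t ht => hV'.measurable hIC.payment_measurable ht) hβ' hIC.effort hattained,
      hIR, hV'.agentOptimalUtility_le hP hHa hc hIC.payment_measurable hβ',
      h.principalUtility_eq hP hHp] with ω hprincipal hreserve hagent hown
    rw [hown, EReal.coe_sub]
    exact hprincipal.trans (EReal.sub_le_sub le_rfl (hreserve.trans hagent))

end IsEfficientSharing

variable [IsFiniteMeasure μ]

theorem exists_isEfficientStep (hP : ∀ t ≤ M.T, Measurable (M.P t)) {t : ℕ} (ht : t < M.T) {K : ℝ}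
    (hK : ∀ i, ∀ᵐ ω ∂μ, 0 < M.P t ω i ∧ |M.P (t + 1) ω i - M.P t ω i| ≤ K * M.P t ω i)
    (hc : ConvexOn ℝ Set.univ (M.c t))
    (hc_superlinear : Tendsto (fun a : EuclideanSpace ℝ (Fin N) => M.c t a / ‖a‖)
      (Bornology.cobounded (EuclideanSpace ℝ (Fin N))) atTop)
    (hHa : IsLossFunction (M.Ha t)) (hHp : IsLossFunction (M.Hp t))
    (hHa_one : (1 : ℝ) ∈ interior {y : ℝ | convexConj (M.Ha t) y < ⊤})
    (hHp_one : (1 : ℝ) ∈ interior {y : ℝ | convexConj (M.Hp t) y < ⊤})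
    {G : Ω → ℝ} (hG : Measurable[M.priceInfo (t + 1)] G ∧ ∃ C, ∀ ω, |G ω| ≤ C) :
    ∃ ρ : Ω → ℝ, (Measurable[M.priceInfo t] ρ ∧ ∃ C, ∀ ω, |ρ ω| ≤ C) ∧
      ∃ a X, M.IsEfficientStep μ t a X G ρ := by
  obtain ⟨hG, C, hGC⟩ := hG
  obtain ⟨a, X, ρ, ha, hX, hρ, hρ_bdd, hagent, hprincipal, hbound⟩ := exists_risk_sharing (μ := μ)
    (priceInfo_mono t.le_succ) (priceInfo_le hP ht) hHp (hHp.hasLinearGrowth_lossExcess hHp_one)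
    hHa (hHa.hasLinearGrowth_lossExcess hHa_one) hc hc_superlinear hG (M.measurable_returns t) hGC
    ((ae_all_iff.2 hK).mono fun ω => M.norm_returns_le)
  simp only [← gain_eq_inner] at hprincipal hbound
  exact ⟨ρ, ⟨hρ, hρ_bdd⟩, a, X, ha, hX, hagent, hprincipal, hbound⟩

theorem exists_isEfficientSharing (hP : ∀ t ≤ M.T, Measurable (M.P t)) {K : ℝ}
    (hK : ∀ t < M.T, ∀ i, ∀ᵐ ω ∂μ,
      0 < M.P t ω i ∧ |M.P (t + 1) ω i - M.P t ω i| ≤ K * M.P t ω i)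
    (hc : ∀ t < M.T, ConvexOn ℝ Set.univ (M.c t))
    (hc_superlinear : ∀ t < M.T, Tendsto (fun a : EuclideanSpace ℝ (Fin N) => M.c t a / ‖a‖)
      (Bornology.cobounded (EuclideanSpace ℝ (Fin N))) atTop)
    (hHa : ∀ t < M.T, IsLossFunction (M.Ha t)) (hHp : ∀ t < M.T, IsLossFunction (M.Hp t))
    (hHa_one : ∀ t < M.T, (1 : ℝ) ∈ interior {y : ℝ | convexConj (M.Ha t) y < ⊤})
    (hHp_one : ∀ t < M.T, (1 : ℝ) ∈ interior {y : ℝ | convexConj (M.Hp t) y < ⊤}) :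
    ∃ G X A, M.IsEfficientSharing μ G X A := by
  obtain ⟨G, hGT, hG, hstep⟩ := exists_backward_recursion M.T (x₀ := (0 : Ω → ℝ))
    (Q := fun t G => Measurable[M.priceInfo t] G ∧ ∃ C, ∀ ω, |G ω| ≤ C)
    ⟨measurable_const, 0, fun ω => by simp⟩ fun t ht G => exists_isEfficientStep hP ht (hK t ht)
      (hc t ht) (hc_superlinear t ht) (hHa t ht) (hHp t ht) (hHa_one t ht) (hHp_one t ht)
  choose! A X hAX using hstep
  exact ⟨G, X, A, hGT, fun t ht => (hG t ht).1, hAX⟩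

end PAModel

theorem mainTheorem3_general {Ω : Type*} {mΩ : MeasurableSpace Ω} (μ : Measure Ω)
    [IsFiniteMeasure μ] {N : ℕ} (M : PAModel Ω N)
    (hP_meas : ∀ t ≤ M.T, Measurable (M.P t)) (K : ℝ)
    (hP : ∀ t < M.T, ∀ i : Fin N, ∀ᵐ ω ∂μ,
      0 < M.P t ω i ∧ |M.P (t + 1) ω i - M.P t ω i| ≤ K * M.P t ω i)
    (hc : ∀ t < M.T, ConvexOn ℝ Set.univ (M.c t))
    (hc_superlinear : ∀ t < M.T, Tendsto (fun a : EuclideanSpace ℝ (Fin N) => M.c t a / ‖a‖)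
      (Bornology.cobounded (EuclideanSpace ℝ (Fin N))) atTop)
    (hHa : ∀ t < M.T, IsLossFunction (M.Ha t)) (hHp : ∀ t < M.T, IsLossFunction (M.Hp t))
    (hHa_one : ∀ t < M.T, (1 : ℝ) ∈ interior {y : ℝ | convexConj (M.Ha t) y < ⊤})
    (hHp_one : ∀ t < M.T, (1 : ℝ) ∈ interior {y : ℝ | convexConj (M.Hp t) y < ⊤}) :
    ∃ (d : (Fin (M.T + 1) → EuclideanSpace ℝ (Fin N)) → ℝ) (Θ : Ω → ℝ)
      (A : ℕ → Ω → EuclideanSpace ℝ (Fin N)),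
      Measurable d ∧
      M.IsOptimalContract μ Θ (fun _ _ => 1) A ∧
      (∀ (B : ℕ → Ω → EuclideanSpace ℝ (Fin N)) (ω : Ω),
        M.payment Θ (fun _ _ => 1) B ω =
          M.wealth B M.T ω - d (fun s => M.P (s : ℕ) ω)) ∧
      M.agentOptimalUtility μ Θ (fun _ _ => 1) =ᵐ[μ] (fun _ => (M.R : EReal)) ∧
      (∀ᵐ ω ∂μ, M.principalUtility μ Θ (fun _ _ => 1) A ω ≠ ⊥ ∧
        M.principalUtility μ Θ (fun _ _ => 1) A ω ≠ ⊤) := by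
  have hc_meas : ∀ t < M.T, Measurable (M.c t) := fun t ht =>
    (continuousOn_univ.1 ((hc t ht).continuousOn isOpen_univ)).measurable
  obtain ⟨G, X, A, h⟩ := PAModel.exists_isEfficientSharing hP_meas hP hc hc_superlinear hHa hHp
    hHa_one hHp_one
  obtain ⟨f, hf, hΘf⟩ := PAModel.exists_eq_function_of_path (h.measurable_promisedUtility le_rfl)
  refine ⟨fun path => M.W₀ - f path, M.promisedUtility X A M.T, A, measurable_const.sub hf,
    h.isOptimalContract hP_meas hHa hHp hc_meas, fun B ω => ?_,
    h.agentOptimalUtility_eq hP_meas hHa hc_meas, ?_⟩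
  · rw [M.payment_one, hΘf]
    ring
  · filter_upwards [h.principalUtility_eq hP_meas hHp] with ω hω
    rw [hω]
    exact ⟨EReal.coe_ne_bot _, EReal.coe_ne_top _⟩

theorem abs_sub_le_div_mul_of_mem_Icc {p q x y : ℝ} (hp : 0 < p) (hx : x ∈ Set.Icc p q)
    (hy : y ∈ Set.Icc p q) : |y - x| ≤ (q - p) / p * x := by
  have hpq : 0 ≤ q - p := sub_nonneg.2 (hx.1.trans hx.2)
  calc |y - x| ≤ q - p := abs_sub_le_of_le_of_le hy.1 hy.2 hx.1 hx.2
    _ = (q - p) / p * p := (div_mul_cancel₀ _ hp.ne').symm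
    _ ≤ (q - p) / p * x := by gcongr; exact hx.1

theorem mainTheorem3 {Ω : Type*} [mΩ : MeasurableSpace Ω] (μ : Measure Ω) [IsProbabilityMeasure μ]
    {N : ℕ} (M : PAModel Ω N)
    (hP_meas : ∀ t ≤ M.T, Measurable (M.P t))
    (pmin pmax : ℝ) (hpmin : 0 < pmin)
    (hP : ∀ t ≤ M.T, ∀ i : Fin N, ∀ᵐ ω ∂μ, pmin ≤ M.P t ω i ∧ M.P t ω i ≤ pmax)
    (hc : ∀ t < M.T, StrictConvexOn ℝ Set.univ (M.c t))
    (hc_superlinear : ∀ t < M.T,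
      Tendsto (fun a : EuclideanSpace ℝ (Fin N) => M.c t a / ‖a‖)
        (Bornology.cobounded (EuclideanSpace ℝ (Fin N))) atTop)
    (hHa : ∀ t < M.T, IsLossFunction (M.Ha t))
    (hHp : ∀ t < M.T, IsLossFunction (M.Hp t))
    (hHa_one : ∀ t < M.T, (1 : ℝ) ∈ interior {y : ℝ | convexConj (M.Ha t) y < ⊤})
    (hHp_one : ∀ t < M.T, (1 : ℝ) ∈ interior {y : ℝ | convexConj (M.Hp t) y < ⊤})
    (hHa_bdd : ∀ t < M.T, ∃ b : ℝ, ∀ s : ℝ, (b : EReal) ≤ M.Ha t s)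
    (hHp_bdd : ∀ t < M.T, ∃ b : ℝ, ∀ s : ℝ, (b : EReal) ≤ M.Hp t s) :
    ∃ (d : (Fin (M.T + 1) → EuclideanSpace ℝ (Fin N)) → ℝ) (Θ : Ω → ℝ)
      (A : ℕ → Ω → EuclideanSpace ℝ (Fin N)),
      Measurable d ∧
      M.IsOptimalContract μ Θ (fun _ _ => 1) A ∧
      (∀ (B : ℕ → Ω → EuclideanSpace ℝ (Fin N)) (ω : Ω),
        M.payment Θ (fun _ _ => 1) B ω =
          M.wealth B M.T ω - d (fun s => M.P (s : ℕ) ω)) ∧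
      M.agentOptimalUtility μ Θ (fun _ _ => 1) =ᵐ[μ] (fun _ => (M.R : EReal)) ∧
      (∀ᵐ ω ∂μ, M.principalUtility μ Θ (fun _ _ => 1) A ω ≠ ⊥ ∧
        M.principalUtility μ Θ (fun _ _ => 1) A ω ≠ ⊤) :=
  mainTheorem3_general μ M hP_meas ((pmax - pmin) / pmin)
    (fun t ht i => by
      filter_upwards [hP t ht.le i, hP (t + 1) ht i] with ω hnow hnext
      exact ⟨hpmin.trans_le hnow.1, abs_sub_le_div_mul_of_mem_Icc hpmin hnow hnext⟩)
    (fun t ht => (hc t ht).convexOn) hc_superlinear hHa hHp hHa_one hHp_one
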